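/- Let $\omega=(\omega_1,\dots,\omega_d)$ with all $\omega_j>0$. For $w\in\mathbb R^d$ let $H^{w}(x,\xi)=\sum_{j=1}^d \tfrac{w_j}{2}(\xi_j^2+x_j^2)$ on $\mathbb R^{d}\times\mathbb R^d$, let $\phi^{w}_t$ be its Hamiltonian flow (which multiplies each $z_j=x_j+i\xi_j$ by $e^{-itw_j}$), and let $\widehat H^{w}_\hbar=\sum_{j=1}^d \tfrac{w_j}{2}(-\hbar^2\partial_{x_j}^2+x_j^2)$. Write $H=H^{\omega}$. Let $S_\omega\subset\mathbb R$ be the $\mathbb Q$-linear span of $\omega_1,\dots,\omega_d$, let $d_\omega=\dim_{\mathbb Q}S_\omega$, let $v_1,\dots,v_{d_\omega}$ be a basis of $S_\omega$, and let $\nu_1,\dots,\nu_{d_\omega}\in\mathbb Q^d$ be the vectors with $\omega=\sum_n v_n\nu_n$. Put $\mathcal H_n=H^{v_n\nu_n}$, $\phi^{\mathcal H_n}_t=\phi^{v_n\nu_n}_t$, $\mathrm{Op}_\hbar(\mathcal H_n)=\widehat H_\hbar^{v_n\nu_n}$, $\mathcal H=(\mathcal H_1,\dots,\mathcal H_{d_\omega})$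 and $\Sigma_{\mathcal H}=\mathcal H(H^{-1}(1))\subset\mathbb R^{d_\omega}$. Let $T_n=2\pi k_n/[v_n\nu_n]$ be the period of $\phi^{\mathcal H_n}_t$, where $[w]=\min\{|w_j| : w_j\ne0\}$ and $k_n$ is the least positive integer with $k_n[v_n\nu_n]^{-1}v_n\nu_n\in\mathbb Z^d$. Put $\mathcal R_\omega=[0,T_1)\times\cdots\times[0,T_{d_\omega})$ and $|\mathcal R_\omega|=T_1\cdots T_{d_\omega}$. For $a\in C_c^\infty(\mathbb R^{2d})$ let $\mathrm{Op}_\hbar(a)$ be its semiclassical Weyl quantization, $$\mathrm{Op}_\hbar(a)\psi(x)=\frac1{(2\pi\hbar)^d}\int_{\mathbb R^d}\int_{\mathbb R^d}e^{\frac i\hbar(x-y)\cdot\xi}\,a\!\left(\tfrac{x+y}2,\xi\right)\psi(y)\,d\xi\,dy .$$ **Lemma.** For every $E\in\Sigma_{\mathcal H}$ there exist $\hbar_0>0$ and a family $(\Lambda_\hbar)_{0<\hbar\le\hbar_0}$ in $\mathbb R^{d_\omega}$ with $\Lambda_\hbar\to E$ as $\hbar\to0^+$ such that the following holds. For every $z_0\in\mathcal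 H^{-1}(E)$ there is a family $(\Psi_\hbar)_{0<\hbar\le\hbar_0}$ of Schwartz functions on $\mathbb R^d$ such that, for all $0<\hbar\le\hbar_0$, $$\mathrm{Op}_\hbar(\mathcal H_n)\Psi_\hbar=\Lambda_{\hbar,n}\Psi_\hbar\quad(n=1,\dots,d_\omega),\qquad \|\Psi_\hbar\|_{L^2(\mathbb R^d)}=1,$$ and, for every $a\in C_c^\infty(\mathbb R^{2d})$, $$\langle\Psi_\hbar,\mathrm{Op}_\hbar(a)\Psi_\hbar\rangle_{L^2(\mathbb R^d)}=\frac1{|\mathcal R_\omega|}\int_{\mathcal R_\omega}a\big(\phi^{\mathcal H_1}_{t_1}\circ\cdots\circ\phi^{\mathcal H_{d_\omega}}_{t_{d_\omega}}(z_0)\big)\,dt_1\cdots dt_{d_\omega}+O(\hbar^{1/2}),\qquad\hbar\to0^+ .$$ -/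

import Mathlib

open MeasureTheory Filter Topology Asymptotics
open scoped SchwartzMap LineDeriv

noncomputable section

namespace QHO

/-- Configuration space `ℝ^d` with its Euclidean structure. -/
abbrev Conf (d : ℕ) : Type := EuclideanSpace ℝ (Fin d)

/-- Phase space `T*ℝ^d = ℝ^d_x × ℝ^d_ξ`. -/
abbrev Phase (d : ℕ) : Type := Conf d × Conf d

/-! ### Classical harmonic oscillators -/

/-- The Hamiltonian `∑ j, w j * H_j` with frequency vector `w` (of arbitrary signs), where
`H_j (x, ξ) = (ξ_j ^ 2 + x_j ^ 2) / 2`. -/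
def hamiltonian {d : ℕ} (w : Fin d → ℝ) (z : Phase d) : ℝ :=
  ∑ j, w j * ((z.2 j ^ 2 + z.1 j ^ 2) / 2)

/-- The Hamiltonian flow of `hamiltonian w`: on the plane of the complex coordinate
`z_j = x_j + i ξ_j` it is multiplication by `exp (-i t w_j)`.
That it solves Hamilton's equations is `hasDerivAt_flow` below. -/
def flow {d : ℕ} (w : Fin d → ℝ) (t : ℝ) (z : Phase d) : Phase d :=
  (WithLp.toLp 2 fun j => Real.cos (t * w j) * z.1 j + Real.sin (t * w j) * z.2 j,
   WithLp.toLp 2 fun j => Real.cos (t * w j) * z.2 j - Real.sin (t * w j) * z.1 j)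

/-- The Hamiltonian vector field `(∂_ξ F, -∂_x F)` of a function `F` on phase space. -/
def hamiltonianVectorField {d : ℕ} (F : Phase d → ℝ) (z : Phase d) : Phase d :=
  (WithLp.toLp 2 fun j => fderiv ℝ F z (0, EuclideanSpace.single j 1),
   WithLp.toLp 2 fun j => -fderiv ℝ F z (EuclideanSpace.single j 1, 0))

/-- `φ_{t_1}^{w_1} ∘ ⋯ ∘ φ_{t_m}^{w_m}`: the composition of the flows with frequency vectors
`w 0, …, w (m - 1)` at the times `τ 0, …, τ (m - 1)`. -/
def multiFlow {d m : ℕ} (w : Fin m → Fin d → ℝ) (τ : Fin m → ℝ) : Phase d → Phase d :=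
  (List.ofFn fun n => flow (w n) (τ n)).foldr (fun f g => f ∘ g) id

/-- `[w]`: the least absolute value of a non-zero component of `w`. -/
def minFreq {d : ℕ} (w : Fin d → ℝ) : ℝ := sInf {r : ℝ | ∃ j, w j ≠ 0 ∧ r = |w j|}

/-- `k_w`: the least positive integer `k` such that `k [w]⁻¹ w ∈ ℤ^d`. -/
def periodIndex {d : ℕ} (w : Fin d → ℝ) : ℕ :=
  sInf {k : ℕ | 0 < k ∧ ∀ j, ∃ l : ℤ, (k : ℝ) * (minFreq w)⁻¹ * w j = l}

/-- The period `T_w = 2 π k_w / [w]` of the flow with frequency vector `w`, for `w ≠ 0` whose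
components are rationally commensurable (see `period_spec` below). -/
def period {d : ℕ} (w : Fin d → ℝ) : ℝ := 2 * Real.pi * periodIndex w / minFreq w

/-- The uniform average `|R|⁻¹ ∫_R a (φ_{t_1}^{w_1} ∘ ⋯ ∘ φ_{t_m}^{w_m} (z₀)) dt_1 ⋯ dt_m` over the
box `R = [0, T_1) × ⋯ × [0, T_m)` of the periods `T_n` of the flows. -/
def torusAverage {d m : ℕ} (w : Fin m → Fin d → ℝ) (a : Phase d → ℂ) (z₀ : Phase d) : ℂ :=
  ((∏ n, period (w n) : ℝ) : ℂ)⁻¹ *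
    ∫ τ in Set.univ.pi fun n => Set.Ico 0 (period (w n)), a (multiFlow w τ z₀)

/-! ### Frequencies -/

/-- `S_ω`: the `ℚ`-linear span of the frequencies in `ℝ`. -/
def freqSpan {d : ℕ} (ω : Fin d → ℝ) : Submodule ℚ ℝ := Submodule.span ℚ (Set.range ω)

/-- `d_ω = dim S_ω`. -/
def freqRank {d : ℕ} (ω : Fin d → ℝ) : ℕ := Module.finrank ℚ (freqSpan ω)

/-- The frequency vectors `v_n ν_n` of the periodic Hamiltonians
`𝓗_n = v_n ∑ j, ν_{n,j} H_j`, for a basis `v` of `S_ω`. -/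
def partFreq {d : ℕ} {ω : Fin d → ℝ} (v : Module.Basis (Fin (freqRank ω)) ℚ (freqSpan ω))
    (ν : Fin (freqRank ω) → Fin d → ℚ) (n : Fin (freqRank ω)) (j : Fin d) : ℝ :=
  (v n : ℝ) * (ν n j : ℝ)

/-- The map `𝓗 = (𝓗_1, …, 𝓗_{d_ω})`. -/
def momentMap {d : ℕ} {ω : Fin d → ℝ} (v : Module.Basis (Fin (freqRank ω)) ℚ (freqSpan ω))
    (ν : Fin (freqRank ω) → Fin d → ℚ) (z : Phase d) (n : Fin (freqRank ω)) : ℝ :=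
  hamiltonian (partFreq v ν n) z

/-- `Σ_𝓗 = 𝓗 (H⁻¹(1))`, the set of joint energies on the level set `H = 1`. -/
def energySet {d : ℕ} {ω : Fin d → ℝ} (v : Module.Basis (Fin (freqRank ω)) ℚ (freqSpan ω))
    (ν : Fin (freqRank ω) → Fin d → ℚ) : Set (Fin (freqRank ω) → ℝ) :=
  momentMap v ν '' {z : Phase d | hamiltonian ω z = 1}

/-! ### Semiclassical operators -/

/-- The Weyl quantization of `hamiltonian w`, the semiclassical harmonic oscillator
`∑ j, w_j (-ħ² ∂_{x_j}² + x_j²) / 2`, applied to a Schwartz function. -/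
def oscillator {d : ℕ} (w : Fin d → ℝ) (ħ : ℝ) (ψ : 𝓢(Conf d, ℂ)) (x : Conf d) : ℂ :=
  ∑ j, (w j : ℂ) / 2 *
    (-(ħ : ℂ) ^ 2 * (∂_{(EuclideanSpace.single j 1 : Conf d)}
        (∂_{(EuclideanSpace.single j 1 : Conf d)} ψ)) x
      + (x j : ℂ) ^ 2 * ψ x)

/-- The semiclassical Weyl quantization `Op_ħ(a)` of a compactly supported smooth symbol `a`:
`Op_ħ(a) ψ (x) = (2πħ)^{-d} ∫∫ e^{i (x - y)·ξ / ħ} a((x + y)/2, ξ) ψ(y) dξ dy`. -/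
def weylOp {d : ℕ} (ħ : ℝ) (a : Phase d → ℂ) (ψ : Conf d → ℂ) (x : Conf d) : ℂ :=
  (((2 * Real.pi * ħ) ^ d : ℝ) : ℂ)⁻¹ *
    ∫ y : Conf d, ∫ ξ : Conf d,
      Complex.exp (Complex.I * ((inner ℝ (x - y) ξ / ħ : ℝ) : ℂ)) *
        a ((1 / 2 : ℝ) • (x + y), ξ) * ψ y

/-- The `L²(ℝ^d)` scalar product `⟨φ, ψ⟩`, antilinear in the first argument. -/
def l2inner {d : ℕ} (φ ψ : Conf d → ℂ) : ℂ := ∫ x, star (φ x) * ψ x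

/-! ### Basic facts showing that the flow and the period are the intended ones -/

theorem flow_add {d : ℕ} (w w' : Fin d → ℝ) (t t' : ℝ) (z : Phase d) :
    flow w t (flow w' t' z) = flow (fun j => t * w j + t' * w' j) 1 z := by
  ext j
  · simp [flow, Real.cos_add, Real.sin_add]; ring
  · simp [flow, Real.cos_add, Real.sin_add]; ring

/-- The composed flow rotates the `j`-th plane by the angle `∑ n, τ n * w n j`. -/
theorem multiFlow_apply {d m : ℕ} (w : Fin m → Fin d → ℝ) (τ : Fin m → ℝ) (z : Phase d) :
    multiFlow w τ z = flow (fun j => ∑ n, τ n * w n j) 1 z := by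
  induction m with
  | zero => ext j <;> simp [multiFlow, flow]
  | succ m ih =>
    have h := ih (fun n => w n.succ) (fun n => τ n.succ)
    simp only [multiFlow] at h
    simp only [multiFlow, List.ofFn_succ, List.foldr_cons, Function.comp_apply, h, flow_add,
      Fin.sum_univ_succ, one_mul]

/-- The flow solves Hamilton's equations. -/
theorem hasDerivAt_flow {d : ℕ} (w : Fin d → ℝ) (z : Phase d) (t : ℝ) :
    flow w 0 z = z ∧
    HasDerivAt (fun s => flow w s z) (hamiltonianVectorField (hamiltonian w) (flow w t z)) t := by
  refine ⟨by ext j <;> simp [flow], ?_⟩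
  have hF : ∀ y : Phase d, HasFDerivAt (hamiltonian w)
      (∑ j, w j • ((y.2 j) • ((EuclideanSpace.proj j : Conf d →L[ℝ] ℝ).comp
          (ContinuousLinearMap.snd ℝ (Conf d) (Conf d)))
        + (y.1 j) • ((EuclideanSpace.proj j : Conf d →L[ℝ] ℝ).comp
          (ContinuousLinearMap.fst ℝ (Conf d) (Conf d))))) y := by
    intro y
    unfold hamiltonian
    refine HasFDerivAt.fun_sum fun j _ => ?_
    have h2 := ((EuclideanSpace.proj j : Conf d →L[ℝ] ℝ).comp
          (ContinuousLinearMap.snd ℝ (Conf d) (Conf d))).hasFDerivAt (x := y)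
    have h1 := ((EuclideanSpace.proj j : Conf d →L[ℝ] ℝ).comp
          (ContinuousLinearMap.fst ℝ (Conf d) (Conf d))).hasFDerivAt (x := y)
    have h := (((h2.pow 2).add (h1.pow 2)).mul_const (1 / 2 : ℝ)).const_mul (w j)
    refine (h.congr_fderiv ?_).congr_of_eventuallyEq (Eventually.of_forall fun u => ?_)
    · ext u <;> simp <;> ring_nf <;> simp
    · simp [div_eq_mul_inv]
  have hV : hamiltonianVectorField (hamiltonian w) (flow w t z) =
      (WithLp.toLp 2 fun j => w j * (flow w t z).2 j,
       WithLp.toLp 2 fun j => -(w j * (flow w t z).1 j)) := by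
    unfold hamiltonianVectorField
    rw [(hF _).fderiv]
    ext j <;> simp
  rw [hV]
  have hc : ∀ j, HasDerivAt (fun s => Real.cos (s * w j)) (-Real.sin (t * w j) * w j) t :=
    fun j => by simpa using ((hasDerivAt_id t).mul_const (w j)).cos
  have hs : ∀ j, HasDerivAt (fun s => Real.sin (s * w j)) (Real.cos (t * w j) * w j) t :=
    fun j => by simpa using ((hasDerivAt_id t).mul_const (w j)).sin
  refine HasDerivAt.prodMk ?_ ?_
  · have h : HasDerivAt (fun s j => Real.cos (s * w j) * z.1 j + Real.sin (s * w j) * z.2 j)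
        (fun j => w j * (flow w t z).2 j) t := hasDerivAt_pi.2 fun j => by
      refine (((hc j).mul_const (z.1 j)).add ((hs j).mul_const (z.2 j))).congr_deriv ?_
      simp only [flow]
      ring
    exact (PiLp.hasStrictFDerivAt_toLp 2 _).hasFDerivAt.comp_hasDerivAt t h
  · have h : HasDerivAt (fun s j => Real.cos (s * w j) * z.2 j - Real.sin (s * w j) * z.1 j)
        (fun j => -(w j * (flow w t z).1 j)) t := hasDerivAt_pi.2 fun j => by
      refine (((hc j).mul_const (z.2 j)).sub ((hs j).mul_const (z.1 j))).congr_deriv ?_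
      simp only [flow]
      ring
    exact (PiLp.hasStrictFDerivAt_toLp 2 _).hasFDerivAt.comp_hasDerivAt t h

/-- For non-zero `w ∈ c ℚ^d` the period is positive and is a period of the flow. -/
theorem period_spec {d : ℕ} (c : ℝ) (q : Fin d → ℚ) (w : Fin d → ℝ) (hw : ∀ j, w j = c * q j)
    (h0 : w ≠ 0) : 0 < period w ∧ ∀ t z, flow w (t + period w) z = flow w t z := by
  obtain ⟨i, hi⟩ := Function.ne_iff.1 h0
  have hfin : {r : ℝ | ∃ j, w j ≠ 0 ∧ r = |w j|}.Finite :=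
    (Set.finite_range fun j => |w j|).subset (by rintro r ⟨j, -, rfl⟩; exact ⟨j, rfl⟩)
  have hne : {r : ℝ | ∃ j, w j ≠ 0 ∧ r = |w j|}.Nonempty := ⟨_, i, hi, rfl⟩
  obtain ⟨i₀, hi₀, hm⟩ := hne.csInf_mem hfin
  change minFreq w = |w i₀| at hm
  have hmpos : 0 < minFreq w := by rw [hm]; exact abs_pos.2 hi₀
  have hkne : {k : ℕ | 0 < k ∧ ∀ j, ∃ l : ℤ, (k : ℝ) * (minFreq w)⁻¹ * w j = l}.Nonempty := by
    have hc : c ≠ 0 := by rintro rfl; exact hi₀ (by simp [hw])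
    have hq : q i₀ ≠ 0 := by intro h; exact hi₀ (by simp [hw, h])
    -- the ratios `w j / [w]` are rational
    have hr : ∀ j, ∃ r : ℚ, (minFreq w)⁻¹ * w j = r := by
      intro j
      rcases abs_choice (w i₀) with h | h
      · refine ⟨q j / q i₀, ?_⟩
        rw [hm, h, hw, hw]; push_cast
        have : (q i₀ : ℝ) ≠ 0 := by exact_mod_cast hq
        field_simp
      · refine ⟨-(q j / q i₀), ?_⟩
        rw [hm, h, hw, hw]; push_cast
        have : (q i₀ : ℝ) ≠ 0 := by exact_mod_cast hq
        field_simp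
    choose r hr using hr
    refine ⟨∏ j, (r j).den, Finset.prod_pos fun j _ => (r j).pos, fun j => ?_⟩
    refine ⟨(∏ j' ∈ Finset.univ.erase j, ((r j').den : ℤ)) * (r j).num, ?_⟩
    rw [mul_assoc, hr j, ← Finset.prod_erase_mul _ _ (Finset.mem_univ j)]
    push_cast
    rw [mul_assoc]
    congr 1
    exact_mod_cast Rat.den_mul_eq_num (r j)
  obtain ⟨hk, hl⟩ := Nat.sInf_mem hkne
  change 0 < periodIndex w at hk
  change ∀ j, ∃ l : ℤ, (periodIndex w : ℝ) * (minFreq w)⁻¹ * w j = l at hl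
  refine ⟨by unfold period; have := Real.pi_pos; positivity, fun t z => ?_⟩
  have ha : ∀ j, ∃ l : ℤ, (t + period w) * w j = t * w j + l * (2 * Real.pi) := by
    intro j
    obtain ⟨l, h⟩ := hl j
    refine ⟨l, ?_⟩
    rw [← h, period]; ring
  choose l hl' using ha
  unfold flow
  simp only [hl', Real.cos_add_int_mul_two_pi, Real.sin_add_int_mul_two_pi]

end QHO

end

/-! ### Proof of the concentration lemma. -/

noncomputable section

namespace QHO

open scoped FourierTransform

/-! Fourier inversion writes `Op_ħ(a)` as a superposition of phase-space translations weighted by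
the Fourier transform of `a`. It therefore suffices to show, for each covector `η`, that the
expectation of one translation differs from the torus average of the character `exp(2πi⟨η, ·⟩)` by
`O(√ħ ‖η‖)`: the first moment of the Fourier transform of `a` is finite (`l2inner_weylOp`,
`integral_average_eq`).

The eigenfunctions are coherent states projected to a joint eigenspace. A coherent state is a
generating series of Hermite functions, and moving its centre along the flows multiplies the `κ`-th
term by `exp(-i κ·θ)`. Averaging against `exp(i k·θ)` over the box of periods keeps exactly the `κ`
with the same joint eigenvalue as `k` (`projectedState_apply`), and there are finitely many of them.
Matrix elements of translations thus become double integrals over pairs of times of explicit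
Gaussian overlaps. The centre is chosen with actions exactly `ħ k_j`. Then, up to a constant factor,
an overlap is the product of a kernel of modulus `exp(-Q)`, with `Q = ∑ k_j (1 - cos β_j)` and a
phase that is cubic in the angle differences `β_j`, of the wanted character at the first time, and
of `exp D` with `D` of size `√ħ ‖η‖ √Q + ħ ‖η‖²` (`overlap_factorization`, `norm_deviation_le`).

The integral of the kernel over the second time does not depend on the first
(`integral_overlapKernel_const`), so the leading term is exactly the total mass of the kernel times
the torus average. Every error is at most a small factor times the double integral of `exp(-Q/2)`,
and this has to be compared with the mass itself. No stationary phase is used, hence neither the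
dimension nor the degeneracy of the orbit matters. Positive definiteness of Gaussians gives `∫∫
exp(-Q/2) ≤ 2^d ∫∫ exp(-Q)` (`integral_exp_half_decayExponent_le`), and the phase of the kernel is
harmless once all `k_j` exceed a fixed constant `M` (`norm_overlapKernel_sub_le`). Requiring `k_j ≥
M` moves the actions only by `O(ħ)` and the centre by `O(√ħ)`, even where an action vanishes.

The eigenvalues must be the same for all points of a fibre of the moment map. They are built from a
reference point `y`. For another point `z` of the fibre, the difference of actions solves a
homogeneous rational system, so it lies, after division by `ħ`, at bounded distance from an integer
solution (`exists_lattice_approx`). Adding that integer vector to the quantum numbers of `y` gives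
quantum numbers for `z` with the same eigenvalues. -/

instance {d : ℕ} :
    ((volume : Measure (Conf d)).prod (volume : Measure (Conf d))).HasTemperateGrowth :=
  Measure.IsAddHaarMeasure.instHasTemperateGrowth

instance {d : ℕ} : (volume : Measure (Phase d)).HasTemperateGrowth :=
  inferInstanceAs
    ((volume : Measure (Conf d)).prod (volume : Measure (Conf d))).HasTemperateGrowth

/-! ### Weyl operators as superpositions of translations. -/

/-- The Fourier transform on `Conf d × Conf d`, computed with the Euclidean scalar product of the
product, of a smooth compactly supported symbol. -/
def symbolFourier {d : ℕ} (a : Phase d → ℂ) (ha : ContDiff ℝ ((⊤ : ℕ∞) : WithTop ℕ∞) a)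
    (hc : HasCompactSupport a) : 𝓢(Phase d, ℂ) :=
  SchwartzMap.compCLMOfContinuousLinearEquiv ℂ
    (WithLp.prodContinuousLinearEquiv 2 ℝ (Conf d) (Conf d)).symm
    (𝓕 (SchwartzMap.compCLMOfContinuousLinearEquiv ℂ
      (WithLp.prodContinuousLinearEquiv 2 ℝ (Conf d) (Conf d)) (hc.toSchwartzMap ha)))

theorem symbol_eq_integral_fourier {d : ℕ} (a : Phase d → ℂ)
    (ha : ContDiff ℝ ((⊤ : ℕ∞) : WithTop ℕ∞) a) (hc : HasCompactSupport a) (z : Phase d) :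
    a z = ∫ η : Phase d, Complex.exp (2 * Real.pi * Complex.I *
      ((inner ℝ η.1 z.1 + inner ℝ η.2 z.2 : ℝ) : ℂ)) * symbolFourier a ha hc η := by
  set F : 𝓢(WithLp 2 (Conf d × Conf d), ℂ) := SchwartzMap.compCLMOfContinuousLinearEquiv ℂ
      (WithLp.prodContinuousLinearEquiv 2 ℝ (Conf d) (Conf d)) (hc.toSchwartzMap ha) with hF
  have h1 : a z = F (WithLp.toLp 2 z) := by
    simp [hF]
  have h2 : F = 𝓕⁻ (𝓕 F) := by simp
  rw [h1, h2, SchwartzMap.fourierInv_coe, Real.fourierInv_eq',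
    ← (WithLp.volume_preserving_toLp (Conf d) (Conf d)).integral_comp
    (MeasurableEquiv.toLp 2 (Conf d × Conf d)).measurableEmbedding]
  refine integral_congr_ae (Eventually.of_forall fun η => ?_)
  have h3 : (𝓕 F) (WithLp.toLp 2 η) = symbolFourier a ha hc η := rfl
  simp only [smul_eq_mul, WithLp.prod_inner_apply, h3]
  congr 2
  push_cast
  ring

/-- By Fubini and inversion in both variables, the inverse Fourier transform of the right-hand side
in `q` is the slice of `a`. Inversion in the single variable `ξ` then gives the claim. -/
theorem fourier_slice_eq {d : ℕ} (a : Phase d → ℂ)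
    (ha : ContDiff ℝ ((⊤ : ℕ∞) : WithTop ℕ∞) a) (hc : HasCompactSupport a) (m q : Conf d) :
    (𝓕 (fun ξ : Conf d => a (m, ξ)) : Conf d → ℂ) q =
      ∫ p : Conf d, Complex.exp (2 * Real.pi * Complex.I * ((inner ℝ p m : ℝ) : ℂ)) *
        symbolFourier a ha hc (p, q) := by
  set A := symbolFourier a ha hc with hA
  set b : Conf d → ℂ := fun q => ∫ p : Conf d,
    Complex.exp (2 * Real.pi * Complex.I * ((inner ℝ p m : ℝ) : ℂ)) * A (p, q) with hb
  have hnorm : ∀ r : ℝ, ‖Complex.exp (2 * Real.pi * Complex.I * (r : ℂ))‖ = 1 := by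
    intro r
    rw [show (2 * Real.pi * Complex.I * (r : ℂ)) = ((2 * Real.pi * r : ℝ) : ℂ) * Complex.I by
      push_cast; ring, Complex.norm_exp_ofReal_mul_I]
  have hint : Integrable (fun η : Conf d × Conf d =>
      Complex.exp (2 * Real.pi * Complex.I * ((inner ℝ η.1 m : ℝ) : ℂ)) * A η)
      ((volume : Measure (Conf d)).prod volume) := by
    have hAi : Integrable (A : Phase d → ℂ) ((volume : Measure (Conf d)).prod volume) :=
      A.integrable
    refine hAi.norm.mono' ?_ (Eventually.of_forall fun η => ?_)
    · have := A.continuous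
      exact Continuous.aestronglyMeasurable (by fun_prop)
    · rw [norm_mul, hnorm, one_mul]
  have hbi : Integrable b := hint.integral_prod_right
  -- Pointwise inversion needs continuity of `b`. Schwartz decay in the joint variable provides a
  -- majorant in `p` that is uniform in `q`.
  have hbc : Continuous b := by
    obtain ⟨k, hk⟩ := (inferInstance : (volume : Measure (Conf d)).HasTemperateGrowth).exists_integrable
    obtain ⟨C, hC⟩ : ∃ C, ∀ η : Phase d, (1 + ‖η‖) ^ k * ‖A η‖ ≤ C :=
      ⟨_, fun η => by
        simpa using A.one_add_le_sup_seminorm_apply (𝕜 := ℝ) (m := (k, 0)) le_rfl le_rfl η⟩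
    refine continuous_of_dominated (bound := fun p => C * (1 + ‖p‖) ^ (-(k : ℝ))) ?_ ?_ ?_ ?_
    · intro q
      have := A.continuous
      exact Continuous.aestronglyMeasurable (by fun_prop)
    · intro q
      refine Eventually.of_forall fun p => ?_
      rw [norm_mul, hnorm, one_mul, Real.rpow_neg (by positivity), Real.rpow_natCast]
      rw [← div_eq_mul_inv, le_div_iff₀ (by positivity), mul_comm]
      refine le_trans ?_ (hC (p, q))
      gcongr
      exact norm_fst_le (p, q)
    · exact hk.const_mul C
    · refine Eventually.of_forall fun p => ?_
      have := A.continuous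
      fun_prop
  have hinv : (𝓕⁻ b : Conf d → ℂ) = fun ξ => a (m, ξ) := by
    ext ξ
    rw [Real.fourierInv_eq', symbol_eq_integral_fourier a ha hc (m, ξ), ← hA]
    have hint2 : Integrable (fun η : Conf d × Conf d =>
      Complex.exp (2 * Real.pi * Complex.I * ((inner ℝ η.1 m + inner ℝ η.2 ξ : ℝ) : ℂ)) * A η)
      ((volume : Measure (Conf d)).prod volume) := by
      have hAi : Integrable (A : Phase d → ℂ) ((volume : Measure (Conf d)).prod volume) :=
        A.integrable
      refine hAi.norm.mono' ?_ (Eventually.of_forall fun η => ?_)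
      · have := A.continuous
        exact Continuous.aestronglyMeasurable (by fun_prop)
      · rw [norm_mul, hnorm, one_mul]
    rw [Measure.volume_eq_prod, integral_prod_symm _ hint2]
    refine integral_congr_ae (Eventually.of_forall fun q => ?_)
    simp only [hb, smul_eq_mul]
    rw [← integral_const_mul]
    refine integral_congr_ae (Eventually.of_forall fun p => ?_)
    simp only
    rw [← mul_assoc, ← Complex.exp_add]
    congr 2
    push_cast
    ring
  have hslice : HasCompactSupport (fun ξ : Conf d => a (m, ξ)) := by
    obtain ⟨K, hK, hK'⟩ := exists_compact_iff_hasCompactSupport.2 hc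
    refine HasCompactSupport.intro (hK.image continuous_snd) fun ξ hξ => hK' _ fun h => ?_
    exact hξ ⟨_, h, rfl⟩
  have hcont : Continuous (fun ξ : Conf d => a (m, ξ)) := by
    have := ha.continuous
    fun_prop
  -- `𝓕 b` is the reflection of `𝓕⁻ b`, a continuous compactly supported slice of `a`.
  have hfi : Integrable (𝓕 b) := by
    have h : Integrable (fun ξ : Conf d => a (m, ξ)) volume :=
      hcont.integrable_of_hasCompactSupport hslice
    rw [← hinv] at h
    have h2 : (𝓕 b : Conf d → ℂ) = fun ξ => (𝓕⁻ b : Conf d → ℂ) (-ξ) := by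
      ext ξ
      rw [Real.fourierInv_eq_fourier_neg, neg_neg]
    rw [h2]
    exact h.comp_neg
  have h := hbc.fourier_fourierInv_eq hbi hfi
  rw [hinv] at h
  rw [h]

/-- The Weyl quantization of `a` is the superposition of phase-space translations whose weight is
the Fourier transform of `a`. -/
theorem weylOp_eq_integral {d : ℕ} {ħ : ℝ} (hħ : 0 < ħ) (a : Phase d → ℂ)
    (ha : ContDiff ℝ ((⊤ : ℕ∞) : WithTop ℕ∞) a) (hc : HasCompactSupport a) (ψ : Conf d → ℂ)
    (x : Conf d) :
    weylOp ħ a ψ x = ∫ q : Conf d, ∫ p : Conf d,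
      Complex.exp (2 * Real.pi * Complex.I * ((inner ℝ p (x + (Real.pi * ħ) • q) : ℝ) : ℂ)) *
        symbolFourier a ha hc (p, q) * ψ (x + (2 * Real.pi * ħ) • q) := by
  have hpi := Real.pi_pos
  set G : Conf d → ℂ := fun y => ∫ ξ : Conf d,
      Complex.exp (Complex.I * ((inner ℝ (x - y) ξ / ħ : ℝ) : ℂ)) *
        a ((1 / 2 : ℝ) • (x + y), ξ) * ψ y with hG
  -- Substituting `y = x + 2πħ q` turns the oscillatory factor into `exp(-2πi q·ξ)` and the midpoint
  -- into `x + πħ q`; the Jacobian cancels the prefactor of the Weyl quantization.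
  have h1 : ∫ y, G y = (((2 * Real.pi * ħ) ^ d : ℝ) : ℂ) *
      ∫ q, G (x + (2 * Real.pi * ħ) • q) := by
    have h := Measure.integral_comp_smul (volume : Measure (Conf d)) (fun y => G (x + y))
      (2 * Real.pi * ħ)
    rw [h, integral_add_left_eq_self]
    have hfr : Module.finrank ℝ (Conf d) = d := by simp
    rw [hfr, abs_of_pos (by positivity), Complex.real_smul, ← mul_assoc, ← Complex.ofReal_mul,
      mul_inv_cancel₀ (by positivity)]
    simp
  have h0 : weylOp ħ a ψ x = (((2 * Real.pi * ħ) ^ d : ℝ) : ℂ)⁻¹ * ∫ y, G y := rfl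
  rw [h0, h1, ← mul_assoc, inv_mul_cancel₀, one_mul]
  · refine integral_congr_ae (Eventually.of_forall fun q => ?_)
    simp only [hG]
    rw [integral_mul_const, integral_mul_const]
    congr 1
    rw [← fourier_slice_eq, Real.fourier_eq']
    refine integral_congr_ae (Eventually.of_forall fun ξ => ?_)
    simp only [smul_eq_mul]
    congr 2
    · rw [sub_add_cancel_left, inner_neg_left, real_inner_smul_left, real_inner_comm]
      push_cast
      have : (ħ : ℂ) ≠ 0 := by exact_mod_cast hħ.ne'
      field_simp
    · congr 1
      rw [← add_assoc, ← two_smul ℝ x, smul_add, smul_smul, smul_smul]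
      norm_num
      congr 1
      ring
  · exact_mod_cast (by positivity : (2 * Real.pi * ħ) ^ d ≠ 0)

/-- The matrix element `⟨ψ, T ψ⟩` of the phase-space translation by `η`. -/
def ambiguity {d : ℕ} (ħ : ℝ) (ψ : Conf d → ℂ) (η : Phase d) : ℂ :=
  ∫ x : Conf d, star (ψ x) *
    (Complex.exp (2 * Real.pi * Complex.I * ((inner ℝ η.1 (x + (Real.pi * ħ) • η.2) : ℝ) : ℂ)) *
      ψ (x + (2 * Real.pi * ħ) • η.2))

/-- Fubini applied to `weylOp_eq_integral`. It separates the symbol from the state, so that only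
expectations of translations remain to be estimated. -/
theorem l2inner_weylOp {d : ℕ} {ħ : ℝ} (hħ : 0 < ħ) (a : Phase d → ℂ)
    (ha : ContDiff ℝ ((⊤ : ℕ∞) : WithTop ℕ∞) a) (hc : HasCompactSupport a) (ψ : 𝓢(Conf d, ℂ)) :
    l2inner ψ (weylOp ħ a ψ) = ∫ η : Phase d, symbolFourier a ha hc η * ambiguity ħ ψ η := by
  set A := symbolFourier a ha hc with hA
  have hnorm : ∀ r : ℝ, ‖Complex.exp (2 * Real.pi * Complex.I * (r : ℂ))‖ = 1 := by
    intro r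
    rw [show (2 * Real.pi * Complex.I * (r : ℂ)) = ((2 * Real.pi * r : ℝ) : ℂ) * Complex.I by
      push_cast; ring, Complex.norm_exp_ofReal_mul_I]
  obtain ⟨C, hC⟩ : ∃ C, ∀ x, ‖ψ x‖ ≤ C := by
    obtain ⟨C, -, hC⟩ := ψ.decay 0 0
    exact ⟨C, fun x => by simpa using hC x⟩
  have hψc := ψ.continuous
  have hAc := A.continuous
  let g : Conf d × Phase d → ℂ := fun y => star (ψ y.1) *
    (Complex.exp (2 * Real.pi * Complex.I *
      ((inner ℝ y.2.1 (y.1 + (Real.pi * ħ) • y.2.2) : ℝ) : ℂ)) * A y.2 *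
      ψ (y.1 + (2 * Real.pi * ħ) • y.2.2))
  have hg : Integrable g ((volume : Measure (Conf d)).prod (volume : Measure (Phase d))) := by
    have hb : Integrable (fun y : Conf d × Phase d => ‖ψ y.1‖ * (C * ‖A y.2‖))
        ((volume : Measure (Conf d)).prod (volume : Measure (Phase d))) :=
      Integrable.mul_prod ψ.integrable.norm (A.integrable.norm.const_mul C)
    refine hb.mono' (Continuous.aestronglyMeasurable (by fun_prop))
      (Eventually.of_forall fun y => ?_)
    simp only [g, norm_mul, norm_star, hnorm, one_mul]
    rw [mul_comm C]
    gcongr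
    exact hC _
  have hgx : ∀ x, Integrable (fun η : Phase d => Complex.exp (2 * Real.pi * Complex.I *
      ((inner ℝ η.1 (x + (Real.pi * ħ) • η.2) : ℝ) : ℂ)) * A η *
      ψ (x + (2 * Real.pi * ħ) • η.2)) ((volume : Measure (Conf d)).prod volume) := by
    intro x
    have hAi : Integrable (A : Phase d → ℂ) ((volume : Measure (Conf d)).prod volume) :=
      A.integrable
    refine (hAi.norm.mul_const C).mono' (Continuous.aestronglyMeasurable (by fun_prop))
      (Eventually.of_forall fun η => ?_)
    simp only [norm_mul, hnorm, one_mul]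
    gcongr
    exact hC _
  have e1 : l2inner ψ (weylOp ħ a ψ) = ∫ x, ∫ η : Phase d, g (x, η) := by
    unfold l2inner
    refine integral_congr_ae (Eventually.of_forall fun x => ?_)
    simp only [g]
    rw [integral_const_mul, weylOp_eq_integral hħ a ha hc, Measure.volume_eq_prod,
      integral_prod_symm _ (hgx x)]
  rw [e1, integral_integral_swap (f := fun x η => g (x, η)) hg]
  refine integral_congr_ae (Eventually.of_forall fun η => ?_)
  simp only [ambiguity, g]
  rw [← integral_const_mul]
  refine integral_congr_ae (Eventually.of_forall fun x => ?_)
  simp only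
  ring

/-! ### Hermite functions -/

/-- The Appell property, by induction on the recurrence; differentiated once more it yields the
Hermite equation. -/
theorem derivative_hermite_succ (n : ℕ) :
    Polynomial.derivative (Polynomial.hermite (n + 1)) =
      ((n : Polynomial ℤ) + 1) * Polynomial.hermite n := by
  induction n with
  | zero => simp
  | succ n ih =>
    rw [Polynomial.hermite_succ (n + 1), Polynomial.derivative_sub, Polynomial.derivative_mul, ih,
      Polynomial.derivative_mul]
    have h := Polynomial.hermite_succ n
    simp only [Polynomial.derivative_X, Polynomial.derivative_add, Polynomial.derivative_natCast,
      Polynomial.derivative_one]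
    push_cast
    linear_combination (-(n : Polynomial ℤ) - 1) * h

theorem hermite_ode (n : ℕ) :
    Polynomial.derivative (Polynomial.derivative (Polynomial.hermite n)) =
      Polynomial.X * Polynomial.derivative (Polynomial.hermite n) -
        (n : Polynomial ℤ) * Polynomial.hermite n := by
  cases n with
  | zero => simp
  | succ n =>
    rw [derivative_hermite_succ, Polynomial.derivative_mul]
    have h := Polynomial.hermite_succ n
    simp only [Polynomial.derivative_add, Polynomial.derivative_natCast,
      Polynomial.derivative_one]
    push_cast
    linear_combination ((n : Polynomial ℤ) + 1) * h

/-- The Hermite polynomials over `ℂ`. -/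
def hermiteC (n : ℕ) : Polynomial ℂ := (Polynomial.hermite n).map (Int.castRingHom ℂ)

theorem hermiteC_succ (n : ℕ) :
    hermiteC (n + 1) = Polynomial.X * hermiteC n - Polynomial.derivative (hermiteC n) := by
  simp [hermiteC, Polynomial.hermite_succ, Polynomial.derivative_map]

theorem hermiteC_ode (n : ℕ) :
    Polynomial.derivative (Polynomial.derivative (hermiteC n)) =
      Polynomial.X * Polynomial.derivative (hermiteC n) - (n : Polynomial ℂ) * hermiteC n := by
  have h := congrArg (Polynomial.map (Int.castRingHom ℂ)) (hermite_ode n)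
  simpa [hermiteC, Polynomial.derivative_map] using h

/-- Each derivative in `t` reproduces the recurrence `hermiteC_succ` at `y - t`. At `t = 0` these
are the Taylor coefficients of an entire function. -/
theorem iteratedDeriv_hermite_generating (y : ℂ) (n : ℕ) :
    iteratedDeriv n (fun t : ℂ => Complex.exp (t * y - t ^ 2 / 2)) =
      fun t => (hermiteC n).eval (y - t) * Complex.exp (t * y - t ^ 2 / 2) := by
  induction n with
  | zero => ext t; simp [hermiteC]
  | succ n ih =>
    rw [iteratedDeriv_succ, ih]
    ext t
    have h1 : HasDerivAt (fun t : ℂ => (hermiteC n).eval (y - t))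
        (-(Polynomial.derivative (hermiteC n)).eval (y - t)) t := by
      have := (Polynomial.hasDerivAt (hermiteC n) (y - t)).comp t ((hasDerivAt_id t).const_sub y)
      simpa using! this
    have h2 : HasDerivAt (fun t : ℂ => Complex.exp (t * y - t ^ 2 / 2))
        (Complex.exp (t * y - t ^ 2 / 2) * (y - t)) t := by
      refine HasDerivAt.cexp ?_
      have := ((hasDerivAt_id t).mul_const y).sub (((hasDerivAt_id t).pow 2).div_const 2)
      refine this.congr_deriv ?_
      simp
    rw [HasDerivAt.deriv (h1.fun_mul h2), hermiteC_succ]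
    simp
    ring

theorem hasSum_hermite_generating (y t : ℂ) :
    HasSum (fun n : ℕ => t ^ n / (n.factorial : ℂ) * (hermiteC n).eval y)
      (Complex.exp (t * y - t ^ 2 / 2)) := by
  have hd : Differentiable ℂ (fun t : ℂ => Complex.exp (t * y - t ^ 2 / 2)) := by fun_prop
  have h := Complex.hasSum_taylorSeries_of_entire hd 0 t
  convert! h using 2 with n
  rw [iteratedDeriv_hermite_generating]
  simp
  ring

/-- The function `P (√(2/ħ) y) exp (-y² / (2ħ))`. -/
def polyGauss (ħ : ℝ) (P : Polynomial ℂ) (y : ℝ) : ℂ :=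
  P.eval ((Real.sqrt (2 / ħ) : ℂ) * y) * Complex.exp (-(y : ℂ) ^ 2 / (2 * ħ))

theorem hasDerivAt_polyGauss {ħ : ℝ} (hħ : 0 < ħ) (P : Polynomial ℂ) (y : ℝ) :
    HasDerivAt (polyGauss ħ P)
      (polyGauss ħ (Polynomial.C (Real.sqrt (2 / ħ) : ℂ) *
        (Polynomial.derivative P - Polynomial.C (1 / 2) * Polynomial.X * P)) y) y := by
  have hb : ((Real.sqrt (2 / ħ) : ℂ)) ^ 2 = 2 / ħ := by
    rw [← Complex.ofReal_pow, Real.sq_sqrt (by positivity)]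
    push_cast
    rfl
  have hh : (ħ : ℂ) ≠ 0 := by exact_mod_cast hħ.ne'
  set b : ℂ := (Real.sqrt (2 / ħ) : ℂ)
  have h0 : HasDerivAt (fun z : ℂ => P.eval (b * z) * Complex.exp (-z ^ 2 / (2 * ħ)))
      ((Polynomial.derivative P).eval (b * y) * b * Complex.exp (-(y : ℂ) ^ 2 / (2 * ħ)) +
        P.eval (b * y) * (Complex.exp (-(y : ℂ) ^ 2 / (2 * ħ)) * (-(2 * y) / (2 * ħ)))) (y : ℂ) := by
    have h1 : HasDerivAt (fun z : ℂ => P.eval (b * z))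
        ((Polynomial.derivative P).eval (b * y) * b) (y : ℂ) := by
      have := (Polynomial.hasDerivAt P (b * y)).comp (y : ℂ) ((hasDerivAt_id (y : ℂ)).const_mul b)
      simpa using! this
    have h2 : HasDerivAt (fun z : ℂ => Complex.exp (-z ^ 2 / (2 * ħ)))
        (Complex.exp (-(y : ℂ) ^ 2 / (2 * ħ)) * (-(2 * y) / (2 * ħ))) (y : ℂ) := by
      refine HasDerivAt.cexp ?_
      have := (((hasDerivAt_id (y : ℂ)).pow 2).neg).div_const (2 * (ħ : ℂ))
      refine this.congr_deriv ?_
      simp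
    exact h1.mul h2
  refine h0.comp_ofReal.congr_deriv ?_
  simp only [polyGauss, Polynomial.eval_mul, Polynomial.eval_sub, Polynomial.eval_C,
    Polynomial.eval_X]
  have hb' : (y : ℂ) / ħ = b ^ 2 * y / 2 := by rw [hb]; field_simp
  linear_combination (-P.eval (b * y) * Complex.exp (-(y : ℂ) ^ 2 / (2 * ħ))) * hb'

theorem deriv_polyGauss {ħ : ℝ} (hħ : 0 < ħ) (P : Polynomial ℂ) :
    deriv (polyGauss ħ P) = polyGauss ħ (Polynomial.C (Real.sqrt (2 / ħ) : ℂ) *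
        (Polynomial.derivative P - Polynomial.C (1 / 2) * Polynomial.X * P)) :=
  funext fun y => (hasDerivAt_polyGauss hħ P y).deriv

theorem polyGauss_hermiteC_ode {ħ : ℝ} (hħ : 0 < ħ) (n : ℕ) (y : ℝ) :
    -(ħ : ℂ) ^ 2 * deriv (deriv (polyGauss ħ (hermiteC n))) y +
      (y : ℂ) ^ 2 * polyGauss ħ (hermiteC n) y =
      (ħ : ℂ) * (2 * n + 1) * polyGauss ħ (hermiteC n) y := by
  have hb : ((Real.sqrt (2 / ħ) : ℂ)) ^ 2 = 2 / ħ := by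
    rw [← Complex.ofReal_pow, Real.sq_sqrt (by positivity)]
    push_cast
    rfl
  have hh : (ħ : ℂ) ≠ 0 := by exact_mod_cast hħ.ne'
  have hb' : (ħ : ℂ) * ((Real.sqrt (2 / ħ) : ℂ)) ^ 2 = 2 := by rw [hb]; field_simp
  have hode := congrArg (Polynomial.eval ((Real.sqrt (2 / ħ) : ℂ) * y)) (hermiteC_ode n)
  rw [deriv_polyGauss hħ, deriv_polyGauss hħ]
  set b : ℂ := (Real.sqrt (2 / ħ) : ℂ)
  simp only [Polynomial.eval_sub, Polynomial.eval_mul, Polynomial.eval_X,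
    Polynomial.eval_natCast] at hode
  simp only [polyGauss, Polynomial.derivative_mul, Polynomial.derivative_sub,
    Polynomial.derivative_C, Polynomial.derivative_X, Polynomial.eval_mul, Polynomial.eval_sub,
    Polynomial.eval_C, Polynomial.eval_X, Polynomial.eval_add, zero_mul, zero_add,
    mul_one]
  set p := (hermiteC n).eval (b * y)
  set p1 := (Polynomial.derivative (hermiteC n)).eval (b * y)
  set p2 := (Polynomial.derivative (Polynomial.derivative (hermiteC n))).eval (b * y)
  set e := Complex.exp (-(y : ℂ) ^ 2 / (2 * ħ))
  have key : (b * (p2 - (1 / 2 * p + 1 / 2 * (b * y) * p1)) -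
      1 / 2 * (b * y) * (b * (p1 - 1 / 2 * (b * y) * p))) =
      b * (-(n : ℂ) * p - 1 / 2 * p + 1 / 4 * (b * y) ^ 2 * p) := by
    rw [hode]; ring
  linear_combination (-(ħ : ℂ) ^ 2 * b * e) * key + (e * p * ħ * (n + 1 / 2)
    - (1 / 4) * e * p * y ^ 2 * (ħ * b ^ 2 + 2)) * hb'

theorem lineDeriv_prod_apply {d : ℕ} (f : Fin d → ℝ → ℂ) (hf : ∀ j, Differentiable ℝ (f j))
    (j : Fin d) (x : Conf d) :
    lineDeriv ℝ (fun x : Conf d => ∏ i, f i (x i)) x (EuclideanSpace.single j 1) =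
      ∏ i, Function.update f j (deriv (f j)) i (x i) := by
  have h : HasDerivAt (fun t : ℝ => ∏ i, f i ((x + t • EuclideanSpace.single j (1 : ℝ)) i))
      (∏ i, Function.update f j (deriv (f j)) i (x i)) 0 := by
    have h1 : (fun t : ℝ => ∏ i, f i ((x + t • EuclideanSpace.single j (1 : ℝ)) i)) =
        fun t => f j (x j + t) * ∏ i ∈ Finset.univ.erase j, f i (x i) := by
      ext t
      rw [← Finset.mul_prod_erase _ _ (Finset.mem_univ j)]
      congr 1
      · simp
      · refine Finset.prod_congr rfl fun i hi => ?_
        simp [Finset.ne_of_mem_erase hi]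
    have h2 : (∏ i, Function.update f j (deriv (f j)) i (x i)) =
        deriv (f j) (x j) * ∏ i ∈ Finset.univ.erase j, f i (x i) := by
      rw [← Finset.mul_prod_erase _ _ (Finset.mem_univ j)]
      congr 1
      · simp
      · refine Finset.prod_congr rfl fun i hi => ?_
        simp [Finset.ne_of_mem_erase hi]
    rw [h1, h2]
    refine HasDerivAt.mul_const ?_ _
    have h3 := (hf j (x j + 0)).hasDerivAt
    have h4 := h3.comp_const_add (x j) 0
    simpa using h4
  exact h.deriv

/-! ### Gaussians as Schwartz functions -/

/-- The power is at most `M! exp(1 + r)`, and completing the square bounds `r - c r²` by `1 / (4c)`.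
-/
theorem exists_forall_one_add_pow_mul_exp_le {c : ℝ} (hc : 0 < c) (M : ℕ) :
    ∃ C : ℝ, ∀ r : ℝ, 0 ≤ r → (1 + r) ^ M * Real.exp (-c * r ^ 2) ≤ C := by
  refine ⟨M.factorial * Real.exp (1 + 1 / (4 * c)), fun r hr => ?_⟩
  have h1 : (1 + r) ^ M ≤ M.factorial * Real.exp (1 + r) := by
    have := Real.pow_div_factorial_le_exp (1 + r) (by positivity) M
    rw [div_le_iff₀ (by positivity)] at this
    linarith
  calc (1 + r) ^ M * Real.exp (-c * r ^ 2)
      ≤ (M.factorial * Real.exp (1 + r)) * Real.exp (-c * r ^ 2) := by gcongr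
    _ = M.factorial * Real.exp (1 + r + -c * r ^ 2) := by rw [mul_assoc, ← Real.exp_add]
    _ ≤ _ := by
      refine mul_le_mul_of_nonneg_left (Real.exp_le_exp.2 ?_) (by positivity)
      have : 0 ≤ c * (r - 1 / (2 * c)) ^ 2 := by positivity
      have e : c * (r - 1 / (2 * c)) ^ 2 = c * r ^ 2 - r + 1 / (4 * c) := by
        field_simp
        ring
      linarith

/-- The Gaussian `exp (-c ‖x‖²)` as a Schwartz function. -/
def gaussianSchwartz (E : Type*) [NormedAddCommGroup E] [InnerProductSpace ℝ E] (c : ℝ)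
    (hc : 0 < c) : 𝓢(E, ℂ) where
  toFun x := ((Real.exp (-c * ‖x‖ ^ 2) : ℝ) : ℂ)
  smooth' := by
    have : ContDiff ℝ ((⊤ : ℕ∞) : WithTop ℕ∞) fun x : E => Real.exp (-c * ‖x‖ ^ 2) :=
      (contDiff_const.mul (contDiff_norm_sq ℝ)).exp
    exact Complex.ofRealCLM.contDiff.comp this
  decay' k n := by
    have hq : (fun x : E => -c * ‖x‖ ^ 2).HasTemperateGrowth :=
      (Function.HasTemperateGrowth.const (-c)).mul (Function.hasTemperateGrowth_norm_sq E)
    obtain ⟨l, C, hC, hb⟩ := hq.norm_iteratedFDeriv_le_uniform n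
    obtain ⟨B, hB⟩ := exists_forall_one_add_pow_mul_exp_le hc (k + l * n)
    refine ⟨n.factorial * (1 + C) ^ n * B, fun x => ?_⟩
    have hsm : ContDiff ℝ ((⊤ : ℕ∞) : WithTop ℕ∞) fun x : E => Real.exp (-c * ‖x‖ ^ 2) :=
      (contDiff_const.mul (contDiff_norm_sq ℝ)).exp
    have h1 : ‖iteratedFDeriv ℝ n (fun x : E => ((Real.exp (-c * ‖x‖ ^ 2) : ℝ) : ℂ)) x‖ =
        ‖iteratedFDeriv ℝ n (fun x : E => Real.exp (-c * ‖x‖ ^ 2)) x‖ := by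
      have := Complex.ofRealLI.norm_iteratedFDeriv_comp_left (f := fun x : E => Real.exp (-c * ‖x‖ ^ 2))
        (x := x) (n := ((⊤ : ℕ∞) : WithTop ℕ∞)) (i := n) hsm.contDiffAt (by exact_mod_cast le_top)
      exact this
    -- Faà di Bruno: all derivatives of `exp` equal `exp`, and the derivatives of the quadratic
    -- exponent grow polynomially. The base `(1 + C)(1 + ‖x‖)^l` is at least `1`, so it is dominated
    -- by its positive powers, as the bound requires.
    have h2 : ‖iteratedFDeriv ℝ n (Real.exp ∘ fun x : E => -c * ‖x‖ ^ 2) x‖ ≤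
        n.factorial * Real.exp (-c * ‖x‖ ^ 2) * ((1 + C) * (1 + ‖x‖) ^ l) ^ n := by
      refine norm_iteratedFDeriv_comp_le (N := ((⊤ : ℕ∞) : WithTop ℕ∞)) Real.contDiff_exp hq.1
        (by exact_mod_cast le_top) x ?_ ?_
      · intro i _
        rw [norm_iteratedFDeriv_eq_norm_iteratedDeriv, iteratedDeriv_eq_iterate, Real.iter_deriv_exp,
          Real.norm_eq_abs, abs_of_pos (Real.exp_pos _)]
      · intro i hi hin
        have h3 : (1 : ℝ) ≤ (1 + C) * (1 + ‖x‖) ^ l := by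
          have : (1 : ℝ) ≤ (1 + ‖x‖) ^ l := one_le_pow₀ (by linarith [norm_nonneg x])
          nlinarith
        refine (hb i hin x).trans (le_trans ?_ (le_self_pow₀ h3 (by omega)))
        gcongr
        linarith
    rw [h1]
    calc ‖x‖ ^ k * ‖iteratedFDeriv ℝ n (Real.exp ∘ fun x : E => -c * ‖x‖ ^ 2) x‖
        ≤ (1 + ‖x‖) ^ k *
          (n.factorial * Real.exp (-c * ‖x‖ ^ 2) * ((1 + C) * (1 + ‖x‖) ^ l) ^ n) := by
          gcongr
          linarith
      _ = n.factorial * (1 + C) ^ n * ((1 + ‖x‖) ^ (k + l * n) * Real.exp (-c * ‖x‖ ^ 2)) := by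
          rw [mul_pow, pow_add, pow_mul]
          ring
      _ ≤ _ := by
          gcongr
          exact hB _ (norm_nonneg x)

theorem gaussianSchwartz_apply {E : Type*} [NormedAddCommGroup E] [InnerProductSpace ℝ E] {c : ℝ}
    (hc : 0 < c) (x : E) : gaussianSchwartz E c hc x = ((Real.exp (-c * ‖x‖ ^ 2) : ℝ) : ℂ) := rfl

theorem hasTemperateGrowth_eval {E : Type*} [NormedAddCommGroup E] [NormedSpace ℝ E] {f : E → ℂ}
    (hf : f.HasTemperateGrowth) (P : Polynomial ℂ) : (fun x => P.eval (f x)).HasTemperateGrowth := by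
  induction P using Polynomial.induction_on' with
  | add p q hp hq =>
    simp only [Polynomial.eval_add]
    exact hp.add hq
  | monomial n a =>
    simp only [Polynomial.eval_monomial]
    exact (Function.HasTemperateGrowth.const a).mul (hf.pow n)

theorem hasTemperateGrowth_prod {ι E : Type*} [NormedAddCommGroup E] [NormedSpace ℝ E]
    {f : ι → E → ℂ} (s : Finset ι) (hf : ∀ i, (f i).HasTemperateGrowth) :
    (fun x => ∏ i ∈ s, f i x).HasTemperateGrowth := by
  classical
  induction s using Finset.induction_on with
  | empty => simp
  | insert i s hi ih =>
    simp only [Finset.prod_insert hi]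
    exact (hf i).mul ih

/-- The (unnormalized) Hermite functions on `ℝ^d`. -/
def hermiteFun {d : ℕ} (ħ : ℝ) (hħ : 0 < ħ) (κ : Fin d → ℕ) : 𝓢(Conf d, ℂ) :=
  SchwartzMap.smulLeftCLM ℂ
    (fun x : Conf d => ∏ j, (hermiteC (κ j)).eval ((Real.sqrt (2 / ħ) : ℂ) * (x j : ℂ)))
    (gaussianSchwartz (Conf d) (1 / (2 * ħ)) (by positivity))

theorem hermiteFun_apply {d : ℕ} {ħ : ℝ} (hħ : 0 < ħ) (κ : Fin d → ℕ) (x : Conf d) :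
    hermiteFun ħ hħ κ x = ∏ j, polyGauss ħ (hermiteC (κ j)) (x j) := by
  have hg : (fun x : Conf d =>
      ∏ j, (hermiteC (κ j)).eval ((Real.sqrt (2 / ħ) : ℂ) * (x j : ℂ))).HasTemperateGrowth := by
    refine hasTemperateGrowth_prod _ fun j => hasTemperateGrowth_eval ?_ _
    refine (Function.HasTemperateGrowth.const _).mul ?_
    exact (Complex.ofRealCLM.comp (EuclideanSpace.proj j : Conf d →L[ℝ] ℝ)).hasTemperateGrowth
  rw [hermiteFun, SchwartzMap.smulLeftCLM_apply_apply hg, gaussianSchwartz_apply]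
  simp only [polyGauss, Finset.prod_mul_distrib, smul_eq_mul]
  congr 1
  rw [← Complex.exp_sum, Complex.ofReal_exp, EuclideanSpace.norm_sq_eq]
  congr 1
  push_cast
  rw [Finset.mul_sum]
  refine Finset.sum_congr rfl fun j _ => ?_
  rw [Real.norm_eq_abs, ← Complex.ofReal_pow, sq_abs, Complex.ofReal_pow]
  ring

/-- Derivatives along the `j`-th axis act on the `j`-th factor only, so this is the one-dimensional
equation multiplied by the other factors. -/
theorem lineDerivOp_hermiteFun {d : ℕ} {ħ : ℝ} (hħ : 0 < ħ) (κ : Fin d → ℕ) (j : Fin d)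
    (x : Conf d) :
    -(ħ : ℂ) ^ 2 * (∂_{(EuclideanSpace.single j 1 : Conf d)}
        (∂_{(EuclideanSpace.single j 1 : Conf d)} (hermiteFun ħ hħ κ))) x
      + (x j : ℂ) ^ 2 * hermiteFun ħ hħ κ x = ħ * (2 * κ j + 1) * hermiteFun ħ hħ κ x := by
  set f : Fin d → ℝ → ℂ := fun i => polyGauss ħ (hermiteC (κ i)) with hf
  have hdiff : ∀ P, Differentiable ℝ (polyGauss ħ P) := fun P y =>
    (hasDerivAt_polyGauss hħ P y).differentiableAt
  have h0 : (hermiteFun ħ hħ κ : Conf d → ℂ) = fun x => ∏ i, f i (x i) :=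
    funext fun x => hermiteFun_apply hħ κ x
  have h1 : ((∂_{(EuclideanSpace.single j 1 : Conf d)} (hermiteFun ħ hħ κ) : 𝓢(Conf d, ℂ)) : Conf d → ℂ) =
      fun x => ∏ i, Function.update f j (deriv (f j)) i (x i) := by
    ext x
    rw [SchwartzMap.lineDerivOp_apply, h0, lineDeriv_prod_apply f (fun j => hdiff _)]
  have h2 : (∂_{(EuclideanSpace.single j 1 : Conf d)}
      (∂_{(EuclideanSpace.single j 1 : Conf d)} (hermiteFun ħ hħ κ))) x =
      ∏ i, Function.update f j (deriv (deriv (f j))) i (x i) := by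
    rw [SchwartzMap.lineDerivOp_apply, h1, lineDeriv_prod_apply]
    · simp
    · intro i
      rcases eq_or_ne i j with rfl | h
      · rw [Function.update_self]
        simp only [hf, deriv_polyGauss hħ]
        exact hdiff _
      · rw [Function.update_of_ne h]
        exact hdiff _
  rw [h2, h0]
  simp only
  have h3 : ∀ g : ℝ → ℂ, ∏ i, Function.update f j g i (x i) =
      g (x j) * ∏ i ∈ Finset.univ.erase j, f i (x i) := by
    intro g
    rw [← Finset.mul_prod_erase _ _ (Finset.mem_univ j)]
    congr 1
    · simp
    · refine Finset.prod_congr rfl fun i hi => ?_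
      simp [Finset.ne_of_mem_erase hi]
  rw [h3, ← Finset.mul_prod_erase _ _ (Finset.mem_univ j)]
  have h4 := polyGauss_hermiteC_ode hħ (κ j) (x j)
  linear_combination (∏ i ∈ Finset.univ.erase j, f i (x i)) * h4

theorem oscillator_add {d : ℕ} (w : Fin d → ℝ) (ħ : ℝ) (ψ φ : 𝓢(Conf d, ℂ)) (x : Conf d) :
    oscillator w ħ (ψ + φ) x = oscillator w ħ ψ x + oscillator w ħ φ x := by
  simp only [oscillator, LineDeriv.lineDerivOp_add, add_apply, ← Finset.sum_add_distrib]
  refine Finset.sum_congr rfl fun j _ => ?_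
  ring

theorem oscillator_smul {d : ℕ} (w : Fin d → ℝ) (ħ : ℝ) (c : ℂ) (ψ : 𝓢(Conf d, ℂ)) (x : Conf d) :
    oscillator w ħ (c • ψ) x = c * oscillator w ħ ψ x := by
  simp only [oscillator, LineDeriv.lineDerivOp_smul, smul_apply, smul_eq_mul, Finset.mul_sum]
  refine Finset.sum_congr rfl fun j _ => ?_
  ring

theorem oscillator_hermiteFun {d : ℕ} (w : Fin d → ℝ) {ħ : ℝ} (hħ : 0 < ħ) (κ : Fin d → ℕ)
    (x : Conf d) :
    oscillator w ħ (hermiteFun ħ hħ κ) x =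
      ((∑ j, w j * (ħ * (κ j + 1 / 2)) : ℝ) : ℂ) * hermiteFun ħ hħ κ x := by
  simp only [oscillator, lineDerivOp_hermiteFun hħ]
  push_cast
  rw [Finset.sum_mul]
  refine Finset.sum_congr rfl fun j _ => ?_
  ring

/-- A combination of Hermite functions with the same eigenvalue is an eigenfunction. -/
theorem oscillator_sum_hermiteFun {d : ℕ} (w : Fin d → ℝ) {ħ : ℝ} (hħ : 0 < ħ)
    (K : Finset (Fin d → ℕ)) (c : (Fin d → ℕ) → ℂ) (lam : ℝ)
    (hK : ∀ κ ∈ K, ∑ j, w j * (ħ * (κ j + 1 / 2)) = lam) (x : Conf d) :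
    oscillator w ħ (∑ κ ∈ K, c κ • hermiteFun ħ hħ κ) x =
      (lam : ℂ) * (∑ κ ∈ K, c κ • hermiteFun ħ hħ κ : 𝓢(Conf d, ℂ)) x := by
  classical
  induction K using Finset.induction_on with
  | empty =>
    have h := oscillator_smul w ħ 0 (0 : 𝓢(Conf d, ℂ)) x
    simp only [zero_smul, zero_mul] at h
    simp [h]
  | insert κ K hκ ih =>
    rw [Finset.sum_insert hκ, oscillator_add, oscillator_smul, oscillator_hermiteFun,
      ih fun κ' h => hK κ' (Finset.mem_insert_of_mem h), hK κ (Finset.mem_insert_self _ _)]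
    simp only [add_apply, smul_apply, smul_eq_mul]
    ring

/-! ### Averages over a box of periods -/

/-- The angle by which `multiFlow w τ` rotates the `j`-th plane. -/
def angle {d m : ℕ} (w : Fin m → Fin d → ℝ) (τ : Fin m → ℝ) (j : Fin d) : ℝ := ∑ n, τ n * w n j

theorem continuous_angle {d m : ℕ} (w : Fin m → Fin d → ℝ) (j : Fin d) :
    Continuous fun τ => angle w τ j := by
  unfold angle
  fun_prop

/-- The uniform probability measure on the box `[0, T_1) × ⋯ × [0, T_m)`. -/
def boxMeasure {m : ℕ} (T : Fin m → ℝ) : Measure (Fin m → ℝ) :=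
  (ENNReal.ofReal (∏ n, T n))⁻¹ • volume.restrict (Set.univ.pi fun n => Set.Ico 0 (T n))

theorem isProbabilityMeasure_boxMeasure {m : ℕ} {T : Fin m → ℝ} (hT : ∀ n, 0 < T n) :
    IsProbabilityMeasure (boxMeasure T) := by
  constructor
  have hp : 0 < ∏ n, T n := Finset.prod_pos fun n _ => hT n
  rw [boxMeasure, Measure.smul_apply, Measure.restrict_apply MeasurableSet.univ, Set.univ_inter,
    Real.volume_pi_Ico, smul_eq_mul]
  simp only [sub_zero]
  rw [← ENNReal.ofReal_prod_of_nonneg fun n _ => (hT n).le]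
  exact ENNReal.inv_mul_cancel (by simpa using hp) ENNReal.ofReal_ne_top

theorem integral_boxMeasure {m : ℕ} {T : Fin m → ℝ} (hT : ∀ n, 0 < T n) (f : (Fin m → ℝ) → ℂ) :
    ∫ τ, f τ ∂boxMeasure T =
      ((∏ n, T n : ℝ) : ℂ)⁻¹ * ∫ τ in Set.univ.pi fun n => Set.Ico 0 (T n), f τ := by
  have hp : 0 ≤ ∏ n, T n := Finset.prod_nonneg fun n _ => (hT n).le
  rw [boxMeasure, integral_smul_measure, ENNReal.toReal_inv, ENNReal.toReal_ofReal hp,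
    Complex.real_smul, Complex.ofReal_inv]

theorem integral_Ico_exp {T a : ℝ} (hT : 0 < T) (ha : ∃ l : ℤ, T * a = l * (2 * Real.pi)) :
    ∫ t in Set.Ico 0 T, Complex.exp (Complex.I * ((t * a : ℝ) : ℂ)) =
      if a = 0 then (T : ℂ) else 0 := by
  rw [integral_Ico_eq_integral_Ioc, ← intervalIntegral.integral_of_le hT.le]
  split_ifs with h
  · simp [h]
  · have hc : Complex.I * (a : ℂ) ≠ 0 := by simp [h]
    have h1 := integral_exp_mul_complex (a := 0) (b := T) hc
    have h2 : ∀ t : ℝ, Complex.exp (Complex.I * ((t * a : ℝ) : ℂ)) =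
        Complex.exp (Complex.I * (a : ℂ) * t) := fun t => by
      congr 1
      push_cast
      ring
    simp_rw [h2, h1]
    obtain ⟨l, hl⟩ := ha
    have h3 : Complex.I * (a : ℂ) * T = l * (2 * Real.pi * Complex.I) := by
      have : (T : ℂ) * a = l * (2 * Real.pi) := by exact_mod_cast hl
      linear_combination Complex.I * this
    rw [h3, Complex.exp_int_mul_two_pi_mul_I]
    simp

/-- Orthogonality of characters: the integrand factors over the coordinates, and a nontrivial factor
runs through whole periods. -/
theorem integral_boxMeasure_char {m : ℕ} {T : Fin m → ℝ} (hT : ∀ n, 0 < T n) (a : Fin m → ℝ)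
    (ha : ∀ n, ∃ l : ℤ, T n * a n = l * (2 * Real.pi)) [Decidable (∀ n, a n = 0)] :
    ∫ τ, Complex.exp (Complex.I * ((∑ n, τ n * a n : ℝ) : ℂ)) ∂boxMeasure T =
      if ∀ n, a n = 0 then 1 else 0 := by
  have hp : 0 < ∏ n, T n := Finset.prod_pos fun n _ => hT n
  have h1 : ∀ τ : Fin m → ℝ, Complex.exp (Complex.I * ((∑ n, τ n * a n : ℝ) : ℂ)) =
      ∏ n, Complex.exp (Complex.I * ((τ n * a n : ℝ) : ℂ)) := by
    intro τ
    rw [← Complex.exp_sum, Complex.ofReal_sum, Finset.mul_sum]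
  rw [integral_boxMeasure hT, volume_pi, Measure.restrict_pi_pi]
  simp_rw [h1]
  rw [integral_fintype_prod_eq_prod (f := fun n (t : ℝ) =>
    Complex.exp (Complex.I * ((t * a n : ℝ) : ℂ)))]
  simp_rw [fun n => integral_Ico_exp (hT n) (ha n)]
  split_ifs with h
  · simp only [h, if_true]
    rw [Complex.ofReal_prod, inv_mul_cancel₀]
    rw [← Complex.ofReal_prod]
    exact_mod_cast hp.ne'
  · push Not at h
    obtain ⟨n, hn⟩ := h
    exact mul_eq_zero_of_right _ (Finset.prod_eq_zero (Finset.mem_univ n) (if_neg hn))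

/-- The multi-indices on which a joint eigenvalue is attained form a finite set. -/
theorem exists_resonant_finset {d m : ℕ} (w : Fin m → Fin d → ℝ) (hpos : ∀ j, 0 < ∑ n, w n j)
    (k : Fin d → ℕ) :
    ∃ K : Finset (Fin d → ℕ), ∀ κ, κ ∈ K ↔ ∀ n, ∑ j, w n j * ((κ j : ℝ) - k j) = 0 := by
  have hfin : {κ : Fin d → ℕ | ∀ n, ∑ j, w n j * ((κ j : ℝ) - k j) = 0}.Finite := by
    set S : ℝ := ∑ j, (∑ n, w n j) * k j with hS
    refine (Set.finite_Iic (fun j => ⌊S / ∑ n, w n j⌋₊)).subset fun κ hκ j => ?_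
    -- Summing the resonance conditions over `n` confines `κ` to a hyperplane with positive normal,
    -- which meets the positive orthant in a bounded set.
    have h1 : ∑ j, (∑ n, w n j) * (κ j : ℝ) = S := by
      have h2 : ∑ n, ∑ j, w n j * ((κ j : ℝ) - k j) = 0 := Finset.sum_eq_zero fun n _ => hκ n
      rw [Finset.sum_comm] at h2
      simp_rw [← Finset.sum_mul, mul_sub, Finset.sum_sub_distrib] at h2
      linarith
    refine Nat.le_floor ((le_div_iff₀ (hpos j)).2 ?_)
    rw [mul_comm, ← h1]
    exact Finset.single_le_sum (f := fun j => (∑ n, w n j) * (κ j : ℝ))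
      (fun i _ => mul_nonneg (hpos i).le (Nat.cast_nonneg _)) (Finset.mem_univ j)
  exact ⟨hfin.toFinset, fun κ => by simp⟩

/-- The box average extracts from a product of power series in `exp (-i θ_j)` the coefficients
whose multi-index is resonant with `k`. -/
theorem integral_boxMeasure_series {d m : ℕ} {w : Fin m → Fin d → ℝ} {T : Fin m → ℝ}
    (hT : ∀ n, 0 < T n) (hw : ∀ n j, ∃ l : ℤ, T n * w n j = l * (2 * Real.pi)) (k : Fin d → ℕ)
    (c : Fin d → ℕ → ℂ) (hc : ∀ j, Summable fun n => ‖c j n‖) (K : Finset (Fin d → ℕ))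
    (hK : ∀ κ, κ ∈ K ↔ ∀ n, ∑ j, w n j * ((κ j : ℝ) - k j) = 0) :
    ∫ τ, ∏ j, (Complex.exp (Complex.I * ((k j * angle w τ j : ℝ) : ℂ)) *
        ∑' n, c j n * Complex.exp (-(Complex.I * (angle w τ j : ℂ))) ^ n) ∂boxMeasure T =
      ∑ κ ∈ K, ∏ j, c j (κ j) := by
  classical
  have := isProbabilityMeasure_boxMeasure hT
  set g : (Fin m → ℝ) → Fin d → ℂ := fun τ j => Complex.exp (-(Complex.I * (angle w τ j : ℂ)))
    with hg
  set e : (Fin m → ℝ) → Fin d → ℂ := fun τ j =>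
    Complex.exp (Complex.I * ((k j * angle w τ j : ℝ) : ℂ)) with he
  have hgn : ∀ τ j, ‖g τ j‖ = 1 := fun τ j => by
    rw [hg]
    simp [Complex.norm_exp]
  have hen : ∀ τ j, ‖e τ j‖ = 1 := fun τ j => by
    rw [he]
    simp [Complex.norm_exp]
  have hgc : ∀ j, Continuous fun τ => g τ j := fun j => by
    have := continuous_angle w j
    simp only [hg]
    fun_prop
  have hec : ∀ j, Continuous fun τ => e τ j := fun j => by
    have := continuous_angle w j
    simp only [he]
    fun_prop
  have hterm : ∀ τ j n, ‖c j n * g τ j ^ n‖ = ‖c j n‖ := fun τ j n => by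
    rw [norm_mul, norm_pow, hgn, one_pow, mul_one]
  -- the finite truncations
  have hfin : ∀ N : ℕ, ∫ τ, ∏ j, (e τ j * ∑ n ∈ Finset.range N, c j n * g τ j ^ n) ∂boxMeasure T =
      ∑ κ ∈ Fintype.piFinset (fun _ : Fin d => Finset.range N),
        if κ ∈ K then ∏ j, c j (κ j) else 0 := by
    intro N
    have h1 : ∀ τ, ∏ j, (e τ j * ∑ n ∈ Finset.range N, c j n * g τ j ^ n) =
        ∑ κ ∈ Fintype.piFinset (fun _ : Fin d => Finset.range N),
          (∏ j, c j (κ j)) * Complex.exp (Complex.I *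
            ((∑ n, τ n * (-∑ j, w n j * ((κ j : ℝ) - k j)) : ℝ) : ℂ)) := by
      intro τ
      rw [Finset.prod_mul_distrib, Finset.prod_univ_sum, Finset.mul_sum]
      refine Finset.sum_congr rfl fun κ _ => ?_
      rw [Finset.prod_mul_distrib, mul_left_comm]
      congr 1
      simp only [he, hg]
      simp_rw [← Complex.exp_nat_mul]
      rw [← Complex.exp_sum, ← Complex.exp_sum, ← Complex.exp_add]
      congr 1
      have h2 : (∑ n, τ n * (-∑ j, w n j * ((κ j : ℝ) - k j))) =
          ∑ j, ((k j : ℝ) - κ j) * angle w τ j := by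
        simp only [angle, Finset.mul_sum, ← Finset.sum_neg_distrib]
        rw [Finset.sum_comm]
        refine Finset.sum_congr rfl fun j _ => Finset.sum_congr rfl fun n _ => ?_
        ring
      rw [h2, ← Finset.sum_add_distrib]
      push_cast
      rw [Finset.mul_sum]
      refine Finset.sum_congr rfl fun j _ => ?_
      ring
    simp_rw [h1]
    rw [integral_finsetSum]
    · refine Finset.sum_congr rfl fun κ _ => ?_
      rw [integral_const_mul, integral_boxMeasure_char hT]
      · simp only [neg_eq_zero, hK κ]
        split_ifs <;> simp
      · intro n
        choose l hl using hw
        refine ⟨-∑ j, l n j * ((κ j : ℤ) - k j), ?_⟩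
        push_cast
        rw [mul_neg, neg_mul, Finset.mul_sum, Finset.sum_mul]
        congr 1
        refine Finset.sum_congr rfl fun j _ => ?_
        linear_combination ((κ j : ℝ) - k j) * hl n j
    · intro κ _
      refine Integrable.const_mul ?_ _
      refine (integrable_const (1 : ℝ)).mono' ?_ (Eventually.of_forall fun τ => ?_)
      · exact Continuous.aestronglyMeasurable (by fun_prop)
      · rw [mul_comm, Complex.norm_exp_ofReal_mul_I]
  have hlim1 : Tendsto (fun N : ℕ => ∫ τ, ∏ j, (e τ j * ∑ n ∈ Finset.range N, c j n * g τ j ^ n)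
      ∂boxMeasure T) atTop (𝓝 (∫ τ, ∏ j, (e τ j * ∑' n, c j n * g τ j ^ n) ∂boxMeasure T)) := by
    refine tendsto_integral_of_dominated_convergence (fun _ => ∏ j, ∑' n, ‖c j n‖) ?_
      (integrable_const _) ?_ ?_
    · intro N
      refine Continuous.aestronglyMeasurable ?_
      refine continuous_finsetProd _ fun j _ => (hec j).mul ?_
      exact continuous_finsetSum _ fun n _ => continuous_const.mul ((hgc j).pow n)
    · intro N
      refine Eventually.of_forall fun τ => ?_
      rw [norm_prod]
      refine Finset.prod_le_prod (fun _ _ => norm_nonneg _) fun j _ => ?_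
      rw [norm_mul, hen, one_mul]
      refine (norm_sum_le _ _).trans ?_
      simp_rw [hterm]
      exact (hc j).sum_le_tsum _ fun _ _ => norm_nonneg _
    · refine Eventually.of_forall fun τ => ?_
      refine tendsto_finsetProd _ fun j _ => Tendsto.const_mul _ ?_
      have hs : Summable fun n => c j n * g τ j ^ n := by
        refine Summable.of_norm ?_
        simp_rw [hterm]
        exact hc j
      exact hs.hasSum.tendsto_sum_nat
  have hlim2 : Tendsto (fun N : ℕ => ∫ τ, ∏ j, (e τ j * ∑ n ∈ Finset.range N, c j n * g τ j ^ n)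
      ∂boxMeasure T) atTop (𝓝 (∑ κ ∈ K, ∏ j, c j (κ j))) := by
    -- As `K` is finite, the truncated integrals are constant once `N` exceeds all entries of its
    -- elements.
    obtain ⟨N₀, hN₀⟩ : ∃ N₀ : ℕ, ∀ κ ∈ K, ∀ j, κ j < N₀ := by
      refine ⟨K.sup (fun κ => Finset.univ.sup κ) + 1, fun κ hκ j => Nat.lt_succ_of_le ?_⟩
      exact (Finset.le_sup (f := κ) (Finset.mem_univ j)).trans
        (Finset.le_sup (f := fun κ : Fin d → ℕ => Finset.univ.sup κ) hκ)
    refine tendsto_const_nhds.congr' ?_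
    filter_upwards [eventually_ge_atTop N₀] with N hN
    rw [hfin N, ← Finset.sum_filter]
    refine Finset.sum_congr ?_ fun _ _ => rfl
    ext κ
    simp only [Finset.mem_filter, Fintype.mem_piFinset, Finset.mem_range]
    exact ⟨fun h => ⟨fun j => (hN₀ κ h j).trans_le hN, h⟩, fun h => h.2⟩
  exact tendsto_nhds_unique hlim1 hlim2

/-! ### Coherent states -/

/-- The unnormalized coherent state centred at `u`. -/
def coherent {d : ℕ} (ħ : ℝ) (u : Fin d → ℂ) (x : Conf d) : ℂ :=
  ∏ j, Complex.exp ((-(x j : ℂ) ^ 2 / 2 + u j * x j - u j ^ 2 / 4) / ħ)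

/-- The orbit of `W` under the composed flows. -/
def orbit {d m : ℕ} (w : Fin m → Fin d → ℝ) (W : Fin d → ℂ) (τ : Fin m → ℝ) (j : Fin d) : ℂ :=
  Complex.exp (-(Complex.I * (angle w τ j : ℂ))) * W j

theorem norm_orbit {d m : ℕ} (w : Fin m → Fin d → ℝ) (W : Fin d → ℂ) (τ : Fin m → ℝ)
    (j : Fin d) : ‖orbit w W τ j‖ = ‖W j‖ := by
  simp [orbit, Complex.norm_exp]

/-- The phase `exp (i ∑ k_j θ_j)`. -/
def charPhase {d m : ℕ} (w : Fin m → Fin d → ℝ) (k : Fin d → ℕ) (τ : Fin m → ℝ) : ℂ :=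
  ∏ j, Complex.exp (Complex.I * ((k j * angle w τ j : ℝ) : ℂ))

theorem norm_charPhase {d m : ℕ} (w : Fin m → Fin d → ℝ) (k : Fin d → ℕ) (τ : Fin m → ℝ) :
    ‖charPhase w k τ‖ = 1 := by
  simp [charPhase, Complex.norm_exp]

theorem continuous_charPhase {d m : ℕ} (w : Fin m → Fin d → ℝ) (k : Fin d → ℕ) :
    Continuous (charPhase w k) := by
  unfold charPhase angle
  fun_prop

theorem continuous_orbit {d m : ℕ} (w : Fin m → Fin d → ℝ) (W : Fin d → ℂ) :
    Continuous (orbit w W) := by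
  unfold orbit angle
  fun_prop

theorem continuous_coherent {d : ℕ} (ħ : ℝ) :
    Continuous fun y : (Fin d → ℂ) × Conf d => coherent ħ y.1 y.2 := by
  unfold coherent
  fun_prop

/-- The Hermite generating function at `t = u / √(2ħ)` and `y = √(2/ħ) x`, times the Gaussian ground
state. The term `-u²/4` in `coherent` is what makes the series a power series in `u`. -/
theorem hasSum_coherent_factor {ħ : ℝ} (hħ : 0 < ħ) (u : ℂ) (x : ℝ) :
    HasSum (fun n : ℕ => (u / (Real.sqrt (2 * ħ) : ℂ)) ^ n / (n.factorial : ℂ) *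
      polyGauss ħ (hermiteC n) x)
      (Complex.exp ((-(x : ℂ) ^ 2 / 2 + u * x - u ^ 2 / 4) / ħ)) := by
  have h := (hasSum_hermite_generating ((Real.sqrt (2 / ħ) : ℂ) * x)
    (u / (Real.sqrt (2 * ħ) : ℂ))).mul_right (Complex.exp (-(x : ℂ) ^ 2 / (2 * ħ)))
  have hh : (ħ : ℂ) ≠ 0 := by exact_mod_cast hħ.ne'
  have hs : (Real.sqrt (2 * ħ) : ℂ) ≠ 0 := by
    exact_mod_cast (Real.sqrt_pos.2 (by positivity : 0 < 2 * ħ)).ne'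
  have h2 : ((Real.sqrt (2 * ħ) : ℂ)) ^ 2 = 2 * ħ := by
    rw [← Complex.ofReal_pow, Real.sq_sqrt (by positivity)]
    push_cast
    rfl
  have h1 : (Real.sqrt (2 / ħ) : ℂ) = (Real.sqrt (2 * ħ) : ℂ) / ħ := by
    rw [← Complex.ofReal_div]
    congr 1
    rw [show 2 / ħ = 2 * ħ / ħ ^ 2 by field_simp, Real.sqrt_div (by positivity),
      Real.sqrt_sq hħ.le]
  convert! h using 1
  · ext n
    rw [polyGauss]
    ring
  · rw [← Complex.exp_add]
    congr 1
    rw [h1]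
    field_simp
    rw [h2]
    ring

/-- The projection of the coherent state at `W` to a joint eigenspace. -/
def projectedState {d : ℕ} (ħ : ℝ) (hħ : 0 < ħ) (W : Fin d → ℂ) (K : Finset (Fin d → ℕ)) :
    𝓢(Conf d, ℂ) :=
  ∑ κ ∈ K, (∏ j, (W j / (Real.sqrt (2 * ħ) : ℂ)) ^ κ j / ((κ j).factorial : ℂ)) •
    hermiteFun ħ hħ κ

/-- Along the orbit the `κ`-th Hermite coefficient acquires the factor `exp(-i κ·θ)`, so averaging
against `exp(i k·θ)` selects the resonant indices. The finite sum shows that the state is an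
eigenfunction; the integral gives access to its matrix elements. -/
theorem projectedState_apply {d m : ℕ} {w : Fin m → Fin d → ℝ} {T : Fin m → ℝ}
    (hT : ∀ n, 0 < T n) (hw : ∀ n j, ∃ l : ℤ, T n * w n j = l * (2 * Real.pi)) (k : Fin d → ℕ)
    (K : Finset (Fin d → ℕ)) (hK : ∀ κ, κ ∈ K ↔ ∀ n, ∑ j, w n j * ((κ j : ℝ) - k j) = 0)
    {ħ : ℝ} (hħ : 0 < ħ) (W : Fin d → ℂ) (x : Conf d) :
    projectedState ħ hħ W K x =
      ∫ τ, charPhase w k τ * coherent ħ (orbit w W τ) x ∂boxMeasure T := by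
  have h := integral_boxMeasure_series hT hw k
    (fun j n => (W j / (Real.sqrt (2 * ħ) : ℂ)) ^ n / (n.factorial : ℂ) *
      polyGauss ħ (hermiteC n) (x j))
    (fun j => (hasSum_coherent_factor hħ (W j) (x j)).summable.norm) K hK
  have h1 : projectedState ħ hħ W K x = ∑ κ ∈ K, ∏ j,
      ((W j / (Real.sqrt (2 * ħ) : ℂ)) ^ κ j / ((κ j).factorial : ℂ) *
        polyGauss ħ (hermiteC (κ j)) (x j)) := by
    rw [projectedState, sum_apply]
    refine Finset.sum_congr rfl fun κ _ => ?_
    rw [smul_apply, hermiteFun_apply, smul_eq_mul, Finset.prod_mul_distrib]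
  rw [h1, ← h]
  refine integral_congr_ae (Eventually.of_forall fun τ => ?_)
  simp only [charPhase, coherent]
  rw [← Finset.prod_mul_distrib]
  refine Finset.prod_congr rfl fun j _ => ?_
  congr 1
  rw [← (hasSum_coherent_factor hħ (orbit w W τ j) (x j)).tsum_eq]
  refine tsum_congr fun n => ?_
  rw [orbit]
  ring

/-! ### Gaussian overlaps and matrix elements. -/

/-- The exponent of the matrix element of a phase-space translation between two one-dimensional
coherent states. -/
def overlapExponent (ħ : ℝ) (u v : ℂ) (p q : ℝ) : ℂ :=
  star u * v / (2 * ħ) + Real.pi * star u * (Complex.I * p - q) +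
    Real.pi * v * (Complex.I * p + q) - Real.pi ^ 2 * ħ * ((p : ℂ) ^ 2 + (q : ℂ) ^ 2)

/-- The squared norm of the one-dimensional coherent state at the origin. -/
def overlapConst (ħ : ℝ) : ℂ := (Real.pi / -(-1 / (ħ : ℂ))) ^ (1 / 2 : ℂ)

theorem overlapConst_ne_zero {ħ : ℝ} (hħ : 0 < ħ) : overlapConst ħ ≠ 0 := by
  have hh : (ħ : ℂ) ≠ 0 := by exact_mod_cast hħ.ne'
  have hp : (Real.pi : ℂ) ≠ 0 := by exact_mod_cast Real.pi_ne_zero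
  rw [overlapConst, Complex.cpow_def_of_ne_zero]
  · exact Complex.exp_ne_zero _
  · simp [hh]

/-- A single Gaussian integral with quadratic coefficient `-1/ħ`: the squares of `star u` and `v`
cancel on completing the square, which leaves only the cross term `star u * v / (2ħ)`. -/
theorem integral_coherent_factor {ħ : ℝ} (hħ : 0 < ħ) (u v : ℂ) (p q : ℝ) :
    ∫ x : ℝ, star (Complex.exp ((-(x : ℂ) ^ 2 / 2 + u * x - u ^ 2 / 4) / ħ)) *
      (Complex.exp (2 * Real.pi * Complex.I * ((p * (x + Real.pi * ħ * q) : ℝ) : ℂ)) *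
        Complex.exp ((-((x + 2 * Real.pi * ħ * q : ℝ) : ℂ) ^ 2 / 2 +
          v * ((x + 2 * Real.pi * ħ * q : ℝ) : ℂ) - v ^ 2 / 4) / ħ)) =
      overlapConst ħ * Complex.exp (overlapExponent ħ u v p q) := by
  have hh : (ħ : ℂ) ≠ 0 := by exact_mod_cast hħ.ne'
  have hb : (-1 / (ħ : ℂ)).re < 0 := by
    rw [show (-1 / (ħ : ℂ)) = ((-1 / ħ : ℝ) : ℂ) by push_cast; ring, Complex.ofReal_re]
    exact div_neg_of_neg_of_pos (by norm_num) hħ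
  have h := integral_cexp_quadratic hb
    ((star u + v) / ħ + 2 * Real.pi * Complex.I * p - 2 * Real.pi * q)
    (-(star u) ^ 2 / (4 * ħ) - v ^ 2 / (4 * ħ) + 2 * Real.pi ^ 2 * Complex.I * ħ * p * q
      - 2 * Real.pi ^ 2 * ħ * q ^ 2 + 2 * Real.pi * q * v)
  rw [overlapConst]
  convert! h using 1
  · refine integral_congr_ae (Eventually.of_forall fun x => ?_)
    simp only [Complex.star_def]
    rw [← Complex.exp_conj, ← Complex.exp_add, ← Complex.exp_add]
    congr 1
    simp only [map_div₀, map_sub, map_add, map_neg, map_mul, map_pow, Complex.conj_ofReal,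
      Complex.conj_ofNat]
    push_cast
    field_simp
    ring
  · congr 2
    rw [overlapExponent]
    have hI : Complex.I ^ 2 = -1 := Complex.I_sq
    field_simp
    ring_nf
    rw [hI]
    ring

theorem integral_coherent {d : ℕ} {ħ : ℝ} (hħ : 0 < ħ) (u v : Fin d → ℂ) (η : Phase d) :
    ∫ x : Conf d, star (coherent ħ u x) *
      (Complex.exp (2 * Real.pi * Complex.I * ((inner ℝ η.1 (x + (Real.pi * ħ) • η.2) : ℝ) : ℂ)) *
        coherent ħ v (x + (2 * Real.pi * ħ) • η.2)) =
      overlapConst ħ ^ d * ∏ j, Complex.exp (overlapExponent ħ (u j) (v j) (η.1 j) (η.2 j)) := by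
  rw [← (PiLp.volume_preserving_toLp (Fin d)).integral_comp
    (MeasurableEquiv.toLp 2 _).measurableEmbedding]
  have h1 : ∀ j, ∫ x : ℝ, star (Complex.exp ((-(x : ℂ) ^ 2 / 2 + u j * x - u j ^ 2 / 4) / ħ)) *
      (Complex.exp (2 * Real.pi * Complex.I *
        ((η.1 j * (x + Real.pi * ħ * η.2 j) : ℝ) : ℂ)) *
        Complex.exp ((-((x + 2 * Real.pi * ħ * η.2 j : ℝ) : ℂ) ^ 2 / 2 +
          v j * ((x + 2 * Real.pi * ħ * η.2 j : ℝ) : ℂ) - v j ^ 2 / 4) / ħ)) =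
      overlapConst ħ * Complex.exp (overlapExponent ħ (u j) (v j) (η.1 j) (η.2 j)) := fun j =>
    integral_coherent_factor hħ (u j) (v j) (η.1 j) (η.2 j)
  have h2 : overlapConst ħ ^ d = ∏ _j : Fin d, overlapConst ħ := by simp
  rw [h2, ← Finset.prod_mul_distrib]
  simp_rw [← h1]
  rw [← integral_fintype_prod_volume_eq_prod (f := fun (j : Fin d) (x : ℝ) =>
    star (Complex.exp ((-(x : ℂ) ^ 2 / 2 + u j * x - u j ^ 2 / 4) / ħ)) *
      (Complex.exp (2 * Real.pi * Complex.I *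
        ((η.1 j * (x + Real.pi * ħ * η.2 j) : ℝ) : ℂ)) *
        Complex.exp ((-((x + 2 * Real.pi * ħ * η.2 j : ℝ) : ℂ) ^ 2 / 2 +
          v j * ((x + 2 * Real.pi * ħ * η.2 j : ℝ) : ℂ) - v j ^ 2 / 4) / ħ)))]
  refine integral_congr_ae (Eventually.of_forall fun x => ?_)
  simp only [Finset.prod_mul_distrib, coherent, star_prod]
  congr 1
  congr 1
  rw [← Complex.exp_sum, ← Finset.mul_sum, ← Complex.ofReal_sum]
  congr 3
  simp [PiLp.inner_apply, mul_comm]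

/-- Half of the Gaussian decay absorbs the linear term. The bound depends on `u` through `‖u j‖`
only, so it is uniform along an orbit and justifies Fubini. -/
theorem norm_coherent_le {d : ℕ} {ħ : ℝ} (hħ : 0 < ħ) (u : Fin d → ℂ) (x : Conf d) :
    ‖coherent ħ u x‖ ≤ (∏ j, Real.exp (2 * ‖u j‖ ^ 2 / ħ)) *
      ‖gaussianSchwartz (Conf d) (1 / (4 * ħ)) (by positivity) x‖ := by
  have h1 : ‖gaussianSchwartz (Conf d) (1 / (4 * ħ)) (by positivity) x‖ =
      ∏ j, Real.exp (-(1 / (4 * ħ)) * (x j) ^ 2) := by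
    rw [gaussianSchwartz_apply, Complex.norm_real, Real.norm_eq_abs, abs_of_pos (Real.exp_pos _),
      ← Real.exp_sum, EuclideanSpace.norm_sq_eq, Finset.mul_sum]
    simp
  rw [h1, ← Finset.prod_mul_distrib, coherent, norm_prod]
  refine Finset.prod_le_prod (fun _ _ => norm_nonneg _) fun j _ => ?_
  rw [Complex.norm_exp, ← Real.exp_add]
  refine Real.exp_le_exp.2 ?_
  have hu : (u j).re ^ 2 + (u j).im ^ 2 = ‖u j‖ ^ 2 := by
    rw [Complex.sq_norm, Complex.normSq_apply]; ring
  have h2 : ((-(x j : ℂ) ^ 2 / 2 + u j * x j - u j ^ 2 / 4) / ħ).re =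
      (-(x j) ^ 2 / 2 + (u j).re * x j - ((u j).re ^ 2 - (u j).im ^ 2) / 4) / ħ := by
    rw [Complex.div_ofReal_re]
    congr 1
    simp only [Complex.sub_re, Complex.add_re, Complex.mul_re, Complex.ofReal_re,
      Complex.ofReal_im, mul_zero, sub_zero]
    have e1 : (-(x j : ℂ) ^ 2 / 2) = ((-(x j) ^ 2 / 2 : ℝ) : ℂ) := by push_cast; ring
    have e2 : (u j ^ 2 / 4).re = ((u j).re ^ 2 - (u j).im ^ 2) / 4 := by
      rw [show (4 : ℂ) = ((4 : ℝ) : ℂ) by norm_num, Complex.div_ofReal_re, sq, Complex.mul_re]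
      ring
    rw [e1, e2, Complex.ofReal_re]
  rw [h2, show 2 * ‖u j‖ ^ 2 / ħ + -(1 / (4 * ħ)) * (x j) ^ 2 =
    (2 * ‖u j‖ ^ 2 - (x j) ^ 2 / 4) / ħ by field_simp; ring]
  refine div_le_div_of_nonneg_right ?_ hħ.le
  nlinarith [sq_nonneg (x j / 2 - (u j).re), sq_nonneg (u j).re, sq_nonneg (u j).im]

theorem norm_gaussianSchwartz_le_one {d : ℕ} {c : ℝ} (hc : 0 < c) (x : Conf d) :
    ‖gaussianSchwartz (Conf d) c hc x‖ ≤ 1 := by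
  rw [gaussianSchwartz_apply, Complex.norm_real, Real.norm_eq_abs, abs_of_pos (Real.exp_pos _)]
  refine Real.exp_le_one_iff.2 ?_
  have : 0 ≤ c * ‖x‖ ^ 2 := by positivity
  linarith

theorem norm_cexp_two_pi_I_mul (r : ℝ) :
    ‖Complex.exp (2 * Real.pi * Complex.I * (r : ℂ))‖ = 1 := by
  rw [show (2 * Real.pi * Complex.I * (r : ℂ)) = ((2 * Real.pi * r : ℝ) : ℂ) * Complex.I by
    push_cast; ring, Complex.norm_exp_ofReal_mul_I]

theorem ambiguity_integral {d m : ℕ} (μ : Measure (Fin m → ℝ)) [IsProbabilityMeasure μ]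
    {f : Conf d → (Fin m → ℝ) → ℂ} (hfc : Continuous fun y : Conf d × (Fin m → ℝ) => f y.1 y.2)
    {g : Conf d → ℝ} (hg : Integrable g) {B : ℝ} (hfg : ∀ x τ, ‖f x τ‖ ≤ g x)
    (hfB : ∀ x τ, ‖f x τ‖ ≤ B) (ħ : ℝ) (η : Phase d) :
    ambiguity ħ (fun x => ∫ τ, f x τ ∂μ) η = ∫ σ, (∫ x, star (f x σ.1) *
      (Complex.exp (2 * Real.pi * Complex.I * ((inner ℝ η.1 (x + (Real.pi * ħ) • η.2) : ℝ) : ℂ)) *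
        f (x + (2 * Real.pi * ħ) • η.2) σ.2)) ∂μ.prod μ := by
  have hGi : Integrable (fun y : Conf d × ((Fin m → ℝ) × (Fin m → ℝ)) =>
      star (f y.1 y.2.1) * (Complex.exp (2 * Real.pi * Complex.I *
        ((inner ℝ η.1 (y.1 + (Real.pi * ħ) • η.2) : ℝ) : ℂ)) *
        f (y.1 + (2 * Real.pi * ħ) • η.2) y.2.2))
      ((volume : Measure (Conf d)).prod (μ.prod μ)) := by
    have hb : Integrable (fun y : Conf d × ((Fin m → ℝ) × (Fin m → ℝ)) => g y.1 * B)
        ((volume : Measure (Conf d)).prod (μ.prod μ)) :=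
      Integrable.mul_prod (g := fun _ => B) hg (integrable_const _)
    refine hb.mono' (Continuous.aestronglyMeasurable ?_) (Eventually.of_forall fun y => ?_)
    · have h1 : Continuous fun y : Conf d × ((Fin m → ℝ) × (Fin m → ℝ)) => f y.1 y.2.1 :=
        hfc.comp (continuous_fst.prodMk (continuous_fst.comp continuous_snd))
      have h2 : Continuous fun y : Conf d × ((Fin m → ℝ) × (Fin m → ℝ)) =>
          f (y.1 + (2 * Real.pi * ħ) • η.2) y.2.2 :=
        hfc.comp ((continuous_fst.add continuous_const).prodMk
          (continuous_snd.comp continuous_snd))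
      refine h1.star.mul (Continuous.mul ?_ h2)
      fun_prop
    · rw [norm_mul, norm_mul, norm_star, norm_cexp_two_pi_I_mul, one_mul]
      exact mul_le_mul (hfg _ _) (hfB _ _) (norm_nonneg _) ((norm_nonneg _).trans (hfg y.1 y.2.1))
  refine Eq.trans ?_ (integral_integral_swap (f := fun (x : Conf d)
    (σ : (Fin m → ℝ) × (Fin m → ℝ)) => star (f x σ.1) *
      (Complex.exp (2 * Real.pi * Complex.I * ((inner ℝ η.1 (x + (Real.pi * ħ) • η.2) : ℝ) : ℂ)) *
        f (x + (2 * Real.pi * ħ) • η.2) σ.2)) hGi)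
  rw [ambiguity]
  refine integral_congr_ae (Eventually.of_forall fun x => ?_)
  have h1 : star (∫ τ, f x τ ∂μ) = ∫ τ, star (f x τ) ∂μ := (integral_conj (f := f x)).symm
  have h2 := integral_prod_mul (μ := μ) (ν := μ) (fun τ => star (f x τ))
    (fun τ => f (x + (2 * Real.pi * ħ) • η.2) τ)
  simp only
  rw [h1, mul_left_comm, ← h2, ← integral_const_mul]
  refine integral_congr_ae (Eventually.of_forall fun σ => ?_)
  simp only
  ring

/-- Matrix elements of the phase-space translations in a projected coherent state. -/
theorem ambiguity_projectedState {d m : ℕ} {w : Fin m → Fin d → ℝ} {T : Fin m → ℝ}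
    (hT : ∀ n, 0 < T n) (hw : ∀ n j, ∃ l : ℤ, T n * w n j = l * (2 * Real.pi)) (k : Fin d → ℕ)
    (K : Finset (Fin d → ℕ)) (hK : ∀ κ, κ ∈ K ↔ ∀ n, ∑ j, w n j * ((κ j : ℝ) - k j) = 0)
    {ħ : ℝ} (hħ : 0 < ħ) (W : Fin d → ℂ) (η : Phase d) :
    ambiguity ħ (projectedState ħ hħ W K) η = overlapConst ħ ^ d *
      ∫ σ, star (charPhase w k σ.1) * charPhase w k σ.2 *
        ∏ j, Complex.exp (overlapExponent ħ (orbit w W σ.1 j) (orbit w W σ.2 j) (η.1 j) (η.2 j))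
        ∂(boxMeasure T).prod (boxMeasure T) := by
  have := isProbabilityMeasure_boxMeasure hT
  have hfc : Continuous fun y : Conf d × (Fin m → ℝ) =>
      charPhase w k y.2 * coherent ħ (orbit w W y.2) y.1 :=
    ((continuous_charPhase w k).comp continuous_snd).mul
      (Continuous.comp (g := fun z : (Fin d → ℂ) × Conf d => coherent ħ z.1 z.2)
        (f := fun y : Conf d × (Fin m → ℝ) => (orbit w W y.2, y.1)) (continuous_coherent ħ)
        (((continuous_orbit w W).comp continuous_snd).prodMk continuous_fst))
  have hB0 : 0 ≤ ∏ j, Real.exp (2 * ‖W j‖ ^ 2 / ħ) :=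
    Finset.prod_nonneg fun _ _ => (Real.exp_pos _).le
  have hfb : ∀ (x : Conf d) (τ : Fin m → ℝ), ‖charPhase w k τ * coherent ħ (orbit w W τ) x‖ ≤
      (∏ j, Real.exp (2 * ‖W j‖ ^ 2 / ħ)) *
        ‖gaussianSchwartz (Conf d) (1 / (4 * ħ)) (by positivity) x‖ := by
    intro x τ
    rw [norm_mul, norm_charPhase, one_mul]
    refine (norm_coherent_le hħ _ x).trans_eq ?_
    simp_rw [norm_orbit]
  have hfun : (projectedState ħ hħ W K : Conf d → ℂ) = fun x =>
      ∫ τ, charPhase w k τ * coherent ħ (orbit w W τ) x ∂boxMeasure T :=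
    funext fun x => projectedState_apply hT hw k K hK hħ W x
  rw [hfun, ambiguity_integral (boxMeasure T) hfc
    ((gaussianSchwartz (Conf d) (1 / (4 * ħ)) (by positivity)).integrable.norm.const_mul _) hfb
    (fun x τ => (hfb x τ).trans
      (mul_le_of_le_one_right hB0 (norm_gaussianSchwartz_le_one _ _))), ← integral_const_mul]
  refine integral_congr_ae (Eventually.of_forall fun σ => ?_)
  simp only
  rw [mul_left_comm, ← integral_coherent hħ, ← integral_const_mul]
  refine integral_congr_ae (Eventually.of_forall fun x => ?_)
  simp only [star_mul']
  ring

/-- The normalization is thus the case `η = 0` of the formula for the matrix elements. -/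
theorem ambiguity_zero {d : ℕ} (ħ : ℝ) (ψ : Conf d → ℂ) :
    ambiguity ħ ψ 0 = ((∫ x, ‖ψ x‖ ^ 2 : ℝ) : ℂ) := by
  rw [ambiguity, ← integral_complex_ofReal]
  refine integral_congr_ae (Eventually.of_forall fun x => ?_)
  simp [Complex.conj_mul']

theorem ambiguity_smul {d : ℕ} (ħ c : ℝ) (ψ : Conf d → ℂ) (η : Phase d) :
    ambiguity ħ (fun x => (c : ℂ) * ψ x) η = (c : ℂ) ^ 2 * ambiguity ħ ψ η := by
  rw [ambiguity, ambiguity, ← integral_const_mul]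
  refine integral_congr_ae (Eventually.of_forall fun x => ?_)
  simp only [star_mul', Complex.star_def, Complex.conj_ofReal]
  ring

theorem integrable_norm_sq {d : ℕ} (ψ : 𝓢(Conf d, ℂ)) : Integrable fun x => ‖ψ x‖ ^ 2 := by
  obtain ⟨C, -, hC⟩ := ψ.decay 0 0
  have hC' : ∀ x, ‖ψ x‖ ≤ C := fun x => by simpa using hC x
  refine (ψ.integrable.norm.const_mul C).mono' ?_ (Eventually.of_forall fun x => ?_)
  · have := ψ.continuous
    exact Continuous.aestronglyMeasurable (by fun_prop)
  · rw [norm_pow, norm_norm, sq]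
    gcongr
    exact hC' x

/-- Translations are unitary; the bound follows from `ab ≤ (a² + b²)/2` and translation invariance.
-/
theorem norm_ambiguity_le {d : ℕ} (ħ : ℝ) (ψ : 𝓢(Conf d, ℂ)) (η : Phase d) :
    ‖ambiguity ħ ψ η‖ ≤ ∫ x, ‖ψ x‖ ^ 2 := by
  have hi := integrable_norm_sq ψ
  have hi2 : Integrable fun x => ‖ψ (x + (2 * Real.pi * ħ) • η.2)‖ ^ 2 := hi.comp_add_right _
  calc ‖ambiguity ħ ψ η‖ ≤
      ∫ x, (‖ψ x‖ ^ 2 + ‖ψ (x + (2 * Real.pi * ħ) • η.2)‖ ^ 2) / 2 := by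
        refine norm_integral_le_of_norm_le ((hi.add hi2).div_const 2)
          (Eventually.of_forall fun x => ?_)
        rw [norm_mul, norm_mul, norm_star, norm_cexp_two_pi_I_mul, one_mul]
        nlinarith [sq_nonneg (‖ψ x‖ - ‖ψ (x + (2 * Real.pi * ħ) • η.2)‖)]
    _ = ∫ x, ‖ψ x‖ ^ 2 := by
        rw [integral_div, integral_add hi hi2,
          integral_add_right_eq_self (fun x => ‖ψ x‖ ^ 2) ((2 * Real.pi * ħ) • η.2)]
        ring

/-! ### Comparison of Gaussian double integrals -/

/-- A Gaussian is the Fourier transform of a Gaussian, so its double integral is a Gaussian-weighted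
integral of the squared modulus of the characteristic function of `ψ` under `μ`. The space has
dimension `2d`, hence the power `d`. -/
theorem integral_gaussian_double_eq {m d : ℕ} (μ : Measure (Fin m → ℝ)) [IsProbabilityMeasure μ]
    {ψ : (Fin m → ℝ) → EuclideanSpace ℝ (Fin d ⊕ Fin d)} (hψ : Continuous ψ) {b : ℝ}
    (hb : 0 < b) :
    (4 * Real.pi * b) ^ d * ∫ σ, Real.exp (-b * ‖ψ σ.1 - ψ σ.2‖ ^ 2) ∂μ.prod μ =
      ∫ y, Real.exp (-(1 / (4 * b)) * ‖y‖ ^ 2) *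
        ‖∫ τ, Complex.exp (Complex.I * ((inner ℝ y (ψ τ) : ℝ) : ℂ)) ∂μ‖ ^ 2 := by
  have hpi := Real.pi_pos
  have hb' : 0 < 1 / (4 * b) := by positivity
  set e : EuclideanSpace ℝ (Fin d ⊕ Fin d) → (Fin m → ℝ) → ℂ := fun y τ =>
    Complex.exp (Complex.I * ((inner ℝ y (ψ τ) : ℝ) : ℂ)) with he
  have hstar : ∀ y τ, star (e y τ) = Complex.exp (-(Complex.I * ((inner ℝ y (ψ τ) : ℝ) : ℂ))) := by
    intro y τ
    simp only [he, Complex.star_def]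
    rw [← Complex.exp_conj, map_mul, Complex.conj_I, Complex.conj_ofReal, neg_mul]
  have hen : ∀ y τ, ‖e y τ‖ = 1 := fun y τ => by
    simp only [he]
    rw [mul_comm, Complex.norm_exp_ofReal_mul_I]
  have h1 : ∀ σ : (Fin m → ℝ) × (Fin m → ℝ),
      (((4 * Real.pi * b) ^ d * Real.exp (-b * ‖ψ σ.1 - ψ σ.2‖ ^ 2) : ℝ) : ℂ) =
      ∫ y, ((Real.exp (-(1 / (4 * b)) * ‖y‖ ^ 2) : ℝ) : ℂ) * (e y σ.1 * star (e y σ.2)) := by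
    intro σ
    have h := GaussianFourier.integral_cexp_neg_mul_sq_norm_add_of_euclideanSpace
      (b := ((1 / (4 * b) : ℝ) : ℂ)) (by rw [Complex.ofReal_re]; exact hb') Complex.I
      (ψ σ.1 - ψ σ.2)
    have hcard : ((Fintype.card (Fin d ⊕ Fin d) : ℂ) / 2) = (d : ℂ) := by
      simp
    rw [hcard, Complex.cpow_natCast] at h
    have hbc : (b : ℂ) ≠ 0 := by exact_mod_cast hb.ne'
    have h2 : (((4 * Real.pi * b) ^ d * Real.exp (-b * ‖ψ σ.1 - ψ σ.2‖ ^ 2) : ℝ) : ℂ) =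
        ((Real.pi : ℂ) / ((1 / (4 * b) : ℝ) : ℂ)) ^ d *
          Complex.exp (Complex.I ^ 2 * (‖ψ σ.1 - ψ σ.2‖ : ℂ) ^ 2 /
            (4 * ((1 / (4 * b) : ℝ) : ℂ))) := by
      push_cast
      congr 2
      · field_simp
      · rw [Complex.I_sq]
        field_simp
    rw [h2, ← h]
    refine integral_congr_ae (Eventually.of_forall fun y => ?_)
    simp only [hstar]
    simp only [he]
    rw [Complex.ofReal_exp, ← Complex.exp_add, ← Complex.exp_add]
    congr 1
    rw [inner_sub_left, real_inner_comm, real_inner_comm (x := ψ σ.2)]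
    push_cast
    ring
  have hint : Integrable (fun p : ((Fin m → ℝ) × (Fin m → ℝ)) × EuclideanSpace ℝ (Fin d ⊕ Fin d) =>
      ((Real.exp (-(1 / (4 * b)) * ‖p.2‖ ^ 2) : ℝ) : ℂ) * (e p.2 p.1.1 * star (e p.2 p.1.2)))
      ((μ.prod μ).prod volume) := by
    have hg := (gaussianSchwartz (EuclideanSpace ℝ (Fin d ⊕ Fin d)) (1 / (4 * b)) hb').integrable
      (μ := volume)
    have hb2 := Integrable.mul_prod (μ := μ.prod μ) (f := fun _ => (1 : ℝ)) (integrable_const 1)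
      hg.norm
    refine hb2.mono' (Continuous.aestronglyMeasurable ?_) (Eventually.of_forall fun p => ?_)
    · simp only [hstar]
      simp only [he]
      fun_prop
    · rw [norm_mul, norm_mul, norm_star, hen, hen, gaussianSchwartz_apply]
      simp
  have h3 : (((4 * Real.pi * b) ^ d *
      ∫ σ, Real.exp (-b * ‖ψ σ.1 - ψ σ.2‖ ^ 2) ∂μ.prod μ : ℝ) : ℂ) =
      ((∫ y, Real.exp (-(1 / (4 * b)) * ‖y‖ ^ 2) * ‖∫ τ, e y τ ∂μ‖ ^ 2 : ℝ) : ℂ) := by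
    rw [← integral_const_mul, ← integral_complex_ofReal, ← integral_complex_ofReal]
    simp_rw [h1]
    rw [integral_integral_swap hint]
    refine integral_congr_ae (Eventually.of_forall fun y => ?_)
    simp only
    rw [integral_const_mul, integral_prod_mul (fun τ => e y τ) (fun τ => star (e y τ))]
    have h4 : ∫ τ, star (e y τ) ∂μ = star (∫ τ, e y τ ∂μ) := integral_conj (f := e y)
    rw [h4, Complex.star_def, Complex.mul_conj']
    push_cast
    rfl
  exact_mod_cast h3

/-- Positive definiteness of Gaussians: widening a Gaussian multiplies its double integral by at
most the ratio of the volumes. -/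
theorem integral_gaussian_double_le {m d : ℕ} (μ : Measure (Fin m → ℝ)) [IsProbabilityMeasure μ]
    {ψ : (Fin m → ℝ) → EuclideanSpace ℝ (Fin d ⊕ Fin d)} (hψ : Continuous ψ) {b c : ℝ}
    (hb : 0 < b) (hbc : b ≤ c) :
    b ^ d * ∫ σ, Real.exp (-b * ‖ψ σ.1 - ψ σ.2‖ ^ 2) ∂μ.prod μ ≤
      c ^ d * ∫ σ, Real.exp (-c * ‖ψ σ.1 - ψ σ.2‖ ^ 2) ∂μ.prod μ := by
  have hpi := Real.pi_pos
  have hc : 0 < c := hb.trans_le hbc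
  have h1 := integral_gaussian_double_eq μ hψ hb
  have h2 := integral_gaussian_double_eq μ hψ hc
  rw [mul_pow, mul_assoc] at h1 h2
  have h3 : ∀ y : EuclideanSpace ℝ (Fin d ⊕ Fin d),
      ‖∫ τ, Complex.exp (Complex.I * ((inner ℝ y (ψ τ) : ℝ) : ℂ)) ∂μ‖ ^ 2 ≤ 1 := by
    intro y
    refine pow_le_one₀ (norm_nonneg _) ?_
    refine (norm_integral_le_of_norm_le_const (C := 1) (Eventually.of_forall fun τ => ?_)).trans ?_
    · rw [mul_comm, Complex.norm_exp_ofReal_mul_I]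
    · simp
  -- On the Fourier side the weight increases with the parameter and multiplies a nonnegative
  -- function.
  have h4 : ∫ y, Real.exp (-(1 / (4 * b)) * ‖y‖ ^ 2) *
        ‖∫ τ, Complex.exp (Complex.I * ((inner ℝ y (ψ τ) : ℝ) : ℂ)) ∂μ‖ ^ 2 ≤
      ∫ y, Real.exp (-(1 / (4 * c)) * ‖y‖ ^ 2) *
        ‖∫ τ, Complex.exp (Complex.I * ((inner ℝ y (ψ τ) : ℝ) : ℂ)) ∂μ‖ ^ 2 := by
    refine integral_mono_of_nonneg (Eventually.of_forall fun y => by positivity) ?_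
      (Eventually.of_forall fun y => ?_)
    · have hg := (gaussianSchwartz (EuclideanSpace ℝ (Fin d ⊕ Fin d)) (1 / (4 * c))
        (by positivity)).integrable (μ := volume)
      have hA : Continuous fun y : EuclideanSpace ℝ (Fin d ⊕ Fin d) =>
          ∫ τ, Complex.exp (Complex.I * ((inner ℝ y (ψ τ) : ℝ) : ℂ)) ∂μ := by
        refine continuous_of_dominated (bound := fun _ => 1) ?_ ?_ (integrable_const _) ?_
        · intro y
          exact Continuous.aestronglyMeasurable (by fun_prop)
        · intro y
          refine Eventually.of_forall fun τ => ?_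
          rw [mul_comm, Complex.norm_exp_ofReal_mul_I]
        · refine Eventually.of_forall fun τ => ?_
          fun_prop
      refine hg.norm.mono' (Continuous.aestronglyMeasurable (by fun_prop))
        (Eventually.of_forall fun y => ?_)
      rw [gaussianSchwartz_apply, norm_mul, Complex.norm_real]
      refine mul_le_of_le_one_right (norm_nonneg _) ?_
      rw [norm_pow, norm_norm]
      exact h3 y
    · simp only
      gcongr
  rw [← h1, ← h2] at h4
  exact le_of_mul_le_mul_left h4 (by positivity)

/-! ### The reproducing kernel of a projected coherent state -/

/-- The exponent of the Gaussian decay of the overlaps. -/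
def decayExponent {d : ℕ} (k : Fin d → ℕ) (β : Fin d → ℝ) : ℝ := ∑ j, k j * (1 - Real.cos (β j))

/-- The overlap of two coherent states on the same torus orbit, with the phase of a joint
eigenspace removed. -/
def overlapKernel {d : ℕ} (k : Fin d → ℕ) (β : Fin d → ℝ) : ℂ :=
  ∏ j, Complex.exp (k j * (Complex.exp (Complex.I * β j) - 1 - Complex.I * β j))

theorem decayExponent_nonneg {d : ℕ} (k : Fin d → ℕ) (β : Fin d → ℝ) : 0 ≤ decayExponent k β :=
  Finset.sum_nonneg fun _ _ =>
    mul_nonneg (Nat.cast_nonneg _) (sub_nonneg.2 (Real.cos_le_one _))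

/-- Polar form. Removing the phase of the eigenspace cancels the linear part of `sin β_j`, so the
remaining phase starts at third order. -/
theorem overlapKernel_eq {d : ℕ} (k : Fin d → ℕ) (β : Fin d → ℝ) :
    overlapKernel k β = Real.exp (-decayExponent k β) *
      Complex.exp (Complex.I * ((∑ j, k j * (Real.sin (β j) - β j) : ℝ) : ℂ)) := by
  rw [overlapKernel, ← Complex.exp_sum, Complex.ofReal_exp, ← Complex.exp_add]
  congr 1
  rw [decayExponent]
  push_cast
  rw [Finset.mul_sum, ← Finset.sum_neg_distrib, ← Finset.sum_add_distrib]
  refine Finset.sum_congr rfl fun j _ => ?_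
  rw [mul_comm Complex.I, Complex.exp_mul_I]
  ring

theorem norm_overlapKernel {d : ℕ} (k : Fin d → ℕ) (β : Fin d → ℝ) :
    ‖overlapKernel k β‖ = Real.exp (-decayExponent k β) := by
  rw [overlapKernel_eq, norm_mul, mul_comm Complex.I, Complex.norm_exp_ofReal_mul_I, mul_one,
    Complex.norm_real, Real.norm_eq_abs, abs_of_pos (Real.exp_pos _)]

/-- The constant comes from `cos y ≤ 1 - (2/π²) y²` and `π² ≤ 10`. -/
theorem sq_le_five_mul_one_sub_cos {y : ℝ} (hy : |y| ≤ Real.pi) : y ^ 2 ≤ 5 * (1 - Real.cos y) := by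
  have h := Real.cos_le_one_sub_mul_cos_sq hy
  have hpi := Real.pi_pos
  have h2 : Real.pi ^ 2 ≤ 10 := by nlinarith [Real.pi_lt_d2, Real.pi_gt_three]
  have h3 : 2 / Real.pi ^ 2 * y ^ 2 ≤ 1 - Real.cos y := by linarith
  rw [div_mul_eq_mul_div, div_le_iff₀ (by positivity)] at h3
  nlinarith [Real.cos_le_one y]

/-- Since the `k j` are integers, the kernel is `2π`-periodic in each angle. Angles may therefore be
taken in `[-π, π]`, where `1 - cos` controls the square of the angle. -/
theorem exists_overlapKernel_eq {d : ℕ} (k : Fin d → ℕ) (β : Fin d → ℝ) :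
    ∃ y : Fin d → ℝ, (∀ j, |y j| ≤ Real.pi) ∧ decayExponent k y = decayExponent k β ∧
      overlapKernel k y = overlapKernel k β := by
  have h : ∀ j, ∃ y : ℝ, |y| ≤ Real.pi ∧ ∃ l : ℤ, β j = y + l * (2 * Real.pi) := by
    intro j
    refine ⟨toIocMod Real.two_pi_pos (-Real.pi) (β j), ?_, toIocDiv Real.two_pi_pos (-Real.pi) (β j),
      ?_⟩
    · have := toIocMod_mem_Ioc Real.two_pi_pos (-Real.pi) (β j)
      rw [abs_le]
      exact ⟨this.1.le, by linarith [this.2]⟩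
    · have := toIocMod_add_toIocDiv_zsmul Real.two_pi_pos (-Real.pi) (β j)
      rw [zsmul_eq_mul] at this
      exact this.symm
  choose y hy l hl using h
  refine ⟨y, hy, ?_, ?_⟩
  · unfold decayExponent
    refine Finset.sum_congr rfl fun j _ => ?_
    rw [hl j, Real.cos_add_int_mul_two_pi]
  · unfold overlapKernel
    refine Finset.prod_congr rfl fun j _ => ?_
    have e1 : Complex.exp (Complex.I * β j) = Complex.exp (Complex.I * y j) := by
      rw [hl j]
      push_cast
      rw [mul_add, Complex.exp_add, show Complex.I * ((l j : ℂ) * (2 * Real.pi)) =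
        l j * (2 * Real.pi * Complex.I) by ring, Complex.exp_int_mul_two_pi_mul_I, mul_one]
    have e2 : (k j : ℂ) * (Complex.exp (Complex.I * y j) - 1 - Complex.I * y j) =
        (k j : ℂ) * (Complex.exp (Complex.I * β j) - 1 - Complex.I * β j) +
          ((k j * l j : ℤ) : ℂ) * (2 * Real.pi * Complex.I) := by
      rw [e1, hl j]
      push_cast
      ring
    rw [e2, Complex.exp_add, Complex.exp_int_mul_two_pi_mul_I, mul_one]

/-- For reduced angles `√k_j |y_j| ≤ 3√Q`, so each cubic phase term is at most `27 Q^(3/2) / √M`.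
Half of the exponential decay absorbs `Q^(3/2)` at the cost of a factor `12`, and `27 · 12 = 324`.
-/
theorem norm_overlapKernel_sub_le {d : ℕ} (k : Fin d → ℕ) {M : ℝ} (hM : 0 < M)
    (hk : ∀ j, M ≤ k j) (β : Fin d → ℝ) :
    ‖overlapKernel k β - Real.exp (-decayExponent k β)‖ ≤
      324 * d / Real.sqrt M * Real.exp (-(decayExponent k β / 2)) := by
  obtain ⟨y, hy, hQ, hker⟩ := exists_overlapKernel_eq k β
  rw [← hQ, ← hker]
  set Q := decayExponent k y with hQdef
  have hQ0 : 0 ≤ Q := decayExponent_nonneg k y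
  set r := Real.sqrt Q with hr
  have hr0 : 0 ≤ r := Real.sqrt_nonneg _
  have hrQ : r ^ 2 = Q := Real.sq_sqrt hQ0
  have hsM : 0 < Real.sqrt M := Real.sqrt_pos.2 hM
  have hterm : ∀ j, |(k j : ℝ) * (Real.sin (y j) - y j)| ≤ 27 * r ^ 3 / Real.sqrt M := by
    intro j
    have hkj : 0 < (k j : ℝ) := hM.trans_le (hk j)
    have hskj : 0 < Real.sqrt (k j) := Real.sqrt_pos.2 hkj
    have h1 : (k j : ℝ) * (1 - Real.cos (y j)) ≤ Q :=
      Finset.single_le_sum (f := fun j => (k j : ℝ) * (1 - Real.cos (y j)))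
        (fun i _ => mul_nonneg (Nat.cast_nonneg _) (sub_nonneg.2 (Real.cos_le_one _)))
        (Finset.mem_univ j)
    have h2 := sq_le_five_mul_one_sub_cos (hy j)
    have h3 : Real.sqrt (k j) * |y j| ≤ 3 * r := by
      refine abs_le_of_sq_le_sq' ?_ (by positivity) |>.2
      rw [mul_pow, Real.sq_sqrt hkj.le, sq_abs, mul_pow, hrQ]
      nlinarith
    have h4 : (k j : ℝ) * |y j| ^ 3 = (Real.sqrt (k j) * |y j|) ^ 3 / Real.sqrt (k j) := by
      rw [mul_pow, eq_div_iff hskj.ne']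
      nth_rewrite 1 [← Real.sq_sqrt hkj.le]
      ring
    rw [abs_mul, abs_of_pos hkj]
    calc (k j : ℝ) * |Real.sin (y j) - y j| ≤ k j * |y j| ^ 3 := by
          gcongr
          rw [abs_sub_comm]
          exact (Real.abs_sub_sin_le _).trans (div_le_self (by positivity) (by norm_num))
      _ ≤ (3 * r) ^ 3 / Real.sqrt M := by
          rw [h4]
          gcongr
          exact hk j
      _ = _ := by ring
  have hphase : |∑ j, (k j : ℝ) * (Real.sin (y j) - y j)| ≤ d * (27 * r ^ 3 / Real.sqrt M) := by
    refine (Finset.abs_sum_le_sum_abs _ _).trans ((Finset.sum_le_sum fun j _ => hterm j).trans ?_)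
    simp
  -- From `r³ ≤ 6 exp r`, `r - r²/2 ≤ 1/2` and `exp(1/2) ≤ 2`.
  have hexp : r ^ 3 * Real.exp (-Q) ≤ 12 * Real.exp (-(Q / 2)) := by
    have h1 : r ^ 3 ≤ 6 * Real.exp r := by
      have := Real.pow_div_factorial_le_exp r hr0 3
      rw [div_le_iff₀ (by positivity)] at this
      simpa [Nat.factorial, mul_comm] using this
    have h2 : Real.exp (1 / 2) ≤ 2 := by
      have h3 : Real.exp (1 / 2) ^ 2 = Real.exp 1 := by
        rw [← Real.exp_nat_mul]
        norm_num
      have h4 := Real.exp_one_lt_d9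
      nlinarith [Real.exp_pos (1 / 2 : ℝ)]
    calc r ^ 3 * Real.exp (-Q) ≤ 6 * Real.exp r * Real.exp (-Q) := by gcongr
      _ = 6 * Real.exp (r - Q / 2) * Real.exp (-(Q / 2)) := by
        rw [mul_assoc, mul_assoc, ← Real.exp_add, ← Real.exp_add]
        ring_nf
      _ ≤ 6 * Real.exp (1 / 2) * Real.exp (-(Q / 2)) := by
        gcongr
        nlinarith [sq_nonneg (r - 1)]
      _ ≤ _ := by nlinarith [Real.exp_pos (-(Q / 2))]
  rw [overlapKernel_eq, ← hQdef]
  have h5 := Real.norm_exp_I_mul_ofReal_sub_one_le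
    (x := ∑ j, (k j : ℝ) * (Real.sin (y j) - y j))
  rw [show ((Real.exp (-Q) : ℝ) : ℂ) * Complex.exp (Complex.I *
      ((∑ j, (k j : ℝ) * (Real.sin (y j) - y j) : ℝ) : ℂ)) - ((Real.exp (-Q) : ℝ) : ℂ) =
      ((Real.exp (-Q) : ℝ) : ℂ) * (Complex.exp (Complex.I *
      ((∑ j, (k j : ℝ) * (Real.sin (y j) - y j) : ℝ) : ℂ)) - 1) by ring, norm_mul,
    Complex.norm_real, Real.norm_eq_abs, abs_of_pos (Real.exp_pos _)]
  calc _ ≤ Real.exp (-Q) * (d * (27 * r ^ 3 / Real.sqrt M)) := by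
        gcongr
        exact h5.trans hphase
    _ = 27 * d / Real.sqrt M * (r ^ 3 * Real.exp (-Q)) := by ring
    _ ≤ 27 * d / Real.sqrt M * (12 * Real.exp (-(Q / 2))) := by gcongr
    _ = _ := by ring

theorem continuous_decayExponent {d : ℕ} (k : Fin d → ℕ) : Continuous (decayExponent k) := by
  unfold decayExponent
  fun_prop

theorem continuous_overlapKernel {d : ℕ} (k : Fin d → ℕ) : Continuous (overlapKernel k) := by
  unfold overlapKernel
  fun_prop

/-- The difference of the angles at two times. -/
def angleDiff {d m : ℕ} (w : Fin m → Fin d → ℝ) (σ : (Fin m → ℝ) × (Fin m → ℝ)) (j : Fin d) : ℝ :=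
  angle w σ.1 j - angle w σ.2 j

theorem continuous_angleDiff {d m : ℕ} (w : Fin m → Fin d → ℝ) : Continuous (angleDiff w) := by
  unfold angleDiff angle
  fun_prop

/-- Embedding the angles in `ℝ^{2d}` as points on circles of radii `√k_j` turns `2Q` into a squared
Euclidean distance, so positive definiteness of Gaussians applies. The constant depends neither on
`k` nor on the orbit. -/
theorem integral_exp_half_decayExponent_le {d m : ℕ} (w : Fin m → Fin d → ℝ) (k : Fin d → ℕ)
    (μ : Measure (Fin m → ℝ)) [IsProbabilityMeasure μ] :
    ∫ σ, Real.exp (-(decayExponent k (angleDiff w σ) / 2)) ∂μ.prod μ ≤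
      2 ^ d * ∫ σ, Real.exp (-decayExponent k (angleDiff w σ)) ∂μ.prod μ := by
  set ψ : (Fin m → ℝ) → EuclideanSpace ℝ (Fin d ⊕ Fin d) := fun τ =>
    WithLp.toLp 2 (Sum.elim (fun j => Real.sqrt (k j) * Real.cos (angle w τ j))
      (fun j => Real.sqrt (k j) * Real.sin (angle w τ j))) with hψ
  have hc : Continuous ψ := by
    refine (PiLp.continuous_toLp 2 _).comp (continuous_pi fun i => ?_)
    rcases i with j | j
    · have := continuous_angle w j
      simp only [Sum.elim_inl]
      fun_prop
    · have := continuous_angle w j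
      simp only [Sum.elim_inr]
      fun_prop
  have hn : ∀ σ : (Fin m → ℝ) × (Fin m → ℝ),
      ‖ψ σ.1 - ψ σ.2‖ ^ 2 = 2 * decayExponent k (angleDiff w σ) := by
    intro σ
    rw [EuclideanSpace.norm_sq_eq, Fintype.sum_sum_type, ← Finset.sum_add_distrib, decayExponent,
      Finset.mul_sum]
    refine Finset.sum_congr rfl fun j _ => ?_
    simp only [hψ, PiLp.sub_apply, Sum.elim_inl, Sum.elim_inr, Real.norm_eq_abs, sq_abs]
    rw [angleDiff, Real.cos_sub]
    have h1 : Real.sqrt (k j) ^ 2 = k j := Real.sq_sqrt (Nat.cast_nonneg _)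
    have h2 := Real.sin_sq_add_cos_sq (angle w σ.1 j)
    have h3 := Real.sin_sq_add_cos_sq (angle w σ.2 j)
    linear_combination ((Real.cos (angle w σ.1 j) - Real.cos (angle w σ.2 j)) ^ 2 +
      (Real.sin (angle w σ.1 j) - Real.sin (angle w σ.2 j)) ^ 2) * h1 + (k j : ℝ) * (h2 + h3)
  -- Against the squared distance `2Q`, the parameters `1/4` and `1/2` give `exp(-Q/2)` and
  -- `exp(-Q)`.
  have h := integral_gaussian_double_le μ hc (b := 1 / 4) (c := 1 / 2) (by norm_num) (by norm_num)
  simp_rw [hn] at h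
  have e1 : ∀ Q : ℝ, -(1 / 4 : ℝ) * (2 * Q) = -(Q / 2) := fun Q => by ring
  have e2 : ∀ Q : ℝ, -(1 / 2 : ℝ) * (2 * Q) = -Q := fun Q => by ring
  simp_rw [e1, e2] at h
  have h4 : (1 / 2 : ℝ) ^ d = (1 / 4) ^ d * 2 ^ d := by
    rw [← mul_pow]
    norm_num
  rw [h4, mul_assoc] at h
  exact le_of_mul_le_mul_left h (by positivity)

theorem integrable_of_continuous_of_bound {X : Type*} [TopologicalSpace X]
    [SecondCountableTopology X] [MeasurableSpace X] [OpensMeasurableSpace X] {μ : Measure X}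
    [IsFiniteMeasure μ] {E : Type*} [NormedAddCommGroup E] {f : X → E} (hf : Continuous f) (C : ℝ)
    (hC : ∀ x, ‖f x‖ ≤ C) : Integrable f μ := by
  borelize E
  exact (integrable_const C).mono' hf.aestronglyMeasurable (Eventually.of_forall hC)

/-- Lower bound for the normalization of a projected coherent state. -/
theorem integral_exp_half_le_norm_integral_overlapKernel {d m : ℕ} (w : Fin m → Fin d → ℝ)
    (k : Fin d → ℕ) {M : ℝ} (hM : 0 < M) (hk : ∀ j, M ≤ k j)
    (hM' : 648 * d * 2 ^ d ≤ Real.sqrt M) (μ : Measure (Fin m → ℝ)) [IsProbabilityMeasure μ] :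
    ∫ σ, Real.exp (-(decayExponent k (angleDiff w σ) / 2)) ∂μ.prod μ ≤
      2 ^ (d + 1) * ‖∫ σ, overlapKernel k (angleDiff w σ) ∂μ.prod μ‖ := by
  have hQc := (continuous_decayExponent k).comp (continuous_angleDiff w)
  have hKc := (continuous_overlapKernel k).comp (continuous_angleDiff w)
  have hQ0 : ∀ σ, 0 ≤ decayExponent k (angleDiff w σ) := fun σ => decayExponent_nonneg _ _
  have hi1 : Integrable (fun σ => Real.exp (-decayExponent k (angleDiff w σ))) (μ.prod μ) := by
    refine integrable_of_continuous_of_bound (Real.continuous_exp.comp hQc.neg) 1 fun σ => ?_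
    rw [Real.norm_eq_abs, abs_of_pos (Real.exp_pos _)]
    exact Real.exp_le_one_iff.2 (by linarith [hQ0 σ])
  have hi2 : Integrable (fun σ => Real.exp (-(decayExponent k (angleDiff w σ) / 2)))
      (μ.prod μ) := by
    refine integrable_of_continuous_of_bound
      (Real.continuous_exp.comp (hQc.div_const 2).neg) 1 fun σ => ?_
    rw [Real.norm_eq_abs, abs_of_pos (Real.exp_pos _)]
    exact Real.exp_le_one_iff.2 (by linarith [hQ0 σ])
  have hi3 : Integrable (fun σ => overlapKernel k (angleDiff w σ)) (μ.prod μ) := by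
    refine integrable_of_continuous_of_bound hKc 1 fun σ => ?_
    rw [norm_overlapKernel]
    exact Real.exp_le_one_iff.2 (by linarith [hQ0 σ])
  have hi1c : Integrable (fun σ => ((Real.exp (-decayExponent k (angleDiff w σ)) : ℝ) : ℂ))
      (μ.prod μ) := hi1.ofReal
  set J := ∫ σ, Real.exp (-(decayExponent k (angleDiff w σ) / 2)) ∂μ.prod μ with hJ
  set I := ∫ σ, Real.exp (-decayExponent k (angleDiff w σ)) ∂μ.prod μ with hI
  have hJI : J ≤ 2 ^ d * I := integral_exp_half_decayExponent_le w k μ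
  have hI0 : 0 ≤ I := integral_nonneg fun σ => (Real.exp_pos _).le
  have hJ0 : 0 ≤ J := integral_nonneg fun σ => (Real.exp_pos _).le
  have hdiff : ‖(∫ σ, overlapKernel k (angleDiff w σ) ∂μ.prod μ) - (I : ℂ)‖ ≤
      324 * d / Real.sqrt M * J := by
    rw [hI, ← integral_complex_ofReal, ← integral_sub hi3 hi1c, hJ, ← integral_const_mul]
    refine norm_integral_le_of_norm_le (hi2.const_mul _) (Eventually.of_forall fun σ => ?_)
    exact norm_overlapKernel_sub_le k hM hk _
  have hs : 0 < Real.sqrt M := Real.sqrt_pos.2 hM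
  -- The lower bound on `√M` is chosen so that the phase error takes away at most half of the mass.
  have hhalf : 324 * d / Real.sqrt M * J ≤ I / 2 := by
    calc 324 * d / Real.sqrt M * J ≤ 324 * d / Real.sqrt M * (2 ^ d * I) := by gcongr
      _ = (648 * d * 2 ^ d) / Real.sqrt M * (I / 2) := by ring
      _ ≤ 1 * (I / 2) := by
        gcongr
        exact (div_le_one hs).2 hM'
      _ = I / 2 := one_mul _
  have hlow : I - I / 2 ≤ ‖∫ σ, overlapKernel k (angleDiff w σ) ∂μ.prod μ‖ := by
    have h1 := norm_sub_norm_le (I : ℂ) (∫ σ, overlapKernel k (angleDiff w σ) ∂μ.prod μ)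
    rw [norm_sub_rev, Complex.norm_real, Real.norm_eq_abs, abs_of_nonneg hI0] at h1
    linarith
  calc J ≤ 2 ^ d * I := hJI
    _ = 2 ^ (d + 1) * (I - I / 2) := by ring
    _ ≤ _ := by gcongr

/-- The mass of the overlap kernel does not depend on the base point of the orbit. -/
theorem integral_overlapKernel_const {d m : ℕ} {w : Fin m → Fin d → ℝ} {T : Fin m → ℝ}
    (hT : ∀ n, 0 < T n) (hw : ∀ n j, ∃ l : ℤ, T n * w n j = l * (2 * Real.pi)) (k : Fin d → ℕ)
    (K : Finset (Fin d → ℕ)) (hK : ∀ κ, κ ∈ K ↔ ∀ n, ∑ j, w n j * ((κ j : ℝ) - k j) = 0)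
    (τ : Fin m → ℝ) :
    ∫ τ', overlapKernel k (angleDiff w (τ, τ')) ∂boxMeasure T =
      ∑ κ ∈ K, ∏ j, Complex.exp (-(k j : ℂ)) * ((k j : ℂ) ^ κ j / ((κ j).factorial : ℂ)) := by
  set g : Fin d → ℂ := fun j => Complex.exp (Complex.I * (angle w τ j : ℂ)) with hg
  have hsum : ∀ j (z : ℂ), HasSum (fun n : ℕ => Complex.exp (-(k j : ℂ)) *
      ((k j * g j) ^ n / (n.factorial : ℂ)) * z ^ n)
      (Complex.exp (-(k j : ℂ)) * Complex.exp (k j * g j * z)) := by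
    intro j z
    have h := (NormedSpace.expSeries_div_hasSum_exp (𝔸 := ℂ) (k j * g j * z)).mul_left
      (Complex.exp (-(k j : ℂ)))
    rw [← Complex.exp_eq_exp_ℂ] at h
    convert! h using 2 with n
    ring
  have h := integral_boxMeasure_series hT hw k
    (fun j n => Complex.exp (-(k j : ℂ)) * ((k j * g j) ^ n / (n.factorial : ℂ)))
    (fun j => by simpa using (hsum j 1).summable.norm) K hK
  have h1 : ∀ τ', overlapKernel k (angleDiff w (τ, τ')) =
      (∏ j, Complex.exp (-(Complex.I * ((k j * angle w τ j : ℝ) : ℂ)))) *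
        ∏ j, (Complex.exp (Complex.I * ((k j * angle w τ' j : ℝ) : ℂ)) *
        ∑' n, Complex.exp (-(k j : ℂ)) * ((k j * g j) ^ n / (n.factorial : ℂ)) *
          Complex.exp (-(Complex.I * (angle w τ' j : ℂ))) ^ n) := by
    intro τ'
    rw [overlapKernel, ← Finset.prod_mul_distrib]
    refine Finset.prod_congr rfl fun j _ => ?_
    rw [(hsum j _).tsum_eq, ← Complex.exp_add, ← Complex.exp_add, ← Complex.exp_add]
    congr 1
    have h2 : Complex.exp (Complex.I * (angleDiff w (τ, τ') j : ℂ)) =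
        g j * Complex.exp (-(Complex.I * (angle w τ' j : ℂ))) := by
      simp only [hg]
      rw [← Complex.exp_add]
      congr 1
      rw [angleDiff]
      push_cast
      ring
    rw [h2, angleDiff]
    push_cast
    ring
  simp_rw [h1]
  rw [integral_const_mul, h, Finset.mul_sum]
  refine Finset.sum_congr rfl fun κ hκ => ?_
  -- On resonant indices the character `exp(i ∑ θ_j (κ_j - k_j))` is trivial along the orbit, so the
  -- base point `τ` drops out.
  have h3 : ∑ j, angle w τ j * ((κ j : ℝ) - k j) = 0 := by
    simp only [angle, Finset.sum_mul]
    rw [Finset.sum_comm]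
    refine Finset.sum_eq_zero fun n _ => ?_
    have := (hK κ).1 hκ n
    simp_rw [mul_assoc, ← Finset.mul_sum, this, mul_zero]
  have h4 : (∑ j, (angle w τ j : ℂ) * ((κ j : ℂ) - k j)) = 0 := by exact_mod_cast h3
  have h5 : ∏ j, (Complex.exp (-(Complex.I * ((k j * angle w τ j : ℝ) : ℂ))) * g j ^ κ j) = 1 := by
    simp only [hg, ← Complex.exp_nat_mul, ← Complex.exp_add]
    rw [← Complex.exp_sum, ← Complex.exp_zero, ← mul_zero Complex.I, ← h4, Finset.mul_sum]
    congr 1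
    refine Finset.sum_congr rfl fun j _ => ?_
    push_cast
    ring
  rw [← one_mul (∏ j, Complex.exp (-(k j : ℂ)) * ((k j : ℂ) ^ κ j / ((κ j).factorial : ℂ))), ← h5,
    ← Finset.prod_mul_distrib, ← Finset.prod_mul_distrib]
  refine Finset.prod_congr rfl fun j _ => ?_
  ring

/-! ### Overlaps along the orbit and expectations of translations. -/

/-- The symplectic pairing phase `η₁ · Re u + η₂ · Im u`. -/
def pairing {d : ℕ} (u : Fin d → ℂ) (η : Phase d) : ℝ :=
  ∑ j, (η.1 j * (u j).re + η.2 j * (u j).im)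

/-- The exponent of the deviation of the overlap of two coherent states from its diagonal value. -/
def deviation {d : ℕ} (ħ : ℝ) (u v : Fin d → ℂ) (η : Phase d) : ℂ :=
  ∑ j, (Real.pi * (v j - u j) * (Complex.I * η.1 j + η.2 j) -
    Real.pi ^ 2 * ħ * ((η.1 j : ℂ) ^ 2 + (η.2 j : ℂ) ^ 2))

theorem star_orbit_mul_orbit {d m : ℕ} (w : Fin m → Fin d → ℝ) (W : Fin d → ℂ)
    (σ : (Fin m → ℝ) × (Fin m → ℝ)) (j : Fin d) :
    star (orbit w W σ.1 j) * orbit w W σ.2 j =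
      (‖W j‖ : ℂ) ^ 2 * Complex.exp (Complex.I * (angleDiff w σ j : ℂ)) := by
  simp only [orbit, star_mul', Complex.star_def, ← Complex.exp_conj, map_neg, map_mul,
    Complex.conj_I, Complex.conj_ofReal, angleDiff]
  rw [← Complex.conj_mul']
  push_cast
  rw [mul_sub, sub_eq_add_neg, Complex.exp_add]
  ring_nf

/-- The choice `‖W j‖² = 2ħ k_j` turns the cross term into `k_j exp(iβ_j)`, while the characters
contribute `-i k_j β_j`; together they form the kernel. The terms linear in `η` are the diagonal
pairing at the first centre plus a multiple of the distance of the two centres. -/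
theorem overlap_factorization {d m : ℕ} (w : Fin m → Fin d → ℝ) {W : Fin d → ℂ} (k : Fin d → ℕ)
    {ħ : ℝ} (hħ : 0 < ħ) (hW : ∀ j, ‖W j‖ ^ 2 = 2 * ħ * k j)
    (σ : (Fin m → ℝ) × (Fin m → ℝ)) (η : Phase d) :
    star (charPhase w k σ.1) * charPhase w k σ.2 *
        ∏ j, Complex.exp (overlapExponent ħ (orbit w W σ.1 j) (orbit w W σ.2 j) (η.1 j) (η.2 j)) =
      (∏ j, Complex.exp (k j)) * (overlapKernel k (angleDiff w σ) *
        Complex.exp (2 * Real.pi * Complex.I * (pairing (orbit w W σ.1) η : ℂ)) *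
        Complex.exp (deviation ħ (orbit w W σ.1) (orbit w W σ.2) η)) := by
  have hh : (ħ : ℂ) ≠ 0 := by exact_mod_cast hħ.ne'
  rw [charPhase, charPhase, overlapKernel, pairing, deviation]
  push_cast
  rw [Finset.mul_sum, Complex.exp_sum, Complex.exp_sum, star_prod]
  simp only [← Finset.prod_mul_distrib]
  refine Finset.prod_congr rfl fun j _ => ?_
  have h1 := star_orbit_mul_orbit w W σ j
  have h2 : ((‖W j‖ : ℂ)) ^ 2 = 2 * ħ * k j := by exact_mod_cast hW j
  have h3 : star (orbit w W σ.1 j) * orbit w W σ.2 j / (2 * ħ) =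
      k j * Complex.exp (Complex.I * (angleDiff w σ j : ℂ)) := by
    rw [h1, h2]
    field_simp
  have h4 : (starRingEnd ℂ) (orbit w W σ.1 j) =
      ((orbit w W σ.1 j).re : ℂ) - (orbit w W σ.1 j).im * Complex.I := by
    apply Complex.ext <;> simp
  have h5 : orbit w W σ.1 j =
      ((orbit w W σ.1 j).re : ℂ) + (orbit w W σ.1 j).im * Complex.I := by
    apply Complex.ext <;> simp
  rw [overlapExponent, h3, Complex.star_def, ← Complex.exp_conj]
  simp only [map_mul, Complex.conj_I, Complex.conj_ofReal, map_natCast]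
  simp only [← Complex.exp_add]
  congr 1
  have h6 : (angleDiff w σ j : ℂ) = angle w σ.1 j - angle w σ.2 j := by
    rw [angleDiff]
    push_cast
    rfl
  rw [h4]
  set a : ℂ := ((orbit w W σ.1 j).re : ℂ)
  set b : ℂ := ((orbit w W σ.1 j).im : ℂ)
  rw [h5, h6]
  ring

theorem sum_norm_orbit_sub_sq {d m : ℕ} (w : Fin m → Fin d → ℝ) {W : Fin d → ℂ} (k : Fin d → ℕ)
    {ħ : ℝ} (hW : ∀ j, ‖W j‖ ^ 2 = 2 * ħ * k j)
    (σ : (Fin m → ℝ) × (Fin m → ℝ)) :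
    ∑ j, ‖orbit w W σ.2 j - orbit w W σ.1 j‖ ^ 2 = 4 * ħ * decayExponent k (angleDiff w σ) := by
  rw [decayExponent, Finset.mul_sum]
  refine Finset.sum_congr rfl fun j _ => ?_
  have h1 := congrArg Complex.re (star_orbit_mul_orbit w W σ j)
  have h2 : ‖orbit w W σ.2 j - orbit w W σ.1 j‖ ^ 2 = ‖orbit w W σ.2 j‖ ^ 2 +
      ‖orbit w W σ.1 j‖ ^ 2 - 2 * (star (orbit w W σ.1 j) * orbit w W σ.2 j).re := by
    simp only [Complex.sq_norm, Complex.normSq_apply, Complex.star_def, Complex.mul_re,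
      Complex.conj_re, Complex.conj_im, Complex.sub_re, Complex.sub_im]
    ring
  rw [h2, h1, norm_orbit, norm_orbit, ← Complex.ofReal_pow, Complex.re_ofReal_mul, hW,
    mul_comm Complex.I, Complex.exp_ofReal_mul_I_re]
  ring

/-- The Euclidean norm of a covector, scaled to the semiclassical length. -/
def scaledNorm {d : ℕ} (ħ : ℝ) (η : Phase d) : ℝ :=
  2 * Real.pi * (Real.sqrt ħ * Real.sqrt (‖η.1‖ ^ 2 + ‖η.2‖ ^ 2))

/-- Cauchy–Schwarz, since the two centres have distance `2 √(ħ Q)` by `sum_norm_orbit_sub_sq`. The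
same `Q` thus measures both the decay of the kernel and the size of the deviation. -/
theorem norm_deviation_le {d m : ℕ} (w : Fin m → Fin d → ℝ) {W : Fin d → ℂ} (k : Fin d → ℕ)
    {ħ : ℝ} (hħ : 0 < ħ) (hW : ∀ j, ‖W j‖ ^ 2 = 2 * ħ * k j)
    (σ : (Fin m → ℝ) × (Fin m → ℝ)) (η : Phase d) :
    ‖deviation ħ (orbit w W σ.1) (orbit w W σ.2) η‖ ≤
      scaledNorm ħ η * Real.sqrt (decayExponent k (angleDiff w σ)) + scaledNorm ħ η ^ 2 / 4 := by
  have hpi := Real.pi_pos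
  set Q := decayExponent k (angleDiff w σ) with hQ
  have hQ0 : 0 ≤ Q := decayExponent_nonneg _ _
  have hρ : ∑ j, (η.1 j ^ 2 + η.2 j ^ 2) = ‖η.1‖ ^ 2 + ‖η.2‖ ^ 2 := by
    rw [Finset.sum_add_distrib, EuclideanSpace.norm_sq_eq, EuclideanSpace.norm_sq_eq]
    simp
  set ρ2 := ‖η.1‖ ^ 2 + ‖η.2‖ ^ 2 with hρ2
  have hρ0 : 0 ≤ ρ2 := by positivity
  have h1 : ∀ j, ‖Complex.I * (η.1 j : ℂ) + η.2 j‖ ^ 2 = η.1 j ^ 2 + η.2 j ^ 2 := by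
    intro j
    rw [Complex.sq_norm, Complex.normSq_apply]
    simp
    ring
  have hterm : ∀ j, ‖Real.pi * (orbit w W σ.2 j - orbit w W σ.1 j) *
      (Complex.I * (η.1 j : ℂ) + η.2 j) -
      Real.pi ^ 2 * ħ * ((η.1 j : ℂ) ^ 2 + (η.2 j : ℂ) ^ 2)‖ ≤
      Real.pi * (‖orbit w W σ.2 j - orbit w W σ.1 j‖ * ‖Complex.I * (η.1 j : ℂ) + η.2 j‖) +
        Real.pi ^ 2 * ħ * (η.1 j ^ 2 + η.2 j ^ 2) := by
    intro j
    refine (norm_sub_le _ _).trans (add_le_add ?_ ?_)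
    · rw [norm_mul, norm_mul, Complex.norm_real, Real.norm_eq_abs, abs_of_pos hpi, mul_assoc]
    · rw [show (Real.pi : ℂ) ^ 2 * ħ * ((η.1 j : ℂ) ^ 2 + (η.2 j : ℂ) ^ 2) =
        ((Real.pi ^ 2 * ħ * (η.1 j ^ 2 + η.2 j ^ 2) : ℝ) : ℂ) by push_cast; ring,
        Complex.norm_real, Real.norm_eq_abs, abs_of_nonneg (by positivity)]
  have hcs := Real.sum_mul_le_sqrt_mul_sqrt Finset.univ
    (fun j => ‖orbit w W σ.2 j - orbit w W σ.1 j‖) (fun j => ‖Complex.I * (η.1 j : ℂ) + η.2 j‖)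
  rw [sum_norm_orbit_sub_sq w k hW σ, Finset.sum_congr rfl fun j _ => h1 j, hρ, ← hQ] at hcs
  have hsq : Real.sqrt (4 * ħ * Q) = 2 * (Real.sqrt ħ * Real.sqrt Q) := by
    rw [Real.sqrt_mul (by positivity), Real.sqrt_mul (by positivity),
      show (4 : ℝ) = 2 ^ 2 by norm_num, Real.sqrt_sq (by norm_num)]
    ring
  calc ‖deviation ħ (orbit w W σ.1) (orbit w W σ.2) η‖
      ≤ ∑ j, (Real.pi * (‖orbit w W σ.2 j - orbit w W σ.1 j‖ *
          ‖Complex.I * (η.1 j : ℂ) + η.2 j‖) +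
        Real.pi ^ 2 * ħ * (η.1 j ^ 2 + η.2 j ^ 2)) :=
        (norm_sum_le _ _).trans (Finset.sum_le_sum fun j _ => hterm j)
    _ ≤ Real.pi * (Real.sqrt (4 * ħ * Q) * Real.sqrt ρ2) + Real.pi ^ 2 * ħ * ρ2 := by
        rw [Finset.sum_add_distrib, ← Finset.mul_sum, ← Finset.mul_sum, hρ]
        gcongr
    _ = _ := by
        rw [hsq, scaledNorm, ← hρ2]
        have e1 : Real.sqrt ħ ^ 2 = ħ := Real.sq_sqrt hħ.le
        have e2 : Real.sqrt ρ2 ^ 2 = ρ2 := Real.sq_sqrt hρ0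
        linear_combination (-Real.pi ^ 2 * ρ2) * e1 - Real.pi ^ 2 * Real.sqrt ħ ^ 2 * e2

theorem continuous_pairing_orbit {d m : ℕ} (w : Fin m → Fin d → ℝ) (W : Fin d → ℂ) (η : Phase d) :
    Continuous fun τ => pairing (orbit w W τ) η := by
  have h := continuous_orbit w W
  have h' : ∀ j, Continuous fun τ => orbit w W τ j := fun j => (continuous_apply j).comp h
  unfold pairing
  refine continuous_finsetSum _ fun j _ => ?_
  exact (continuous_const.mul (Complex.continuous_re.comp (h' j))).add
    (continuous_const.mul (Complex.continuous_im.comp (h' j)))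

theorem continuous_deviation_orbit {d m : ℕ} (w : Fin m → Fin d → ℝ) (W : Fin d → ℂ) (ħ : ℝ)
    (η : Phase d) : Continuous fun σ : (Fin m → ℝ) × (Fin m → ℝ) =>
      deviation ħ (orbit w W σ.1) (orbit w W σ.2) η := by
  have h := continuous_orbit w W
  have h1 : ∀ j, Continuous fun σ : (Fin m → ℝ) × (Fin m → ℝ) => orbit w W σ.1 j := fun j =>
    (continuous_apply j).comp (h.comp continuous_fst)
  have h2 : ∀ j, Continuous fun σ : (Fin m → ℝ) × (Fin m → ℝ) => orbit w W σ.2 j := fun j =>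
    (continuous_apply j).comp (h.comp continuous_snd)
  unfold deviation
  refine continuous_finsetSum _ fun j _ => Continuous.sub ?_ continuous_const
  exact (continuous_const.mul ((h2 j).sub (h1 j))).mul continuous_const

/-- From `‖exp D - 1‖ ≤ ‖D‖ exp ‖D‖` with `‖D‖ ≤ s (r + 1)` and `r = √Q`. The constant comes from
`-r² + 2r + 1 ≤ 3 - r²/2`, which is `(r - 2)² ≥ 0`. -/
theorem exp_mul_norm_exp_sub_one_le {Q s : ℝ} (hQ : 0 ≤ Q) (hs0 : 0 ≤ s) (hs1 : s ≤ 1) {D : ℂ}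
    (hD : ‖D‖ ≤ s * Real.sqrt Q + s ^ 2 / 4) :
    Real.exp (-Q) * ‖Complex.exp D - 1‖ ≤ Real.exp 3 * s * Real.exp (-(Q / 2)) := by
  set r := Real.sqrt Q with hr
  have hr0 : 0 ≤ r := Real.sqrt_nonneg _
  have hrQ : r ^ 2 = Q := Real.sq_sqrt hQ
  have h1 : ‖Complex.exp D - 1‖ ≤ ‖D‖ * Real.exp ‖D‖ := by
    simpa using Complex.norm_exp_sub_sum_le_norm_mul_exp D 1
  have h2 : ‖D‖ ≤ s * (r + 1) := by nlinarith
  have h3 : ‖D‖ ≤ r + 1 := h2.trans (mul_le_of_le_one_left (by positivity) hs1)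
  have h4 : r + 1 ≤ Real.exp r := Real.add_one_le_exp r
  calc Real.exp (-Q) * ‖Complex.exp D - 1‖
      ≤ Real.exp (-Q) * (s * Real.exp r * Real.exp (r + 1)) := by
        gcongr
        refine h1.trans ?_
        gcongr
        exact h2.trans (by gcongr)
    _ = s * Real.exp (-Q + r + (r + 1)) := by
        rw [Real.exp_add (-Q + r), Real.exp_add (-Q)]
        ring
    _ ≤ s * Real.exp (3 + -(Q / 2)) := by
        refine mul_le_mul_of_nonneg_left (Real.exp_le_exp.2 ?_) hs0
        nlinarith [sq_nonneg (r - 2)]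
    _ = _ := by
        rw [Real.exp_add]
        ring

/-- In a normalized projected coherent state, phase-space translations have the expectation value
given by the average over the torus orbit, up to an error of order `√ħ`. -/
theorem norm_ambiguity_sub_average_le {d m : ℕ} {w : Fin m → Fin d → ℝ} {T : Fin m → ℝ}
    (hT : ∀ n, 0 < T n) (hw : ∀ n j, ∃ l : ℤ, T n * w n j = l * (2 * Real.pi)) (k : Fin d → ℕ)
    (K : Finset (Fin d → ℕ)) (hK : ∀ κ, κ ∈ K ↔ ∀ n, ∑ j, w n j * ((κ j : ℝ) - k j) = 0)
    {M : ℝ} (hM : 0 < M) (hk : ∀ j, M ≤ k j) (hM' : 648 * d * 2 ^ d ≤ Real.sqrt M)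
    {ħ : ℝ} (hħ : 0 < ħ) {W : Fin d → ℂ} (hW : ∀ j, ‖W j‖ ^ 2 = 2 * ħ * k j) :
    0 < ∫ x, ‖projectedState ħ hħ W K x‖ ^ 2 ∧ ∀ η : Phase d,
      ‖ambiguity ħ (projectedState ħ hħ W K) η / ((∫ x, ‖projectedState ħ hħ W K x‖ ^ 2 : ℝ) : ℂ) -
        ∫ τ, Complex.exp (2 * Real.pi * Complex.I * (pairing (orbit w W τ) η : ℂ)) ∂boxMeasure T‖ ≤
      (Real.exp 3 * 2 ^ (d + 1) + 2) * scaledNorm ħ η := by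
  have hprob := isProbabilityMeasure_boxMeasure hT
  set μ := boxMeasure T with hμ
  set S := projectedState ħ hħ W K with hS
  set N := ∫ σ, overlapKernel k (angleDiff w σ) ∂μ.prod μ with hN
  set J := ∫ σ, Real.exp (-(decayExponent k (angleDiff w σ) / 2)) ∂μ.prod μ with hJ
  have hQ0 : ∀ σ, 0 ≤ decayExponent k (angleDiff w σ) := fun σ => decayExponent_nonneg _ _
  have hJN : J ≤ 2 ^ (d + 1) * ‖N‖ :=
    integral_exp_half_le_norm_integral_overlapKernel w k hM hk hM' μ
  have hi2 : Integrable (fun σ => Real.exp (-(decayExponent k (angleDiff w σ) / 2)))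
      (μ.prod μ) := by
    refine integrable_of_continuous_of_bound (Real.continuous_exp.comp
      ((((continuous_decayExponent k).comp (continuous_angleDiff w)).div_const 2).neg)) 1
      fun σ => ?_
    rw [Real.norm_eq_abs, abs_of_pos (Real.exp_pos _)]
    exact Real.exp_le_one_iff.2 (by linarith [hQ0 σ])
  have hJ0 : 0 < J := integral_exp_pos hi2
  have hN0 : N ≠ 0 := by
    rintro h
    rw [h, norm_zero, mul_zero] at hJN
    linarith
  set X : Phase d → ℂ := fun η => ∫ σ, overlapKernel k (angleDiff w σ) *
        Complex.exp (2 * Real.pi * Complex.I * (pairing (orbit w W σ.1) η : ℂ)) *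
        Complex.exp (deviation ħ (orbit w W σ.1) (orbit w W σ.2) η) ∂μ.prod μ with hX
  set C := overlapConst ħ ^ d * ∏ j, Complex.exp (k j : ℂ) with hC
  have hC0 : C ≠ 0 := mul_ne_zero (pow_ne_zero _ (overlapConst_ne_zero hħ))
    (Finset.prod_ne_zero_iff.2 fun j _ => Complex.exp_ne_zero _)
  have hamb : ∀ η, ambiguity ħ S η = C * X η := by
    intro η
    rw [hS, ambiguity_projectedState hT hw k K hK hħ W η]
    simp_rw [overlap_factorization w k hħ hW]
    rw [integral_const_mul, ← mul_assoc]
  have hX0 : X 0 = N := by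
    simp [hX, pairing, deviation, hN]
  have hnorm : ((∫ x, ‖S x‖ ^ 2 : ℝ) : ℂ) = C * N := by
    rw [← ambiguity_zero ħ S, hamb, hX0]
  have hpos : 0 < ∫ x, ‖S x‖ ^ 2 := by
    refine lt_of_le_of_ne (integral_nonneg fun x => by positivity) fun h => ?_
    rw [← h, Complex.ofReal_zero] at hnorm
    exact mul_ne_zero hC0 hN0 hnorm.symm
  refine ⟨hpos, fun η => ?_⟩
  set s := scaledNorm ħ η with hs
  have hs0 : 0 ≤ s := by
    have := Real.pi_pos
    rw [hs, scaledNorm]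
    positivity
  set A := ∫ τ, Complex.exp (2 * Real.pi * Complex.I * (pairing (orbit w W τ) η : ℂ)) ∂μ with hA
  -- For `s > 1` both quantities have modulus at most `1`; this accounts for the summand `2` in the
  -- constant.
  rcases le_or_gt s 1 with hs1 | hs1
  · have hE : ∀ σ, ‖overlapKernel k (angleDiff w σ) *
        Complex.exp (2 * Real.pi * Complex.I * (pairing (orbit w W σ.1) η : ℂ)) *
        (Complex.exp (deviation ħ (orbit w W σ.1) (orbit w W σ.2) η) - 1)‖ ≤
        Real.exp 3 * s * Real.exp (-(decayExponent k (angleDiff w σ) / 2)) := by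
      intro σ
      rw [norm_mul, norm_mul, norm_cexp_two_pi_I_mul, mul_one, norm_overlapKernel]
      exact exp_mul_norm_exp_sub_one_le (hQ0 σ) hs0 hs1 (norm_deviation_le w k hħ hW σ η)
    have hc1 : Continuous fun σ : (Fin m → ℝ) × (Fin m → ℝ) => overlapKernel k (angleDiff w σ) *
        Complex.exp (2 * Real.pi * Complex.I * (pairing (orbit w W σ.1) η : ℂ)) := by
      refine ((continuous_overlapKernel k).comp (continuous_angleDiff w)).mul
        (Complex.continuous_exp.comp (continuous_const.mul (Complex.continuous_ofReal.comp ?_)))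
      exact (continuous_pairing_orbit w W η).comp continuous_fst
    have hi3 : Integrable (fun σ : (Fin m → ℝ) × (Fin m → ℝ) => overlapKernel k (angleDiff w σ) *
        Complex.exp (2 * Real.pi * Complex.I * (pairing (orbit w W σ.1) η : ℂ))) (μ.prod μ) := by
      refine integrable_of_continuous_of_bound hc1 1 fun σ => ?_
      rw [norm_mul, norm_cexp_two_pi_I_mul, mul_one, norm_overlapKernel]
      exact Real.exp_le_one_iff.2 (by linarith [hQ0 σ])
    have hi4 : Integrable (fun σ : (Fin m → ℝ) × (Fin m → ℝ) => overlapKernel k (angleDiff w σ) *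
        Complex.exp (2 * Real.pi * Complex.I * (pairing (orbit w W σ.1) η : ℂ)) *
        (Complex.exp (deviation ħ (orbit w W σ.1) (orbit w W σ.2) η) - 1)) (μ.prod μ) := by
      refine (hi2.const_mul (Real.exp 3 * s)).mono' (Continuous.aestronglyMeasurable ?_)
        (Eventually.of_forall hE)
      exact hc1.mul ((Complex.continuous_exp.comp
        (continuous_deviation_orbit w W ħ η)).sub continuous_const)
    -- The leading term factors exactly, because the integral of the kernel over the second time is
    -- the same for every first time.
    have hNA : ∫ σ, overlapKernel k (angleDiff w σ) *
        Complex.exp (2 * Real.pi * Complex.I * (pairing (orbit w W σ.1) η : ℂ)) ∂μ.prod μ =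
        N * A := by
      have hi5 : Integrable (fun σ => overlapKernel k (angleDiff w σ)) (μ.prod μ) := by
        refine integrable_of_continuous_of_bound
          ((continuous_overlapKernel k).comp (continuous_angleDiff w)) 1 fun σ => ?_
        rw [norm_overlapKernel]
        exact Real.exp_le_one_iff.2 (by linarith [hQ0 σ])
      rw [integral_prod _ hi3, hN, integral_prod _ hi5]
      simp_rw [integral_mul_const, hμ, integral_overlapKernel_const hT hw k K hK]
      rw [integral_const_mul, integral_const]
      simp [hA, hμ]
    have hdiff : X η - N * A = ∫ σ, overlapKernel k (angleDiff w σ) *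
        Complex.exp (2 * Real.pi * Complex.I * (pairing (orbit w W σ.1) η : ℂ)) *
        (Complex.exp (deviation ħ (orbit w W σ.1) (orbit w W σ.2) η) - 1) ∂μ.prod μ := by
      rw [← hNA, sub_eq_iff_eq_add, ← integral_add hi4 hi3]
      refine integral_congr_ae (Eventually.of_forall fun σ => ?_)
      simp only
      ring
    have hb : ‖X η - N * A‖ ≤ Real.exp 3 * s * J := by
      rw [hdiff, hJ, ← integral_const_mul]
      exact norm_integral_le_of_norm_le (hi2.const_mul _) (Eventually.of_forall hE)
    have e1 : ambiguity ħ S η / ((∫ x, ‖S x‖ ^ 2 : ℝ) : ℂ) - A = (X η - N * A) / N := by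
      rw [hnorm, hamb]
      field_simp
    rw [e1, norm_div, div_le_iff₀ (norm_pos_iff.2 hN0)]
    calc ‖X η - N * A‖ ≤ Real.exp 3 * s * J := hb
      _ ≤ Real.exp 3 * s * (2 ^ (d + 1) * ‖N‖) := by gcongr
      _ = Real.exp 3 * 2 ^ (d + 1) * s * ‖N‖ := by ring
      _ ≤ (Real.exp 3 * 2 ^ (d + 1) + 2) * s * ‖N‖ := by
        gcongr
        linarith
  · have h1 : ‖ambiguity ħ S η / ((∫ x, ‖S x‖ ^ 2 : ℝ) : ℂ)‖ ≤ 1 := by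
      rw [norm_div, Complex.norm_real, Real.norm_eq_abs, abs_of_pos hpos, div_le_one hpos]
      exact norm_ambiguity_le ħ S η
    have h2 : ‖A‖ ≤ 1 := by
      refine (norm_integral_le_of_norm_le_const (C := 1)
        (Eventually.of_forall fun τ => (norm_cexp_two_pi_I_mul _).le)).trans ?_
      simp
    have h3 : 0 < Real.exp 3 * 2 ^ (d + 1) := by positivity
    calc _ ≤ (1 : ℝ) + 1 := (norm_sub_le _ _).trans (add_le_add h1 h2)
      _ ≤ (Real.exp 3 * 2 ^ (d + 1) + 2) * s := by nlinarith

/-! ### Eigenfunctions concentrating on a torus orbit -/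

/-- The complex coordinates `x_j + i ξ_j` of a point of phase space. -/
def complexCoord {d : ℕ} (z : Phase d) (j : Fin d) : ℂ := (z.1 j : ℂ) + (z.2 j : ℂ) * Complex.I

/-- The action variables `(ξ_j² + x_j²) / 2`. -/
def action {d : ℕ} (z : Phase d) (j : Fin d) : ℝ := (z.2 j ^ 2 + z.1 j ^ 2) / 2

theorem norm_complexCoord_sq {d : ℕ} (z : Phase d) (j : Fin d) :
    ‖complexCoord z j‖ ^ 2 = 2 * action z j := by
  rw [Complex.sq_norm, Complex.normSq_apply, complexCoord, action]
  simp
  ring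

theorem pairing_orbit_complexCoord {d m : ℕ} (w : Fin m → Fin d → ℝ) (τ : Fin m → ℝ) (z : Phase d)
    (η : Phase d) :
    pairing (orbit w (complexCoord z) τ) η =
      inner ℝ η.1 (multiFlow w τ z).1 + inner ℝ η.2 (multiFlow w τ z).2 := by
  rw [multiFlow_apply, pairing, Finset.sum_add_distrib]
  have h : ∀ j, orbit w (complexCoord z) τ j =
      ((Real.cos (angle w τ j) * z.1 j + Real.sin (angle w τ j) * z.2 j : ℝ) : ℂ) +
      ((Real.cos (angle w τ j) * z.2 j - Real.sin (angle w τ j) * z.1 j : ℝ) : ℂ) * Complex.I := by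
    intro j
    rw [orbit, complexCoord, show -(Complex.I * (angle w τ j : ℂ)) =
      ((-angle w τ j : ℝ) : ℂ) * Complex.I by push_cast; ring, Complex.exp_mul_I,
      ← Complex.ofReal_cos, ← Complex.ofReal_sin, Real.cos_neg, Real.sin_neg]
    push_cast
    linear_combination (-(Complex.sin (angle w τ j)) * z.2 j) * Complex.I_sq
  have hre : ∀ j, (orbit w (complexCoord z) τ j).re =
      Real.cos (angle w τ j) * z.1 j + Real.sin (angle w τ j) * z.2 j := fun j => by
    rw [h j, Complex.add_re, Complex.ofReal_re, Complex.re_ofReal_mul, Complex.I_re, mul_zero,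
      add_zero]
  have him : ∀ j, (orbit w (complexCoord z) τ j).im =
      Real.cos (angle w τ j) * z.2 j - Real.sin (angle w τ j) * z.1 j := fun j => by
    rw [h j, Complex.add_im, Complex.ofReal_im, Complex.im_ofReal_mul, Complex.I_im, mul_one,
      zero_add]
  simp only [hre, him, flow, PiLp.inner_apply, one_mul]
  congr 1 <;> exact Finset.sum_congr rfl fun j _ => by simp [angle, mul_comm]

/-- The flows are linear and rotate each coordinate plane, so the distance of the starting points is
preserved uniformly in time. -/
theorem abs_pairing_orbit_sub_le {d m : ℕ} (w : Fin m → Fin d → ℝ) (τ : Fin m → ℝ)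
    {W Z : Fin d → ℂ} {ε : ℝ} (h : ∀ j, ‖W j - Z j‖ ≤ ε) (η : Phase d) :
    |pairing (orbit w W τ) η - pairing (orbit w Z τ) η| ≤ 2 * d * ε * ‖η‖ := by
  rw [pairing, pairing, ← Finset.sum_sub_distrib]
  refine (Finset.abs_sum_le_sum_abs _ _).trans ?_
  have hj : ∀ j, |η.1 j * (orbit w W τ j).re + η.2 j * (orbit w W τ j).im -
      (η.1 j * (orbit w Z τ j).re + η.2 j * (orbit w Z τ j).im)| ≤ 2 * ε * ‖η‖ := by
    intro j
    have h0 : ‖orbit w W τ j - orbit w Z τ j‖ ≤ ε := by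
      have : orbit w W τ j - orbit w Z τ j = orbit w (fun j => W j - Z j) τ j := by
        simp only [orbit]
        ring
      rw [this, norm_orbit]
      exact h j
    have h1 : |η.1 j| ≤ ‖η‖ := (PiLp.norm_apply_le η.1 j).trans (norm_fst_le η)
    have h2 : |η.2 j| ≤ ‖η‖ := (PiLp.norm_apply_le η.2 j).trans (norm_snd_le η)
    have h3 := (Complex.abs_re_le_norm (orbit w W τ j - orbit w Z τ j)).trans h0
    have h4 := (Complex.abs_im_le_norm (orbit w W τ j - orbit w Z τ j)).trans h0
    rw [show η.1 j * (orbit w W τ j).re + η.2 j * (orbit w W τ j).im -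
      (η.1 j * (orbit w Z τ j).re + η.2 j * (orbit w Z τ j).im) =
      η.1 j * (orbit w W τ j - orbit w Z τ j).re + η.2 j * (orbit w W τ j - orbit w Z τ j).im by
        rw [Complex.sub_re, Complex.sub_im]; ring]
    refine (abs_add_le _ _).trans ?_
    rw [abs_mul, abs_mul]
    have h5 := mul_le_mul h1 h3 (abs_nonneg _) (norm_nonneg _)
    have h6 := mul_le_mul h2 h4 (abs_nonneg _) (norm_nonneg _)
    linarith
  refine (Finset.sum_le_sum fun j _ => hj j).trans_eq ?_
  simp
  ring

theorem norm_cexp_two_pi_I_sub_le (a b : ℝ) :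
    ‖Complex.exp (2 * Real.pi * Complex.I * (a : ℂ)) -
      Complex.exp (2 * Real.pi * Complex.I * (b : ℂ))‖ ≤ 2 * Real.pi * |a - b| := by
  have h1 : Complex.exp (2 * Real.pi * Complex.I * (a : ℂ)) -
      Complex.exp (2 * Real.pi * Complex.I * (b : ℂ)) =
      Complex.exp (2 * Real.pi * Complex.I * (b : ℂ)) *
        (Complex.exp (Complex.I * ((2 * Real.pi * (a - b) : ℝ) : ℂ)) - 1) := by
    rw [mul_sub, ← Complex.exp_add, mul_one]
    congr 2
    push_cast
    ring
  rw [h1, norm_mul, norm_cexp_two_pi_I_mul, one_mul]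
  refine Real.norm_exp_I_mul_ofReal_sub_one_le.trans_eq ?_
  rw [Real.norm_eq_abs, abs_mul, abs_of_pos Real.two_pi_pos]

theorem scaledNorm_le {d : ℕ} (ħ : ℝ) (η : Phase d) :
    scaledNorm ħ η ≤ 4 * Real.pi * Real.sqrt ħ * ‖η‖ := by
  have hpi := Real.pi_pos
  have h1 : Real.sqrt (‖η.1‖ ^ 2 + ‖η.2‖ ^ 2) ≤ 2 * ‖η‖ := by
    refine Real.sqrt_le_iff.2 ⟨by positivity, ?_⟩
    have h2 := norm_fst_le η
    have h3 := norm_snd_le η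
    nlinarith [norm_nonneg η.1, norm_nonneg η.2, norm_nonneg η]
  calc scaledNorm ħ η ≤ 2 * Real.pi * (Real.sqrt ħ * (2 * ‖η‖)) := by
        rw [scaledNorm]
        gcongr
    _ = _ := by ring

/-- The point with the same angles as `z` and with the actions `ħ k`. -/
def quantizedPoint {d : ℕ} (ħ : ℝ) (k : Fin d → ℕ) (z : Phase d) (j : Fin d) : ℂ :=
  (Real.sqrt (2 * ħ * k j) : ℂ) * Complex.exp ((complexCoord z j).arg * Complex.I)

theorem norm_quantizedPoint_sq {d : ℕ} {ħ : ℝ} (hħ : 0 < ħ) (k : Fin d → ℕ) (z : Phase d)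
    (j : Fin d) : ‖quantizedPoint ħ k z j‖ ^ 2 = 2 * ħ * k j := by
  rw [quantizedPoint, norm_mul, Complex.norm_exp_ofReal_mul_I, mul_one, Complex.norm_real,
    Real.norm_eq_abs, sq_abs, Real.sq_sqrt (by positivity)]

/-- Hölder continuity of the square root, valid also at `0`. It turns an error `O(ħ)` in the actions
into `O(√ħ)` in the coordinates without a lower bound on the actions. -/
theorem abs_sqrt_sub_le {a b : ℝ} (ha : 0 ≤ a) (hb : 0 ≤ b) :
    |Real.sqrt a - b| ≤ Real.sqrt |a - b ^ 2| := by
  refine Real.le_sqrt_of_sq_le ?_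
  have h1 : 0 ≤ Real.sqrt a := Real.sqrt_nonneg a
  have h2 : a - b ^ 2 = (Real.sqrt a - b) * (Real.sqrt a + b) := by
    nth_rewrite 1 [← Real.sq_sqrt ha]
    ring
  rw [h2, abs_mul, sq]
  refine mul_le_mul_of_nonneg_left ?_ (abs_nonneg _)
  rw [abs_of_nonneg (by positivity : 0 ≤ Real.sqrt a + b)]
  exact abs_sub_le_iff.2 ⟨by linarith, by linarith⟩

theorem norm_quantizedPoint_sub_le {d : ℕ} {ħ : ℝ} (hħ : 0 < ħ) (k : Fin d → ℕ) (z : Phase d)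
    {B : ℝ} (hB : ∀ j, |(k j : ℝ) - action z j / ħ| ≤ B) (j : Fin d) :
    ‖quantizedPoint ħ k z j - complexCoord z j‖ ≤ Real.sqrt (2 * B) * Real.sqrt ħ := by
  have h1 : quantizedPoint ħ k z j - complexCoord z j =
      ((Real.sqrt (2 * ħ * k j) - ‖complexCoord z j‖ : ℝ) : ℂ) *
        Complex.exp ((complexCoord z j).arg * Complex.I) := by
    rw [Complex.ofReal_sub, sub_mul, Complex.norm_mul_exp_arg_mul_I, quantizedPoint]
  have hB0 : 0 ≤ B := (abs_nonneg _).trans (hB j)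
  rw [h1, norm_mul, Complex.norm_exp_ofReal_mul_I, mul_one, Complex.norm_real, Real.norm_eq_abs]
  refine (abs_sqrt_sub_le (by positivity) (norm_nonneg _)).trans ?_
  rw [← Real.sqrt_mul (by positivity)]
  refine Real.sqrt_le_sqrt ?_
  rw [norm_complexCoord_sq, show 2 * ħ * k j - 2 * action z j = 2 * ħ * (k j - action z j / ħ) by
    field_simp, abs_mul, abs_of_pos (by positivity : 0 < 2 * ħ)]
  have := mul_le_mul_of_nonneg_left (hB j) (by positivity : 0 ≤ 2 * ħ)
  linarith

theorem integral_average_eq {d m : ℕ} {w : Fin m → Fin d → ℝ} (μ : Measure (Fin m → ℝ))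
    [IsProbabilityMeasure μ] (a : Phase d → ℂ) (ha : ContDiff ℝ ((⊤ : ℕ∞) : WithTop ℕ∞) a)
    (hc : HasCompactSupport a) (z : Phase d) :
    ∫ τ, a (multiFlow w τ z) ∂μ = ∫ η : Phase d, symbolFourier a ha hc η *
      ∫ τ, Complex.exp (2 * Real.pi * Complex.I *
        (pairing (orbit w (complexCoord z) τ) η : ℂ)) ∂μ := by
  have hA := (symbolFourier a ha hc).continuous
  have hp : Continuous fun p : (Fin m → ℝ) × Phase d => pairing (orbit w (complexCoord z) p.1) p.2 := by
    have h := continuous_orbit w (complexCoord z)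
    have h' : ∀ j, Continuous fun p : (Fin m → ℝ) × Phase d => orbit w (complexCoord z) p.1 j :=
      fun j => (continuous_apply j).comp (h.comp continuous_fst)
    unfold pairing
    refine continuous_finsetSum _ fun j _ => ?_
    refine (Continuous.mul (by fun_prop) (Complex.continuous_re.comp (h' j))).add
      (Continuous.mul (by fun_prop) (Complex.continuous_im.comp (h' j)))
  have hint : Integrable (fun p : (Fin m → ℝ) × Phase d =>
      Complex.exp (2 * Real.pi * Complex.I * (pairing (orbit w (complexCoord z) p.1) p.2 : ℂ)) *
        symbolFourier a ha hc p.2) (μ.prod (volume : Measure (Phase d))) := by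
    have hb := Integrable.mul_prod (μ := μ) (f := fun _ => (1 : ℝ)) (integrable_const 1)
      (symbolFourier a ha hc).integrable.norm (ν := (volume : Measure (Phase d)))
    refine hb.mono' (Continuous.aestronglyMeasurable (by fun_prop))
      (Eventually.of_forall fun p => ?_)
    rw [norm_mul, norm_cexp_two_pi_I_mul]
  have h1 : ∀ τ, a (multiFlow w τ z) = ∫ η : Phase d, Complex.exp (2 * Real.pi * Complex.I *
      (pairing (orbit w (complexCoord z) τ) η : ℂ)) * symbolFourier a ha hc η := by
    intro τ
    rw [symbol_eq_integral_fourier a ha hc]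
    refine integral_congr_ae (Eventually.of_forall fun η => ?_)
    simp only [pairing_orbit_complexCoord]
  simp_rw [h1]
  rw [integral_integral_swap hint]
  refine integral_congr_ae (Eventually.of_forall fun η => ?_)
  simp only
  rw [integral_mul_const, mul_comm]

theorem continuous_ambiguity {d : ℕ} (ħ : ℝ) (ψ : 𝓢(Conf d, ℂ)) : Continuous (ambiguity ħ ψ) := by
  obtain ⟨C, hC⟩ := ψ.decay 0 0
  have hb : ∀ x, ‖ψ x‖ ≤ C := fun x => by simpa using hC.2 x
  have hψ := ψ.continuous
  unfold ambiguity
  refine continuous_of_dominated (bound := fun x => ‖ψ x‖ * C)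
    (fun η => Continuous.aestronglyMeasurable (by fun_prop))
    (fun η => Eventually.of_forall fun x => ?_) (ψ.integrable.norm.mul_const C)
    (Eventually.of_forall fun x => by fun_prop)
  rw [norm_mul, norm_mul, norm_star, norm_cexp_two_pi_I_mul, one_mul]
  gcongr
  exact hb _

/-- For quantum numbers `k ħ` with `ħ k` within `O(ħ)` of the actions of `z`, there are normalized
joint eigenfunctions with the corresponding eigenvalues which concentrate on the torus orbit of
`z` at the rate `√ħ`. -/
theorem exists_concentrating_eigenfunctions {d m : ℕ} {w : Fin m → Fin d → ℝ} {T : Fin m → ℝ}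
    (hT : ∀ n, 0 < T n) (hw : ∀ n j, ∃ l : ℤ, T n * w n j = l * (2 * Real.pi))
    (hpos : ∀ j, 0 < ∑ n, w n j) (z : Phase d) {M B : ℝ} (hM : 0 < M)
    (hM' : 648 * d * 2 ^ d ≤ Real.sqrt M) (k : ℝ → Fin d → ℕ)
    (hkM : ∀ ħ, 0 < ħ → ∀ j, M ≤ k ħ j)
    (hkB : ∀ ħ, 0 < ħ → ∀ j, |(k ħ j : ℝ) - action z j / ħ| ≤ B) :
    ∃ Ψ : ℝ → 𝓢(Conf d, ℂ),
      (∀ ħ, 0 < ħ → (∀ n x, oscillator (w n) ħ (Ψ ħ) x =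
        ((∑ j, w n j * (ħ * (k ħ j + 1 / 2)) : ℝ) : ℂ) * Ψ ħ x) ∧ ∫ x, ‖Ψ ħ x‖ ^ 2 = 1) ∧
      ∀ a : Phase d → ℂ, ContDiff ℝ ((⊤ : ℕ∞) : WithTop ℕ∞) a → HasCompactSupport a →
        ∃ C : ℝ, ∀ ħ, 0 < ħ → ‖l2inner (Ψ ħ) (weylOp ħ a (Ψ ħ)) -
          ∫ τ, a (multiFlow w τ z) ∂boxMeasure T‖ ≤ C * Real.sqrt ħ := by
  have hprob := isProbabilityMeasure_boxMeasure hT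
  have hpi := Real.pi_pos
  choose K hK using fun k => exists_resonant_finset w hpos k
  set S : ∀ ħ : ℝ, 0 < ħ → 𝓢(Conf d, ℂ) := fun ħ hħ =>
    projectedState ħ hħ (quantizedPoint ħ (k ħ) z) (K (k ħ)) with hS
  have hmain := fun (ħ : ℝ) (hħ : 0 < ħ) => norm_ambiguity_sub_average_le hT hw (k ħ) (K (k ħ))
    (hK (k ħ)) hM (hkM ħ hħ) hM' hħ (norm_quantizedPoint_sq hħ (k ħ) z)
  set c : ∀ ħ : ℝ, 0 < ħ → ℝ := fun ħ hħ => (Real.sqrt (∫ x, ‖S ħ hħ x‖ ^ 2))⁻¹ with hc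
  have hcsq : ∀ ħ hħ, c ħ hħ ^ 2 = (∫ x, ‖S ħ hħ x‖ ^ 2)⁻¹ := fun ħ hħ => by
    rw [hc, inv_pow, Real.sq_sqrt (hmain ħ hħ).1.le]
  classical
  -- The projected state is only constructed for `ħ > 0`; the value `0` elsewhere plays no role.
  refine ⟨fun ħ => if hħ : 0 < ħ then (c ħ hħ : ℂ) • S ħ hħ else 0, fun ħ hħ => ⟨fun n x => ?_, ?_⟩,
    fun a ha hca => ?_⟩
  · simp only [dif_pos hħ]
    rw [oscillator_smul, smul_apply, smul_eq_mul,
      show S ħ hħ = projectedState ħ hħ (quantizedPoint ħ (k ħ) z) (K (k ħ)) from rfl, projectedState,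
      oscillator_sum_hermiteFun (w n) hħ _ _ (∑ j, w n j * (ħ * (k ħ j + 1 / 2)))]
    · ring
    · intro κ hκ
      have h := (hK (k ħ) κ).1 hκ n
      rw [← sub_eq_zero, ← Finset.sum_sub_distrib, ← mul_zero ħ, ← h, Finset.mul_sum]
      refine Finset.sum_congr rfl fun j _ => ?_
      ring
  · simp only [dif_pos hħ]
    have h1 : ∀ x, ‖((c ħ hħ : ℂ) • S ħ hħ) x‖ ^ 2 = c ħ hħ ^ 2 * ‖S ħ hħ x‖ ^ 2 := by
      intro x
      rw [smul_apply, smul_eq_mul, norm_mul, mul_pow, Complex.norm_real, Real.norm_eq_abs, sq_abs]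
    simp_rw [h1]
    rw [integral_const_mul, hcsq, inv_mul_cancel₀ (hmain ħ hħ).1.ne']
  · set A := symbolFourier a ha hca with hA
    -- The first summand comes from the translations, the second from replacing the quantized centre
    -- by `z`.
    set C₁ : ℝ := (Real.exp 3 * 2 ^ (d + 1) + 2) * (4 * Real.pi) +
      2 * Real.pi * (2 * d * Real.sqrt (2 * B)) with hC₁
    refine ⟨C₁ * ∫ η : Phase d, ‖η‖ * ‖A η‖, fun ħ hħ => ?_⟩
    simp only [dif_pos hħ]
    rw [l2inner_weylOp hħ a ha hca, integral_average_eq (boxMeasure T) a ha hca, ← hA]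
    have hamb : ∀ η, ambiguity ħ ((c ħ hħ : ℂ) • S ħ hħ : 𝓢(Conf d, ℂ)) η =
        ambiguity ħ (S ħ hħ) η / ((∫ x, ‖S ħ hħ x‖ ^ 2 : ℝ) : ℂ) := by
      intro η
      have h1 : (((c ħ hħ : ℂ) • S ħ hħ : 𝓢(Conf d, ℂ)) : Conf d → ℂ) =
          fun x => (c ħ hħ : ℂ) * S ħ hħ x := funext fun x => by rw [smul_apply, smul_eq_mul]
      rw [h1, ambiguity_smul, ← Complex.ofReal_pow, hcsq, Complex.ofReal_inv, div_eq_inv_mul]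
    simp_rw [hamb]
    set F : Phase d → ℂ := fun η =>
      ambiguity ħ (S ħ hħ) η / ((∫ x, ‖S ħ hħ x‖ ^ 2 : ℝ) : ℂ) with hF
    set G : Phase d → ℂ := fun η => ∫ τ, Complex.exp (2 * Real.pi * Complex.I *
      (pairing (orbit w (complexCoord z) τ) η : ℂ)) ∂boxMeasure T with hG
    have hbound : ∀ η, ‖F η - G η‖ ≤ C₁ * Real.sqrt ħ * ‖η‖ := by
      intro η
      have h1 := (hmain ħ hħ).2 η
      have h2 : ‖(∫ τ, Complex.exp (2 * Real.pi * Complex.I *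
          (pairing (orbit w (quantizedPoint ħ (k ħ) z) τ) η : ℂ)) ∂boxMeasure T) - G η‖ ≤
          2 * Real.pi * (2 * d * (Real.sqrt (2 * B) * Real.sqrt ħ) * ‖η‖) := by
        rw [hG, ← integral_sub]
        · refine (norm_integral_le_of_norm_le_const
            (C := 2 * Real.pi * (2 * d * (Real.sqrt (2 * B) * Real.sqrt ħ) * ‖η‖))
            (Eventually.of_forall fun τ => ?_)).trans_eq (by simp)
          refine (norm_cexp_two_pi_I_sub_le _ _).trans ?_
          gcongr
          exact abs_pairing_orbit_sub_le w τ
            (norm_quantizedPoint_sub_le hħ (k ħ) z (hkB ħ hħ)) η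
        all_goals
          refine integrable_of_continuous_of_bound ?_ 1 fun τ => (norm_cexp_two_pi_I_mul _).le
          exact Complex.continuous_exp.comp (continuous_const.mul
            (Complex.continuous_ofReal.comp (continuous_pairing_orbit w _ η)))
      have h3 := scaledNorm_le ħ η
      have h4 : 0 < Real.exp 3 * 2 ^ (d + 1) + 2 := by positivity
      calc ‖F η - G η‖ ≤ _ := norm_sub_le_norm_sub_add_norm_sub _ _ _
        _ ≤ (Real.exp 3 * 2 ^ (d + 1) + 2) * (4 * Real.pi * Real.sqrt ħ * ‖η‖) +
            2 * Real.pi * (2 * d * (Real.sqrt (2 * B) * Real.sqrt ħ) * ‖η‖) :=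
          add_le_add (h1.trans (by gcongr)) h2
        _ = _ := by
          rw [hC₁]
          ring
    have hFm : Integrable fun η => A η * F η := by
      refine A.integrable.norm.mono' (A.continuous.mul
        ((continuous_ambiguity ħ (S ħ hħ)).div_const _)).aestronglyMeasurable
        (Eventually.of_forall fun η => ?_)
      rw [norm_mul]
      refine mul_le_of_le_one_right (norm_nonneg _) ?_
      rw [hF, norm_div, Complex.norm_real, Real.norm_eq_abs, abs_of_pos (hmain ħ hħ).1]
      exact div_le_one_of_le₀ (norm_ambiguity_le ħ _ η) (hmain ħ hħ).1.le
    have hGm : Integrable fun η => A η * G η := by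
      have hGc : Continuous G := by
        refine continuous_of_dominated (bound := fun _ => 1)
          (fun η => Continuous.aestronglyMeasurable ?_)
          (fun η => Eventually.of_forall fun τ => (norm_cexp_two_pi_I_mul _).le)
          (integrable_const 1) (Eventually.of_forall fun τ => ?_)
        · exact Complex.continuous_exp.comp (continuous_const.mul
            (Complex.continuous_ofReal.comp (continuous_pairing_orbit w _ η)))
        · unfold pairing
          fun_prop
      refine A.integrable.norm.mono' (A.continuous.mul hGc).aestronglyMeasurable
        (Eventually.of_forall fun η => ?_)
      rw [norm_mul]
      refine mul_le_of_le_one_right (norm_nonneg _) ?_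
      refine (norm_integral_le_of_norm_le_const (C := 1)
        (Eventually.of_forall fun τ => (norm_cexp_two_pi_I_mul _).le)).trans_eq (by simp)
    have hAi : Integrable (fun η : Phase d => ‖η‖ * ‖A η‖) := by
      simpa using A.integrable_pow_mul volume 1
    rw [← integral_sub hFm hGm]
    calc _ ≤ ∫ η : Phase d, C₁ * Real.sqrt ħ * (‖η‖ * ‖A η‖) := by
          refine norm_integral_le_of_norm_le (hAi.const_mul _) (Eventually.of_forall fun η => ?_)
          rw [← mul_sub, norm_mul]
          calc ‖A η‖ * ‖F η - G η‖ ≤ ‖A η‖ * (C₁ * Real.sqrt ħ * ‖η‖) := by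
                gcongr
                exact hbound η
            _ = _ := by ring
      _ = _ := by
          rw [integral_const_mul]
          ring

/-! ### Lattice points near a rational subspace -/

/-- A section of the map onto its range, extended to the whole space. It makes `1 - G * N` a
projection onto the kernel of `N` with entries in the same field, here `ℚ`. -/
theorem exists_matrix_generalized_inverse {K : Type*} [Field K] {d m : ℕ}
    (N : Matrix (Fin m) (Fin d) K) : ∃ G : Matrix (Fin d) (Fin m) K, N * G * N = N := by
  obtain ⟨s, hs⟩ := LinearMap.exists_rightInverse_of_surjective N.mulVecLin.rangeRestrict
    N.mulVecLin.range_rangeRestrict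
  obtain ⟨g, hg⟩ := LinearMap.exists_extend s
  refine ⟨LinearMap.toMatrix' g, ?_⟩
  refine Matrix.toLin'.injective (LinearMap.ext fun x => ?_)
  rw [Matrix.toLin'_mul, Matrix.toLin'_mul, Matrix.toLin'_toMatrix']
  have h1 : g (N.mulVecLin x) = s (N.mulVecLin.rangeRestrict x) :=
    LinearMap.congr_fun hg (N.mulVecLin.rangeRestrict x)
  have h2 : N.mulVecLin.rangeRestrict (s (N.mulVecLin.rangeRestrict x)) =
    N.mulVecLin.rangeRestrict x := LinearMap.congr_fun hs _
  change N.mulVecLin (g (N.mulVecLin x)) = N.mulVecLin x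
  rw [h1]
  exact congrArg Subtype.val h2

theorem exists_common_denominator {d : ℕ} (P : Matrix (Fin d) (Fin d) ℚ) :
    ∃ (D : ℤ) (p : Fin d → Fin d → ℤ), D ≠ 0 ∧ ∀ i j, (p i j : ℚ) = D * P i j := by
  obtain ⟨D, hD⟩ := IsLocalization.exist_integer_multiples_of_finite (nonZeroDivisors ℤ)
    fun q : Fin d × Fin d => P q.1 q.2
  choose p hp using hD
  refine ⟨D, fun i j => p (i, j), nonZeroDivisors.coe_ne_zero D, fun i j => ?_⟩
  have h := hp (i, j)
  simpa [Algebra.smul_def] using h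

/-- Every real solution of a homogeneous rational system lies at bounded distance from an integer
solution. -/
theorem exists_lattice_approx {d m : ℕ} (ν : Fin m → Fin d → ℚ) :
    ∃ R : ℝ, 0 ≤ R ∧ ∀ δ : Fin d → ℝ, (∀ n, ∑ j, (ν n j : ℝ) * δ j = 0) →
      ∃ l : Fin d → ℤ, (∀ n, ∑ j, (ν n j : ℝ) * l j = 0) ∧ ∀ j, |(l j : ℝ) - δ j| ≤ R := by
  obtain ⟨G, hG⟩ := exists_matrix_generalized_inverse (Matrix.of ν)
  obtain ⟨D, p, hD, hp⟩ := exists_common_denominator (1 - G * Matrix.of ν)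
  have hp' : ∀ i j, (p i j : ℝ) = D * ((1 - G * Matrix.of ν : Matrix _ _ ℚ) i j : ℝ) := by
    intro i j
    exact_mod_cast hp i j
  have hD' : (D : ℝ) ≠ 0 := by exact_mod_cast hD
  have hzero : ∀ n i, ∑ j, (ν n j : ℝ) * p j i = 0 := by
    intro n i
    have h : (Matrix.of ν * (1 - G * Matrix.of ν) : Matrix _ _ ℚ) n i = 0 := by
      rw [Matrix.mul_sub, Matrix.mul_one, ← Matrix.mul_assoc, hG, sub_self, Matrix.zero_apply]
    rw [Matrix.mul_apply] at h
    have h' : ∑ j, (ν n j : ℝ) * ((1 - G * Matrix.of ν : Matrix _ _ ℚ) j i : ℝ) = 0 := by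
      exact_mod_cast h
    simp_rw [hp', mul_left_comm _ (D : ℝ), ← Finset.mul_sum, h', mul_zero]
  -- A real solution is fixed by the projection, hence it is a real combination, with coefficients
  -- `δ i / D`, of the integer columns of `p`, which are themselves solutions.
  have hfix : ∀ δ : Fin d → ℝ, (∀ n, ∑ j, (ν n j : ℝ) * δ j = 0) → ∀ j,
      ∑ i, (p j i : ℝ) * (δ i / D) = δ j := by
    intro δ hδ j
    have h1 : ∀ i, (p j i : ℝ) * (δ i / D) =
        (if j = i then δ i else 0) - ∑ n, (G j n : ℝ) * ((ν n i : ℝ) * δ i) := by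
      intro i
      rw [hp', Matrix.sub_apply, Matrix.mul_apply, Matrix.one_apply]
      push_cast
      simp only [Matrix.of_apply, ← mul_assoc, ← Finset.sum_mul]
      have h2 : ∀ r : ℝ, D * r * (δ i / D) = r * δ i := fun r => by field_simp
      rw [h2]
      split_ifs <;> simp [sub_mul]
    simp_rw [h1, Finset.sum_sub_distrib]
    rw [Finset.sum_comm]
    simp_rw [← Finset.mul_sum, hδ]
    simp
  -- Rounding the coefficients down stays among the integer solutions and changes each by at most
  -- `1`.
  refine ⟨∑ j, ∑ i, |(p j i : ℝ)|, by positivity, fun δ hδ =>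
    ⟨fun j => ∑ i, p j i * ⌊δ i / D⌋, fun n => ?_, fun j => ?_⟩⟩
  · push_cast
    simp_rw [Finset.mul_sum, ← mul_assoc]
    rw [Finset.sum_comm]
    simp_rw [← Finset.sum_mul, hzero, zero_mul]
    simp
  · rw [← hfix δ hδ j]
    push_cast
    rw [← Finset.sum_sub_distrib]
    refine (Finset.abs_sum_le_sum_abs _ _).trans ?_
    refine le_trans (Finset.sum_le_sum fun i _ => ?_)
      (Finset.single_le_sum (f := fun j => ∑ i, |(p j i : ℝ)|)
        (fun j _ => by positivity) (Finset.mem_univ j))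
    rw [← mul_sub, abs_mul]
    refine mul_le_of_le_one_right (abs_nonneg _) ?_
    rw [abs_le]
    constructor <;> linarith [Int.floor_le (δ i / D), Int.lt_floor_add_one (δ i / D)]

/-! ### Frequencies and periods -/

theorem coe_basis_ne_zero {d : ℕ} {ω : Fin d → ℝ}
    (v : Module.Basis (Fin (freqRank ω)) ℚ (freqSpan ω)) (n : Fin (freqRank ω)) :
    (v n : ℝ) ≠ 0 := fun h => v.ne_zero n (Subtype.ext h)

/-- If `ν n` vanished, the `n`-th coordinate would vanish on every `ω j`, hence on their span, but
it equals `1` on `v n`. This makes `period_spec` available. -/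
theorem partFreq_ne_zero {d : ℕ} {ω : Fin d → ℝ}
    (v : Module.Basis (Fin (freqRank ω)) ℚ (freqSpan ω)) (ν : Fin (freqRank ω) → Fin d → ℚ)
    (hν : ∀ j, ω j = ∑ n, (v n : ℝ) * (ν n j : ℝ)) (n : Fin (freqRank ω)) :
    partFreq v ν n ≠ 0 := by
  intro h
  have h0 : ∀ j, ν n j = 0 := fun j => by
    have h1 : (v n : ℝ) * (ν n j : ℝ) = 0 := congrFun h j
    exact_mod_cast (mul_eq_zero.1 h1).resolve_left (coe_basis_ne_zero v n)
  have hcoord : ∀ x (hx : x ∈ freqSpan ω), v.coord n ⟨x, hx⟩ = 0 := by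
    intro x hx
    induction hx using Submodule.span_induction with
    | mem x hx =>
      obtain ⟨j, rfl⟩ := hx
      have h2 : (⟨ω j, Submodule.subset_span ⟨j, rfl⟩⟩ : freqSpan ω) = ∑ i, ν i j • v i := by
        refine Subtype.ext ?_
        rw [Submodule.coe_sum]
        refine (hν j).trans ?_
        refine Finset.sum_congr rfl fun i _ => ?_
        rw [Submodule.coe_smul, Rat.smul_def, mul_comm]
      change v.coord n (⟨ω j, Submodule.subset_span ⟨j, rfl⟩⟩ : freqSpan ω) = 0
      rw [h2, Module.Basis.coord_apply, v.repr_sum_self, h0]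
    | zero => exact (v.coord n).map_zero
    | add x y hx hy h1 h2 =>
      exact ((v.coord n).map_add ⟨x, hx⟩ ⟨y, hy⟩).trans (by rw [h1, h2, add_zero])
    | smul q x hx h1 =>
      exact ((v.coord n).map_smul q ⟨x, hx⟩).trans (by rw [h1, smul_zero])
  have h3 := hcoord (v n) (v n).2
  rw [Subtype.coe_eta, Module.Basis.coord_apply, v.repr_self, Finsupp.single_eq_same] at h3
  exact one_ne_zero h3

/-- Following the `j`-th unit vector over one period gives `cos (T w_j) = 1`. -/
theorem exists_int_of_flow_periodic {d : ℕ} {w : Fin d → ℝ} {T : ℝ}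
    (h : ∀ t z, flow w (t + T) z = flow w t z) (j : Fin d) :
    ∃ l : ℤ, T * w j = l * (2 * Real.pi) := by
  have h1 := congrArg (fun z : Phase d => z.1 j) (h 0 (EuclideanSpace.single j 1, 0))
  simp only [flow] at h1
  obtain ⟨l, hl⟩ := (Real.cos_eq_one_iff (T * w j)).1 (by simpa using h1)
  exact ⟨l, hl.symm⟩

theorem tendsto_quantized_action {I : ℝ} (hI : 0 ≤ I) (N : ℕ) :
    Tendsto (fun ħ : ℝ => ħ * (((⌊I / ħ⌋₊ + N : ℕ) : ℝ) + 1 / 2)) (𝓝[>] 0) (𝓝 I) := by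
  have h0 : Tendsto (fun ħ : ℝ => ħ * (N + 2)) (𝓝[>] 0) (𝓝 0) := by
    have h : Tendsto (fun ħ : ℝ => ħ * (N + 2)) (𝓝 0) (𝓝 (0 * (N + 2))) :=
      (continuous_id.mul continuous_const).tendsto 0
    rw [zero_mul] at h
    exact h.mono_left nhdsWithin_le_nhds
  refine tendsto_iff_dist_tendsto_zero.2 (squeeze_zero' (Eventually.of_forall fun _ => dist_nonneg)
    ?_ h0)
  filter_upwards [self_mem_nhdsWithin] with ħ hħ
  have hħ' : 0 < ħ := hħ
  have h1 := Nat.floor_le (div_nonneg hI hħ'.le)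
  have h2 := Nat.lt_floor_add_one (I / ħ)
  have h3 : (ħ * (((⌊I / ħ⌋₊ + N : ℕ) : ℝ) + 1 / 2)) - I =
      ħ * ((⌊I / ħ⌋₊ : ℝ) + N + 1 / 2 - I / ħ) := by
    push_cast
    field_simp
  rw [Real.dist_eq, h3, abs_mul, abs_of_pos hħ']
  refine mul_le_mul_of_nonneg_left ?_ hħ'.le
  have hN : (0 : ℝ) ≤ N := N.cast_nonneg
  rw [abs_le]
  constructor <;> linarith

theorem action_nonneg {d : ℕ} (z : Phase d) (j : Fin d) : 0 ≤ action z j := by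
  unfold action
  positivity

/-- Quantum numbers which approximate the actions of a point `z` and which have the same resonant
sums as given quantum numbers `k₀` that approximate the actions of a point `y` with the same
joint energy. -/
theorem exists_resonant_quantum_numbers {d m : ℕ} {ν : Fin m → Fin d → ℚ} {R : ℝ}
    (hR : ∀ δ : Fin d → ℝ, (∀ n, ∑ j, (ν n j : ℝ) * δ j = 0) →
      ∃ l : Fin d → ℤ, (∀ n, ∑ j, (ν n j : ℝ) * l j = 0) ∧ ∀ j, |(l j : ℝ) - δ j| ≤ R)
    {y z : Phase d} (hyz : ∀ n, ∑ j, (ν n j : ℝ) * (action z j - action y j) = 0) {M : ℝ} {N : ℕ}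
    (hN : M + R + 1 ≤ N) (hM : 0 ≤ M) {ħ : ℝ} (hħ : 0 < ħ) :
    ∃ k : Fin d → ℕ, (∀ j, M ≤ k j) ∧ (∀ j, |(k j : ℝ) - action z j / ħ| ≤ N + R + 1) ∧
      ∀ n, ∑ j, (ν n j : ℝ) * ((k j : ℝ) - ((⌊action y j / ħ⌋₊ + N : ℕ) : ℝ)) = 0 := by
  obtain ⟨l, hl, hlR⟩ := hR (fun j => (action z j - action y j) / ħ) fun n => by
    simp_rw [← mul_div_assoc, ← Finset.sum_div, hyz, zero_div]
  -- Flooring loses at most `1` and the lattice approximation at most `R`, so the shift `N ≥ M + R +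
  -- 1` keeps every entry above `M`; in particular it is a natural number.
  have hb : ∀ j, M ≤ ((⌊action y j / ħ⌋₊ + N : ℕ) : ℝ) + l j ∧
      |((⌊action y j / ħ⌋₊ + N : ℕ) : ℝ) + l j - action z j / ħ| ≤ N + R + 1 := by
    intro j
    have h1 := Nat.floor_le (div_nonneg (action_nonneg y j) hħ.le)
    have h2 := Nat.lt_floor_add_one (action y j / ħ)
    have h3 := abs_le.1 (hlR j)
    rw [sub_div] at h3
    have h4 := div_nonneg (action_nonneg z j) hħ.le
    have hN0 : (0 : ℝ) ≤ N := N.cast_nonneg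
    push_cast
    refine ⟨by linarith, abs_le.2 ⟨by linarith, by linarith⟩⟩
  have hk : ∀ j, ((((⌊action y j / ħ⌋₊ + N : ℕ) : ℤ) + l j).toNat : ℝ) =
      ((⌊action y j / ħ⌋₊ + N : ℕ) : ℝ) + l j := by
    intro j
    have h0 : 0 ≤ ((⌊action y j / ħ⌋₊ + N : ℕ) : ℤ) + l j := by
      have := hM.trans (hb j).1
      exact_mod_cast this
    have h1 := Int.toNat_of_nonneg h0
    exact_mod_cast congrArg (Int.cast : ℤ → ℝ) h1
  refine ⟨fun j => (((⌊action y j / ħ⌋₊ + N : ℕ) : ℤ) + l j).toNat, fun j => ?_, fun j => ?_,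
    fun n => ?_⟩
  · rw [hk]
    exact (hb j).1
  · rw [hk]
    exact (hb j).2
  · simp_rw [hk, add_sub_cancel_left]
    exact hl n

end QHO

end

/-! ### Assembly. -/

theorem lemma2p1 (d : ℕ) (ω : Fin d → ℝ) (hω : ∀ j, 0 < ω j)
    (v : Module.Basis (Fin (QHO.freqRank ω)) ℚ (QHO.freqSpan ω))
    (ν : Fin (QHO.freqRank ω) → Fin d → ℚ)
    (hν : ∀ j, ω j = ∑ n, (v n : ℝ) * (ν n j : ℝ))
    (E : Fin (QHO.freqRank ω) → ℝ) (hE : E ∈ QHO.energySet v ν) :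
    ∃ ħ₀ : ℝ, 0 < ħ₀ ∧ ∃ Λ : ℝ → Fin (QHO.freqRank ω) → ℝ,
      Tendsto Λ (𝓝[>] 0) (𝓝 E) ∧
      ∀ z₀ : QHO.Phase d, QHO.momentMap v ν z₀ = E →
        ∃ Ψ : ℝ → 𝓢(QHO.Conf d, ℂ),
          (∀ ħ ∈ Set.Ioc 0 ħ₀,
            (∀ n x, QHO.oscillator (QHO.partFreq v ν n) ħ (Ψ ħ) x = (Λ ħ n : ℂ) * Ψ ħ x) ∧
            ∫ x, ‖Ψ ħ x‖ ^ 2 = 1) ∧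
          ∀ a : QHO.Phase d → ℂ, ContDiff ℝ ((⊤ : ℕ∞) : WithTop ℕ∞) a → HasCompactSupport a →
            (fun ħ : ℝ => QHO.l2inner (Ψ ħ) (QHO.weylOp ħ a (Ψ ħ)) -
                QHO.torusAverage (QHO.partFreq v ν) a z₀)
              =O[𝓝[>] 0] fun ħ : ℝ => ħ ^ (1 / 2 : ℝ) := by
  obtain ⟨y, -, rfl⟩ := hE
  obtain ⟨R, hR0, hR⟩ := QHO.exists_lattice_approx ν
  -- Large enough for the lower bound on the mass of the kernel and independent of `ħ`; the summand
  -- `1` keeps it positive when `d = 0`.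
  set M : ℝ := (648 * d * 2 ^ d) ^ 2 + 1 with hM
  have hM0 : 0 < M := by positivity
  have hM' : 648 * d * 2 ^ d ≤ Real.sqrt M := Real.le_sqrt_of_sq_le (by rw [hM]; linarith)
  obtain ⟨N, hN⟩ := exists_nat_ge (M + R + 1)
  have hper := fun n => QHO.period_spec (v n : ℝ) (ν n) (QHO.partFreq v ν n) (fun _ => rfl)
    (QHO.partFreq_ne_zero v ν hν n)
  have hT : ∀ n, 0 < QHO.period (QHO.partFreq v ν n) := fun n => (hper n).1
  have hw : ∀ n j, ∃ l : ℤ, QHO.period (QHO.partFreq v ν n) * QHO.partFreq v ν n j =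
      l * (2 * Real.pi) := fun n j => QHO.exists_int_of_flow_periodic (hper n).2 j
  have hpos : ∀ j, 0 < ∑ n, QHO.partFreq v ν n j := fun j => (hω j).trans_eq (hν j)
  -- The eigenvalues use only the reference point `y`, so they serve the whole fibre. The estimates
  -- hold for every `ħ > 0`, so `ħ₀ = 1` is arbitrary.
  refine ⟨1, one_pos, fun ħ n => ∑ j, QHO.partFreq v ν n j *
    (ħ * (((⌊QHO.action y j / ħ⌋₊ + N : ℕ) : ℝ) + 1 / 2)), ?_, fun z hz => ?_⟩
  · refine tendsto_pi_nhds.2 fun n => tendsto_finsetSum _ fun j _ => ?_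
    exact (QHO.tendsto_quantized_action (QHO.action_nonneg y j) N).const_mul _
  -- Cancelling `v n` in each component of the moment map turns equality of energies into a system
  -- with rational coefficients.
  have hyz : ∀ n, ∑ j, (ν n j : ℝ) * (QHO.action z j - QHO.action y j) = 0 := by
    intro n
    have h : ∑ j, QHO.partFreq v ν n j * QHO.action z j =
        ∑ j, QHO.partFreq v ν n j * QHO.action y j := congrFun hz n
    simp only [QHO.partFreq, mul_assoc, ← Finset.mul_sum] at h
    simp_rw [mul_sub, Finset.sum_sub_distrib]
    exact sub_eq_zero.2 (mul_left_cancel₀ (QHO.coe_basis_ne_zero v n) h)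
  choose! k hkM hkB hkν using fun (ħ : ℝ) (hħ : 0 < ħ) =>
    QHO.exists_resonant_quantum_numbers hR hyz hN hM0.le hħ
  obtain ⟨Ψ, hΨ, hconc⟩ := QHO.exists_concentrating_eigenfunctions hT hw hpos z hM0 hM' k hkM hkB
  refine ⟨Ψ, fun ħ hħ => ⟨fun n x => ?_, (hΨ ħ hħ.1).2⟩, fun a ha hc => ?_⟩
  · rw [(hΨ ħ hħ.1).1 n x]
    congr 2
    -- The two eigenvalues differ by `v_n ħ` times a resonant sum, which vanishes.
    rw [← sub_eq_zero, ← Finset.sum_sub_distrib,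
      ← mul_zero ((v n : ℝ) * ħ), ← hkν ħ hħ.1 n, Finset.mul_sum]
    refine Finset.sum_congr rfl fun j _ => ?_
    rw [QHO.partFreq]
    ring
  · obtain ⟨C, hC⟩ := hconc a ha hc
    refine IsBigO.of_bound C ?_
    filter_upwards [self_mem_nhdsWithin] with ħ hħ
    rw [QHO.torusAverage, ← QHO.integral_boxMeasure hT, ← Real.sqrt_eq_rpow, Real.norm_eq_abs,
      abs_of_nonneg (Real.sqrt_nonneg ħ)]
    exact hC ħ hħ
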